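/- **Setting.** Consider a sequence of linear regression problems (with index suppressed) $y=X\beta_0+\varepsilon$, where $X=(x_1,\dots,x_p)$ is a deterministic $n\times p$ matrix with $\|x_j\|_2=\sqrt n$ for all $j$ and $\varepsilon\sim N(0,\sigma^2I_n)$, $\sigma>0$. Let $s=\|\beta_0\|_0$ be the number of nonzero components of $\beta_0$, $b_0=\min\{|\beta_{0,j}|:\beta_{0,j}\ne0\}$ and $\widetilde p=\max(n,p)$. For $c>0$, let $M$ (the robust spark) be the smallest $\tau$ such that some $\tau$ columns of $n^{-1/2}X$ form a matrix with a singular value less than $c$ ($M=\infty$ if there is none). Let $\sigma$, $c$, $c_2\ge\sqrt{10}\,\sigma$, $c_3>0$ and $b>0$ be constants, and assume that: * $s<M/2$, $s=o(n)$ and $b_0>\max(\sqrt{16/c^2},1)\,c^{-1}c_2\sqrt{(2s+1)(\log\widetilde p)/n}$; * $c^{-1}c_2\sqrt{(2s+1)(\log\widetilde p)/n}<\lambda<b_0\min(1,\sqrt{c^2/2})$; * $\|\beta_0\|_2\ge b$, and $n^{-1/2}\|X\delta\|_2\le c_3$ whenever $\|\delta\|_0<M/2$ and $\|\delta\|_2=1$.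 Let $\widehat\beta$ be a global minimizer of $(2n)^{-1}\|y-X\beta\|_2^2+\sum_jp_\lambda(|\beta_j|)$ over $\{\beta:\|\beta\|_0<M/2\}$, where $p_\lambda(t)$ is either the hard-thresholding penalty $\frac12[\lambda^2-(\lambda-t)_+^2]$ or the $L_0$-penalty $\frac12\lambda^21_{\{t\neq0\}}$. Let $X_1$ consist of the $s_1$ columns of $X$ in $\mathrm{supp}(\widehat\beta)$. For $\lambda_1\ge0$ let $\widehat\beta_{\rm refitted}=(X_1^\top X_1+\lambda_1I_{s_1})^{-1}X_1^\top y$ on $\mathrm{supp}(\widehat\beta)$, and $0$ elsewhere. Let $X_0$ consist of the columns of $X$ in $\mathrm{supp}(\beta_0)$, let $X_0^\top X_0=P^\top DP$ be an eigendecomposition ($P$ orthogonal, $D=\mathrm{diag}(d_1,\dots,d_s)$) and $\lambda_{\min},\lambda_{\max}$ its extreme eigenvalues, and let $(b_1,\dots,b_s)^\top=P\beta_{0,1}$, where $\beta_{0,1}$ is the vector of nonzero components of $\beta_0$. For the sharp assertions marked $(*)$, assume in addition that $c_2$ is large enough for the level of signal strength, in the sense that $\widetilde p^{\,1/2-c_2^2/(4\sigma^2)}\|\beta_0\|_2^4\le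 K s^2n^{-2}$ for a constant $K$. (As $c_2\ge\sqrt{10}\,\sigma$, this holds automatically if $\|\beta_0\|_2$ is bounded above; if $\|\beta_0\|_2=O(\widetilde p^{\,\kappa})$, it holds once $c_2^2\ge(10+16\kappa)\sigma^2$.) **Theorem.** All constants in $O(\cdot)$ below depend only on $\sigma,c,c_2,c_3,b,K$. For all sufficiently late members of the sequence the losses below are integrable for every $\lambda_1\ge0$, all the minima over $\lambda_1\ge0$ are attained, and: (a) *($L_2$-risk)* The minimum of $E\|\widehat\beta_{\rm refitted}-\beta_0\|_2^2$ is $O(s/n)+O(s^2n^{-2}\|\beta_0\|_2^{-2})$. $(*)$ Every minimizer is of the form $\lambda_{1,\rm opt}=L+O(s^2n^{-1}\|\beta_0\|_2^{-4})$ with leading term $L=O(s\|\beta_0\|_2^{-2})$ satisfying $$s\sigma^2\|\beta_0\|_2^{-2}(\lambda_{\min}/\lambda_{\max})^2\le L\le s\sigma^2\|\beta_0\|_2^{-2}(\lambda_{\max}/\lambda_{\min})^2,$$ and the minimum equals $\sum_{j=1}^s\frac{\lambda_{1,\rm opt}^2b_j^2+d_j\sigma^2}{(d_j+\lambda_{1,\rm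 opt})^2}+O(s^2n^{-2}\|\beta_0\|_2^{-2})$, where the sum is $O(s/n)$. (b) *($L_q$-risk)* The minimum of $E\|\widehat\beta_{\rm refitted}-\beta_0\|_q^q$ is $O(s/n^{q/2})+O(s^2\|\beta_0\|_2^{-2}/n^{q/2+1})$, uniformly in $q\in[1,2]$, and the minimum of $E\|\widehat\beta_{\rm refitted}-\beta_0\|_\infty$ is $O(s^{1/2}/n^{1/2})+O(s^{3/2}\|\beta_0\|_2^{-2}/n^{3/2})$. (c) *(Prediction risk)* The minimum of $n^{-1}E\|X(\widehat\beta_{\rm refitted}-\beta_0)\|_2^2$ is $O(s/n)+O(s^2n^{-2}\|\beta_0\|_2^{-2})$. $(*)$ Every minimizer is of the form $\lambda_{1,\rm opt}'=L'+O(s^2n^{-1}\|\beta_0\|_2^{-4})$ with leading term $L'=O(s\|\beta_0\|_2^{-2})$ satisfying $$s\sigma^2\|\beta_0\|_2^{-2}\lambda_{\min}/\lambda_{\max}\le L'\le s\sigma^2\|\beta_0\|_2^{-2}\lambda_{\max}/\lambda_{\min},$$ and the minimum equals $n^{-1}\sum_{j=1}^s\frac{(\lambda_{1,\rm opt}')^2b_j^2d_j+d_j^2\sigma^2}{(d_j+\lambda_{1,\rm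 opt}')^2}+O(s^2n^{-2}\|\beta_0\|_2^{-2})$, where the whole expression $n^{-1}\sum$ is $O(s/n)$. -/

import Mathlib

open MeasureTheory ProbabilityTheory Filter Matrix
open scoped ENNReal Topology

noncomputable section

namespace ThresholdedRegression

/-- The support of a vector. -/
def supp {p : ℕ} (β : Fin p → ℝ) : Finset (Fin p) := {j | β j ≠ 0}

/-- The number of nonzero components of a vector. -/
def l0 {p : ℕ} (β : Fin p → ℝ) : ℕ := (supp β).card

/-- The Euclidean norm of a vector. -/
def l2 {m : ℕ} (v : Fin m → ℝ) : ℝ := ‖WithLp.toLp 2 v‖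

/-- The submatrix of `X` with columns in `S`. -/
def cols {n p : ℕ} (X : Matrix (Fin n) (Fin p) ℝ) (S : Finset (Fin p)) : Matrix (Fin n) S ℝ :=
  X.submatrix id (fun j => (j : Fin p))

/-- The Gram matrix `X_Sᵀ X_S` of the columns in `S`. -/
def gram {n p : ℕ} (X : Matrix (Fin n) (Fin p) ℝ) (S : Finset (Fin p)) : Matrix S S ℝ :=
  (cols X S)ᵀ * cols X S

/-- `t` is a singular value of `A`, i.e. a square root of an eigenvalue of `Aᵀ A`
(so a matrix with linearly dependent columns has the singular value `0`). -/
def IsSingularValue {ι κ : Type*} [Fintype ι] [Fintype κ] [DecidableEq κ]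
    (A : Matrix ι κ ℝ) (t : ℝ) : Prop :=
  0 ≤ t ∧ Module.End.HasEigenvalue (Matrix.toLin' (Aᵀ * A)) (t ^ 2)

/-- Robust spark with bound `c`: the smallest number of columns of `n^{-1/2} X` whose submatrix
has a singular value less than `c` (and `⊤` if there is no such set of columns). -/
def rspark {n p : ℕ} (c : ℝ) (X : Matrix (Fin n) (Fin p) ℝ) : ℕ∞ :=
  sInf {τ : ℕ∞ | ∃ S : Finset (Fin p), (S.card : ℕ∞) = τ ∧
    ∃ t, IsSingularValue ((√(n : ℝ))⁻¹ • cols X S) t ∧ t < c}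

/-- Smallest real eigenvalue of a matrix. -/
def minEig {κ : Type*} [Fintype κ] [DecidableEq κ] (A : Matrix κ κ ℝ) : ℝ :=
  sInf {t : ℝ | Module.End.HasEigenvalue (Matrix.toLin' A) t}

/-- Largest real eigenvalue of a matrix. -/
def maxEig {κ : Type*} [Fintype κ] [DecidableEq κ] (A : Matrix κ κ ℝ) : ℝ :=
  sSup {t : ℝ | Module.End.HasEigenvalue (Matrix.toLin' A) t}

/-- Hard-thresholding penalty, for `t ≥ 0`. -/
def hardPenalty (lam t : ℝ) : ℝ := (lam ^ 2 - (max (lam - t) 0) ^ 2) / 2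

/-- `L₀`-penalty, for `t ≥ 0`. -/
def l0Penalty (lam t : ℝ) : ℝ := if t ≠ 0 then lam ^ 2 / 2 else 0

/-- Penalized residual sum of squares
`(2n)⁻¹ ‖y - Xβ‖₂² + ∑ⱼ pen_lam(|βⱼ|)`. -/
def penLS {n p : ℕ} (pen : ℝ → ℝ → ℝ) (lam : ℝ) (X : Matrix (Fin n) (Fin p) ℝ)
    (y : Fin n → ℝ) (β : Fin p → ℝ) : ℝ :=
  (2 * (n : ℝ))⁻¹ * l2 (y - X *ᵥ β) ^ 2 + ∑ j, pen lam |β j|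

/-- The union of coordinate subspaces `{β : ‖β‖₀ < M / 2}`. -/
def sparseVectors (p : ℕ) (M : ℕ∞) : Set (Fin p → ℝ) := {β | 2 * (l0 β : ℕ∞) < M}

/-- The response vector `y = X β₀ + ε`. -/
def response {n p : ℕ} {Ω : Type*} (X : Matrix (Fin n) (Fin p) ℝ) (β₀ : Fin p → ℝ)
    (ε : Ω → Fin n → ℝ) (ω : Ω) : Fin n → ℝ :=
  X *ᵥ β₀ + ε ω

/-- The smallest signal strength `b₀ = min {|β₀ⱼ| : β₀ⱼ ≠ 0}`. -/
def minSignal {p : ℕ} (β₀ : Fin p → ℝ) : ℝ := ⨅ j : supp β₀, |β₀ j|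

/-- `p̃ = n ∨ p`, as a real number. -/
def ptilde (n p : ℕ) : ℝ := max (n : ℝ) (p : ℝ)

/-- All the conditions on one regression problem: the errors are `N(0, σ² Iₙ)`, the covariates are
rescaled to norm `√n`, the model is sparse relative to the robust spark, the signals are strong
enough, `‖β₀‖₂` is bounded below by `b`, sparse singular values are bounded above by `c₃`, the
regularization parameter `lam` lies in the admissible range, and `βhat` is a (measurable) global
minimizer of the penalized least squares over `{β : ‖β‖₀ < M / 2}`. -/
structure Conditions {n p : ℕ} {Ω : Type*} [MeasurableSpace Ω]
    (σ c c₂ c₃ b : ℝ) (pen : ℝ → ℝ → ℝ) (μ : Measure Ω)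
    (X : Matrix (Fin n) (Fin p) ℝ) (β₀ : Fin p → ℝ) (ε : Ω → Fin n → ℝ)
    (lam : ℝ) (βhat : Ω → Fin p → ℝ) : Prop where
  column_norm : ∀ j, l2 (fun i => X i j) = √(n : ℝ)
  gaussian : HasLaw ε (Measure.pi fun _ : Fin n => gaussianReal 0 (σ ^ 2).toNNReal) μ
  sparse : 2 * (l0 β₀ : ℕ∞) < rspark c X
  signal : max √(16 / c ^ 2) 1 * c⁻¹ * c₂ * √((2 * l0 β₀ + 1) * Real.log (ptilde n p) / n)
    < minSignal β₀
  norm_lower : b ≤ l2 β₀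
  sparse_upper : ∀ δ : Fin p → ℝ, 2 * (l0 δ : ℕ∞) < rspark c X → l2 δ = 1 →
    (√(n : ℝ))⁻¹ * l2 (X *ᵥ δ) ≤ c₃
  lam_lower : c⁻¹ * c₂ * √((2 * l0 β₀ + 1) * Real.log (ptilde n p) / n) < lam
  lam_upper : lam < minSignal β₀ * min 1 √(c ^ 2 / 2)
  measurable : AEMeasurable βhat μ
  feasible : ∀ᵐ ω ∂μ, βhat ω ∈ sparseVectors p (rspark c X)
  minimizer : ∀ᵐ ω ∂μ, IsMinOn (penLS pen lam X (response X β₀ ε ω))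
    (sparseVectors p (rspark c X)) (βhat ω)

/-- Ridge regression with parameter `l` on the columns in `S`:
`(X_Sᵀ X_S + l I)⁻¹ X_Sᵀ y` on `S`, and zero outside `S`. -/
def ridge {n p : ℕ} (X : Matrix (Fin n) (Fin p) ℝ) (S : Finset (Fin p)) (l : ℝ)
    (y : Fin n → ℝ) : Fin p → ℝ := fun j =>
  if h : j ∈ S then ((gram X S + l • (1 : Matrix S S ℝ))⁻¹ *ᵥ ((cols X S)ᵀ *ᵥ y)) ⟨j, h⟩ else 0

/-- The estimation error of the `L₂`-regularized refitted estimator with ridge parameter `l`,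
computed on the support of `βhat`. -/
def refitError {n p : ℕ} {Ω : Type*} (X : Matrix (Fin n) (Fin p) ℝ) (β₀ : Fin p → ℝ)
    (ε : Ω → Fin n → ℝ) (βhat : Ω → Fin p → ℝ) (l : ℝ) (ω : Ω) : Fin p → ℝ :=
  ridge X (supp (βhat ω)) l (response X β₀ ε ω) - β₀

/-- Squared `L₂`-loss. -/
def sqLoss {p : ℕ} (v : Fin p → ℝ) : ℝ := l2 v ^ 2

/-- The loss `‖v‖_q^q`. -/
def lqLoss {p : ℕ} (q : ℝ) (v : Fin p → ℝ) : ℝ := ∑ j, |v j| ^ q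

/-- `L_∞`-loss (`‖·‖` on `Fin p → ℝ` is the maximum norm). -/
def supLoss {p : ℕ} (v : Fin p → ℝ) : ℝ := ‖v‖

/-- Prediction loss `n⁻¹ ‖X v‖₂²`. -/
def predLoss {n p : ℕ} (X : Matrix (Fin n) (Fin p) ℝ) (v : Fin p → ℝ) : ℝ :=
  (n : ℝ)⁻¹ * l2 (X *ᵥ v) ^ 2

/-- Risk: the expectation of the loss of a random error vector. -/
def risk {p : ℕ} {Ω : Type*} [MeasurableSpace Ω] (μ : Measure Ω) (loss : (Fin p → ℝ) → ℝ)
    (err : Ω → Fin p → ℝ) : ℝ := ∫ ω, loss (err ω) ∂μ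

/-- The risk of `err l` is finite for all ridge parameters `l ≥ 0`, and its minimum over `l ≥ 0`
is attained at `l`. -/
def IsOptimalRidge {p : ℕ} {Ω : Type*} [MeasurableSpace Ω] (μ : Measure Ω)
    (loss : (Fin p → ℝ) → ℝ) (err : ℝ → Ω → Fin p → ℝ) (l : ℝ) : Prop :=
  (∀ l' : ℝ, 0 ≤ l' → Integrable (fun ω => loss (err l' ω)) μ) ∧
  0 ≤ l ∧ ∀ l' : ℝ, 0 ≤ l' → risk μ loss (err l) ≤ risk μ loss (err l')

/-- `A = Pᵀ diag(d) P` with `P` orthogonal. -/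
def IsEigendecomposition {κ : Type*} [Fintype κ] [DecidableEq κ] (A P : Matrix κ κ ℝ)
    (d : κ → ℝ) : Prop :=
  P ∈ Matrix.orthogonalGroup κ ℝ ∧ A = Pᵀ * Matrix.diagonal d * P

/-- The vector `P β₀,₁`, where `β₀,₁` is the subvector of nonzero components of `β₀`. -/
def rotated {p : ℕ} (β₀ : Fin p → ℝ) (P : Matrix (supp β₀) (supp β₀) ℝ) : supp β₀ → ℝ :=
  P *ᵥ (fun j => β₀ j)

end ThresholdedRegression

end

/-!
# Risks of the ridge-refitted thresholded estimator

Outside `badEvent`, where the noise is noticeably correlated with some covariate, the global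
minimizer has exactly the support of `β₀` (`Conditions.ae_supp_eq`): comparing the objective at the
minimizer and at `β₀`, and using that sparse submatrices of `X` are well conditioned, every wrongly
included covariate and every missed signal costs more than it can gain. The event has probability
at most `2 * ptilde ^ (1 - c₂² / (2σ²))` by the Gaussian tail bound and a union over the covariates.

Hence the refitted estimator is, up to the bad event, ridge regression on the true support. For a
quadratic loss that is diagonal in the eigenbasis of `X₀ᵀ X₀`, with weights `w`, its risk is the
explicit function
`leadRisk l = ∑ j, w j * (l² * b j² + d j * σ²) / (d j + l)²` (`risk_oracle`). The true risk differs
from it by `remainder l`, an integral over the bad event. Both `remainder` and its Lipschitz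
constant in `l` are bounded through `badMass`, by the Cauchy–Schwarz inequality and the fourth moment
of the noise; under the level condition on `c₂` they are `O(s² / (n² ‖β₀‖²))` and
`O(s² / (n³ ‖β₀‖²))` (`abs_remainder_le`, `abs_remainder_sub_le`).

The upper bounds for the minimal risks come from `l = 0`. There the error of refitting on any
support is controlled by the noise alone, without `‖β₀‖` (`Conditions.ae_refitError_zero_le`): the
minimizer has a residual not much larger than the noise, and least squares on its support has an
even smaller one. So the risk at `0` is `O(s / n)` even without the level condition
(`risk_zero_le`), and the `L_q`- and `L_∞`-risks follow by comparison with the squared loss and the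
expected size of the support.

The minimum over `l ≥ 0` is attained because the risk is continuous and tends, as `l → ∞`, to the
loss of the zero estimator, which exceeds the risk at `0` (`exists_isOptimalRidge`). To locate the
minimizers, the derivative of `leadRisk` is compared with that of a quadratic function of `l`:
since `d j` is of order `n`, `leadRisk` is minimal near
`leadOpt = σ² * (∑ w j / d j²) / ∑ w j * b j² / d j²`, and it grows steeply enough away from it for
a perturbation with the above Lipschitz constant to move a minimizer by `O(s² / (n ‖β₀‖⁴))` only
(`abs_sub_leadOpt_le`). As the `w j / d j²` lie between two functions of the extreme eigenvalues,
`leadOpt` is within the stated range of `s * σ² / ‖β₀‖²` (`leadOpt_mem`).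
-/


noncomputable section

namespace ThresholdedRegression

/-! ### Euclidean norms, sparse vectors and eigendecompositions -/

lemma l2_sq {m : ℕ} (v : Fin m → ℝ) : l2 v ^ 2 = v ⬝ᵥ v := by
  simp only [l2, EuclideanSpace.norm_sq_eq, dotProduct]
  exact Finset.sum_congr rfl fun i _ => by simp [sq]

lemma l2_nonneg {m : ℕ} (v : Fin m → ℝ) : 0 ≤ l2 v := norm_nonneg _

lemma l2_add_le {m : ℕ} (u v : Fin m → ℝ) : l2 (u + v) ≤ l2 u + l2 v := by
  simpa [l2] using norm_add_le (WithLp.toLp 2 u) (WithLp.toLp 2 v)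

lemma l2_sub_le {m : ℕ} (u v : Fin m → ℝ) : l2 (u - v) ≤ l2 u + l2 v := by
  simpa [l2] using norm_sub_le (WithLp.toLp 2 u) (WithLp.toLp 2 v)

lemma l2_smul {m : ℕ} (a : ℝ) (v : Fin m → ℝ) : l2 (a • v) = |a| * l2 v := by
  simp [l2, norm_smul]

lemma l2_neg {m : ℕ} (v : Fin m → ℝ) : l2 (-v) = l2 v := by
  simp [l2]

lemma l2_zero {m : ℕ} : l2 (0 : Fin m → ℝ) = 0 := by
  simp [l2]

lemma l2_sq_eq_sum {m : ℕ} (v : Fin m → ℝ) : l2 v ^ 2 = ∑ i, v i ^ 2 := by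
  rw [l2_sq]
  exact Finset.sum_congr rfl fun i _ => by rw [sq]

lemma abs_apply_le_l2 {m : ℕ} (v : Fin m → ℝ) (i : Fin m) : |v i| ≤ l2 v := by
  simpa [l2] using PiLp.norm_apply_le (WithLp.toLp 2 v) i

lemma continuous_l2 {m : ℕ} : Continuous (l2 : (Fin m → ℝ) → ℝ) := by
  unfold l2; fun_prop

lemma dotProduct_le_l2 {m : ℕ} (u v : Fin m → ℝ) : u ⬝ᵥ v ≤ l2 u * l2 v := by
  have := real_inner_le_norm (WithLp.toLp 2 v) (WithLp.toLp 2 u)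
  simp only [EuclideanSpace.inner_toLp_toLp, star_trivial] at this
  rw [mul_comm]
  exact this

lemma abs_dotProduct_le_l2 {m : ℕ} (u v : Fin m → ℝ) : |u ⬝ᵥ v| ≤ l2 u * l2 v := by
  refine abs_le.2 ⟨?_, dotProduct_le_l2 u v⟩
  have := dotProduct_le_l2 (-u) v
  rw [neg_dotProduct, l2_neg] at this
  linarith

lemma l2_eq_zero {m : ℕ} {v : Fin m → ℝ} : l2 v = 0 ↔ v = 0 := by
  simp [l2]

lemma mem_supp {p : ℕ} {β : Fin p → ℝ} {j : Fin p} : j ∈ supp β ↔ β j ≠ 0 := by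
  simp [supp]

/-- The vector on `Fin p` that extends `v` by zero outside `S`. -/
def extend {p : ℕ} (S : Finset (Fin p)) (v : S → ℝ) : Fin p → ℝ :=
  fun j => if h : j ∈ S then v ⟨j, h⟩ else 0

lemma supp_extend_subset {p : ℕ} (S : Finset (Fin p)) (v : S → ℝ) : supp (extend S v) ⊆ S := by
  intro j hj
  by_contra h
  simp [mem_supp, extend, h] at hj

lemma extend_restrict {p : ℕ} {S : Finset (Fin p)} {u : Fin p → ℝ} (h : supp u ⊆ S) :
    extend S (fun j => u j) = u := by
  ext j
  by_cases hj : j ∈ S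
  · simp [extend, hj]
  · have : u j = 0 := by
      by_contra h0
      exact hj (h (mem_supp.2 h0))
    simp [extend, hj, this]

lemma sum_extend_mul {p : ℕ} (S : Finset (Fin p)) (v : S → ℝ) (f : Fin p → ℝ) :
    ∑ j, f j * extend S v j = ∑ j : S, f j * v j := by
  rw [← Finset.sum_subset (Finset.subset_univ S), ← Finset.sum_coe_sort S]
  · exact Finset.sum_congr rfl fun j _ => by simp [extend]
  · intro j _ hj
    simp [extend, hj]

lemma mulVec_extend {n p : ℕ} (X : Matrix (Fin n) (Fin p) ℝ) (S : Finset (Fin p)) (v : S → ℝ) :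
    X *ᵥ extend S v = cols X S *ᵥ v := by
  ext i
  simp only [mulVec, dotProduct, cols, submatrix_apply, id]
  exact sum_extend_mul S v (X i)

lemma dotProduct_extend {p : ℕ} (S : Finset (Fin p)) (u v : S → ℝ) :
    extend S u ⬝ᵥ extend S v = u ⬝ᵥ v := by
  simp only [dotProduct]
  rw [sum_extend_mul]
  exact Finset.sum_congr rfl fun j _ => by simp [extend]

lemma mulVec_dotProduct_mulVec {ι κ : Type*} [Fintype ι] [Fintype κ] (A : Matrix ι κ ℝ)
    (u v : κ → ℝ) : (A *ᵥ u) ⬝ᵥ (A *ᵥ v) = u ⬝ᵥ ((Aᵀ * A) *ᵥ v) := by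
  rw [← mulVec_mulVec, dotProduct_mulVec u, vecMul_transpose]

section Eigen

variable {κ : Type*} [Fintype κ] [DecidableEq κ]

lemma exists_isEigendecomposition {A : Matrix κ κ ℝ} (hA : Aᵀ = A) :
    ∃ P d, IsEigendecomposition A P d := by
  have hH : A.IsHermitian := by rw [IsHermitian, conjTranspose_eq_transpose_of_trivial, hA]
  refine ⟨((hH.eigenvectorUnitary : Matrix κ κ ℝ))ᵀ, hH.eigenvalues, ?_, ?_⟩
  · have := Unitary.star_mem hH.eigenvectorUnitary.2
    rw [star_eq_conjTranspose, conjTranspose_eq_transpose_of_trivial] at this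
    exact this
  · have := hH.spectral_theorem
    rw [Unitary.conjStarAlgAut_apply] at this
    conv_lhs => rw [this]
    rw [star_eq_conjTranspose, conjTranspose_eq_transpose_of_trivial, transpose_transpose]
    rfl

variable {A P : Matrix κ κ ℝ} {d : κ → ℝ}

lemma IsEigendecomposition.mul_transpose (h : IsEigendecomposition A P d) : P * Pᵀ = 1 := by
  have := (mem_orthogonalGroup_iff κ ℝ).1 h.1
  exact this

lemma IsEigendecomposition.transpose_mul (h : IsEigendecomposition A P d) : Pᵀ * P = 1 :=
  mul_eq_one_comm.1 h.mul_transpose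

lemma IsEigendecomposition.mul_eq (h : IsEigendecomposition A P d) :
    P * A = Matrix.diagonal d * P := by
  rw [h.2, ← Matrix.mul_assoc, ← Matrix.mul_assoc, h.mul_transpose, Matrix.one_mul]

lemma IsEigendecomposition.hasEigenvalue (h : IsEigendecomposition A P d) (j : κ) :
    Module.End.HasEigenvalue (Matrix.toLin' A) (d j) := by
  have hne : Pᵀ *ᵥ Pi.single j (1 : ℝ) ≠ 0 := by
    intro h0
    have h1 : P *ᵥ (Pᵀ *ᵥ Pi.single j (1 : ℝ)) = 0 := by rw [h0, mulVec_zero]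
    rw [mulVec_mulVec, h.mul_transpose, one_mulVec] at h1
    have := congrFun h1 j
    simp at this
  refine Module.End.hasEigenvalue_of_hasEigenvector (x := Pᵀ *ᵥ Pi.single j (1 : ℝ)) ?_
  refine Module.End.hasEigenvector_iff.2 ⟨?_, hne⟩
  rw [Module.End.mem_eigenspace_iff, toLin'_apply, h.2, mulVec_mulVec, Matrix.mul_assoc,
    h.mul_transpose, Matrix.mul_one, ← mulVec_mulVec, diagonal_mulVec_single, mul_one,
    ← mulVec_smul]
  congr 1
  ext i
  by_cases hi : i = j
  · subst hi; simp
  · simp [hi]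

lemma IsEigendecomposition.dotProduct_self (h : IsEigendecomposition A P d) (v : κ → ℝ) :
    v ⬝ᵥ v = ∑ j, (P *ᵥ v) j ^ 2 := by
  have := mulVec_dotProduct_mulVec P v v
  rw [h.transpose_mul, one_mulVec] at this
  rw [← this]
  simp [dotProduct, sq]

lemma IsEigendecomposition.dotProduct_mulVec_self (h : IsEigendecomposition A P d) (v : κ → ℝ) :
    v ⬝ᵥ (A *ᵥ v) = ∑ j, d j * (P *ᵥ v) j ^ 2 := by
  have : v ⬝ᵥ (A *ᵥ v) = (P *ᵥ v) ⬝ᵥ (P *ᵥ (A *ᵥ v)) := by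
    rw [mulVec_dotProduct_mulVec, h.transpose_mul, one_mulVec]
  rw [this, mulVec_mulVec, h.mul_eq, ← mulVec_mulVec]
  simp only [dotProduct, mulVec_diagonal]
  exact Finset.sum_congr rfl fun j _ => by ring

/-- A real eigenvalue is the Rayleigh quotient of some nonzero vector. -/
lemma exists_rayleigh {t : ℝ} (h : Module.End.HasEigenvalue (Matrix.toLin' A) t) :
    ∃ v : κ → ℝ, 0 < v ⬝ᵥ v ∧ v ⬝ᵥ (A *ᵥ v) = t * (v ⬝ᵥ v) := by
  obtain ⟨v, hv⟩ := h.exists_hasEigenvector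
  refine ⟨v, ?_, ?_⟩
  · have h0 : v ⬝ᵥ v ≠ 0 := fun h0 => hv.2 (dotProduct_self_eq_zero.1 h0)
    have h1 : 0 ≤ v ⬝ᵥ v := by
      simp only [dotProduct]; exact Finset.sum_nonneg fun i _ => mul_self_nonneg _
    exact lt_of_le_of_ne h1 (Ne.symm h0)
  · have := hv.apply_eq_smul
    rw [toLin'_apply] at this
    rw [this, dotProduct_smul, smul_eq_mul]

end Eigen

section Design

variable {n p : ℕ} {c c₃ : ℝ} {X : Matrix (Fin n) (Fin p) ℝ}

lemma gram_transpose (X : Matrix (Fin n) (Fin p) ℝ) (S : Finset (Fin p)) :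
    (gram X S)ᵀ = gram X S := by
  simp [gram, transpose_mul]

/-- Below the robust spark, all singular values of `n^{-1/2} X_S` are at least `c`. -/
lemma sparse_lower_cols (hc : 0 < c) (hn : 0 < n) {S : Finset (Fin p)}
    (hS : (S.card : ℕ∞) < rspark c X) (v : S → ℝ) :
    c ^ 2 * n * (v ⬝ᵥ v) ≤ (cols X S *ᵥ v) ⬝ᵥ (cols X S *ᵥ v) := by
  have hn' : (0 : ℝ) < n := by exact_mod_cast hn
  set A : Matrix (Fin n) S ℝ := (√(n : ℝ))⁻¹ • cols X S with hA
  obtain ⟨P, d, hP⟩ := exists_isEigendecomposition (A := Aᵀ * A) (by simp [transpose_mul])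
  have hd : ∀ j, c ^ 2 ≤ d j := by
    intro j
    have hj := hP.hasEigenvalue j
    have h0 : 0 ≤ d j := by
      obtain ⟨x, hx, hx'⟩ := exists_rayleigh hj
      rw [← mulVec_dotProduct_mulVec] at hx'
      have : 0 ≤ (A *ᵥ x) ⬝ᵥ (A *ᵥ x) := by
        simp only [dotProduct]; exact Finset.sum_nonneg fun i _ => mul_self_nonneg _
      rw [hx'] at this
      exact nonneg_of_mul_nonneg_left this hx
    by_contra hlt
    rw [not_le] at hlt
    refine absurd hS (not_lt.2 (sInf_le ⟨S, rfl, √(d j), ⟨Real.sqrt_nonneg _, ?_⟩, ?_⟩))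
    · rw [Real.sq_sqrt h0]; exact hj
    · rw [Real.sqrt_lt h0 hc.le]; exact hlt
  have h1 : c ^ 2 * (v ⬝ᵥ v) ≤ (A *ᵥ v) ⬝ᵥ (A *ᵥ v) := by
    rw [mulVec_dotProduct_mulVec, hP.dotProduct_mulVec_self, hP.dotProduct_self, Finset.mul_sum]
    exact Finset.sum_le_sum fun j _ => mul_le_mul_of_nonneg_right (hd j) (sq_nonneg _)
  have h2 : (A *ᵥ v) ⬝ᵥ (A *ᵥ v) = (n : ℝ)⁻¹ * ((cols X S *ᵥ v) ⬝ᵥ (cols X S *ᵥ v)) := by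
    rw [hA, smul_mulVec, smul_dotProduct, dotProduct_smul, smul_eq_mul, smul_eq_mul, ← mul_assoc,
      ← mul_inv, Real.mul_self_sqrt hn'.le]
  rw [h2] at h1
  have := mul_le_mul_of_nonneg_left h1 hn'.le
  rw [mul_inv_cancel_left₀ hn'.ne'] at this
  linarith

lemma sparse_lower (hc : 0 < c) (hn : 0 < n) {u : Fin p → ℝ} {S : Finset (Fin p)}
    (hu : supp u ⊆ S) (hS : (S.card : ℕ∞) < rspark c X) :
    c * √(n : ℝ) * l2 u ≤ l2 (X *ᵥ u) := by
  have h := sparse_lower_cols hc hn hS (fun j => u j)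
  rw [← mulVec_extend, ← dotProduct_extend, extend_restrict hu, ← l2_sq, ← l2_sq] at h
  refine abs_le_of_sq_le_sq' ?_ (l2_nonneg _) |>.2
  calc (c * √(n : ℝ) * l2 u) ^ 2 = c ^ 2 * (√(n : ℝ)) ^ 2 * l2 u ^ 2 := by ring
    _ = c ^ 2 * n * l2 u ^ 2 := by rw [Real.sq_sqrt (Nat.cast_nonneg n)]
    _ ≤ _ := h

lemma sparse_upper_le (hn : 0 < n)
    (h : ∀ δ : Fin p → ℝ, 2 * (l0 δ : ℕ∞) < rspark c X → l2 δ = 1 →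
      (√(n : ℝ))⁻¹ * l2 (X *ᵥ δ) ≤ c₃) {u : Fin p → ℝ} (hu : 2 * (l0 u : ℕ∞) < rspark c X) :
    l2 (X *ᵥ u) ≤ c₃ * √(n : ℝ) * l2 u := by
  have hn' : (0 : ℝ) < √(n : ℝ) := Real.sqrt_pos.2 (by exact_mod_cast hn)
  by_cases h0 : l2 u = 0
  · rw [l2_eq_zero.1 h0]; simp [l2_zero]
  have hpos : 0 < l2 u := lt_of_le_of_ne (l2_nonneg _) (Ne.symm h0)
  have hsupp : supp ((l2 u)⁻¹ • u) = supp u := by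
    ext j; simp [mem_supp, h0]
  have := h ((l2 u)⁻¹ • u) (by unfold l0; rw [hsupp]; exact hu)
    (by rw [l2_smul, abs_of_pos (inv_pos.2 hpos), inv_mul_cancel₀ h0])
  rw [mulVec_smul, l2_smul, abs_of_pos (inv_pos.2 hpos)] at this
  rw [inv_mul_le_iff₀ hn', inv_mul_le_iff₀ hpos] at this
  linarith

lemma card_lt_of_two_mul_lt {M : ℕ∞} {a b : ℕ} (ha : 2 * (a : ℕ∞) < M) (hb : 2 * (b : ℕ∞) < M) :
    ((a + b : ℕ) : ℕ∞) < M := by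
  cases M with
  | top => exact ENat.natCast_lt_top _
  | coe m =>
    have ha' : 2 * a < m := by exact_mod_cast ha
    have hb' : 2 * b < m := by exact_mod_cast hb
    exact_mod_cast (by omega : a + b < m)

lemma two_mul_card_lt_mono {M : ℕ∞} {a b : ℕ} (hab : a ≤ b) (hb : 2 * (b : ℕ∞) < M) :
    2 * (a : ℕ∞) < M :=
  lt_of_le_of_lt (by gcongr) hb

lemma supp_sub_subset (u v : Fin p → ℝ) : supp (u - v) ⊆ supp u ∪ supp v := by
  intro j hj
  rw [Finset.mem_union, mem_supp, mem_supp]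
  rw [mem_supp, Pi.sub_apply] at hj
  by_contra! h
  exact hj (by rw [h.1, h.2, sub_zero])

/-- The lower bound on sparse singular values applies to differences of two vectors whose supports
are smaller than half the robust spark. -/
lemma sparse_lower_sub (hc : 0 < c) (hn : 0 < n) {u v : Fin p → ℝ}
    (hu : 2 * (l0 u : ℕ∞) < rspark c X) (hv : 2 * (l0 v : ℕ∞) < rspark c X) :
    c * √(n : ℝ) * l2 (u - v) ≤ l2 (X *ᵥ (u - v)) :=
  sparse_lower hc hn (supp_sub_subset u v)
    (lt_of_le_of_lt (by exact_mod_cast Finset.card_union_le _ _) (card_lt_of_two_mul_lt hu hv))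

end Design

/-! ### Ridge regression on a fixed set of columns -/

section Ridge

variable {n p : ℕ} {c l : ℝ} {X : Matrix (Fin n) (Fin p) ℝ} {S : Finset (Fin p)}

lemma ridge_eq_extend (X : Matrix (Fin n) (Fin p) ℝ) (S : Finset (Fin p)) (l : ℝ)
    (y : Fin n → ℝ) :
    ridge X S l y =
      extend S ((gram X S + l • (1 : Matrix S S ℝ))⁻¹ *ᵥ ((cols X S)ᵀ *ᵥ y)) := rfl

lemma supp_ridge_subset (X : Matrix (Fin n) (Fin p) ℝ) (S : Finset (Fin p)) (l : ℝ)
    (y : Fin n → ℝ) : supp (ridge X S l y) ⊆ S :=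
  supp_extend_subset S _

/-- Below the robust spark the inverse in `ridge` is a genuine one, also for `l = 0`. -/
lemma isUnit_gram_add (hc : 0 < c) (hn : 0 < n) (hS : (S.card : ℕ∞) < rspark c X) (hl : 0 ≤ l) :
    IsUnit (gram X S + l • (1 : Matrix S S ℝ)) := by
  refine mulVec_injective_iff_isUnit.1 ?_
  rw [← coe_mulVecLin, ← LinearMap.ker_eq_bot, LinearMap.ker_eq_bot']
  intro v hv
  rw [mulVecLin_apply] at hv
  have h1 : v ⬝ᵥ ((gram X S + l • (1 : Matrix S S ℝ)) *ᵥ v) = 0 := by rw [hv, dotProduct_zero]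
  rw [add_mulVec, smul_mulVec, one_mulVec, dotProduct_add, dotProduct_smul, gram,
    ← mulVec_dotProduct_mulVec, smul_eq_mul] at h1
  have h2 := sparse_lower_cols hc hn hS v
  have h3 : 0 ≤ v ⬝ᵥ v := by
    simp only [dotProduct]; exact Finset.sum_nonneg fun i _ => mul_self_nonneg _
  have h4 : 0 < c ^ 2 * n := by positivity
  exact dotProduct_self_eq_zero.1 (by nlinarith [mul_nonneg hl h3])

lemma gram_add_mulVec_ridge (hc : 0 < c) (hn : 0 < n) (hS : (S.card : ℕ∞) < rspark c X)
    (hl : 0 ≤ l) (y : Fin n → ℝ) :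
    (gram X S + l • (1 : Matrix S S ℝ)) *ᵥ
      ((gram X S + l • (1 : Matrix S S ℝ))⁻¹ *ᵥ ((cols X S)ᵀ *ᵥ y)) = (cols X S)ᵀ *ᵥ y := by
  rw [mulVec_mulVec, mul_nonsing_inv _ ((isUnit_iff_isUnit_det _).1 (isUnit_gram_add hc hn hS hl)),
    one_mulVec]

/-- The normal equations of ridge regression, tested against a vector supported in `S`. -/
lemma ridge_normal_eq (hc : 0 < c) (hn : 0 < n) (hS : (S.card : ℕ∞) < rspark c X) (hl : 0 ≤ l)
    (y : Fin n → ℝ) {v : Fin p → ℝ} (hv : supp v ⊆ S) :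
    (X *ᵥ v) ⬝ᵥ (X *ᵥ ridge X S l y) + l * (v ⬝ᵥ ridge X S l y) = (X *ᵥ v) ⬝ᵥ y := by
  rw [← extend_restrict hv, ridge_eq_extend, mulVec_extend, mulVec_extend, dotProduct_extend]
  have h := gram_add_mulVec_ridge hc hn hS hl y
  set w := (gram X S + l • (1 : Matrix S S ℝ))⁻¹ *ᵥ ((cols X S)ᵀ *ᵥ y)
  have h' := congrArg (fun x => (fun j : S => v j) ⬝ᵥ x) h
  rw [add_mulVec, smul_mulVec, one_mulVec, dotProduct_add, dotProduct_smul, gram,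
    ← mulVec_dotProduct_mulVec, smul_eq_mul] at h'
  rw [h', dotProduct_mulVec, vecMul_transpose]

lemma ridge_energy (hc : 0 < c) (hn : 0 < n) (hS : (S.card : ℕ∞) < rspark c X) (hl : 0 ≤ l)
    (y : Fin n → ℝ) :
    l2 (X *ᵥ ridge X S l y) ^ 2 + l * l2 (ridge X S l y) ^ 2 = (X *ᵥ ridge X S l y) ⬝ᵥ y := by
  rw [l2_sq, l2_sq]
  exact ridge_normal_eq hc hn hS hl y (supp_ridge_subset X S l y)

lemma l2_mulVec_ridge_le (hc : 0 < c) (hn : 0 < n) (hS : (S.card : ℕ∞) < rspark c X) (hl : 0 ≤ l)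
    (y : Fin n → ℝ) : l2 (X *ᵥ ridge X S l y) ≤ l2 y := by
  have h := ridge_energy hc hn hS hl y
  have h1 := dotProduct_le_l2 (X *ᵥ ridge X S l y) y
  have h2 : 0 ≤ l * l2 (ridge X S l y) ^ 2 := by positivity
  by_contra! hlt
  nlinarith [l2_nonneg y, l2_nonneg (X *ᵥ ridge X S l y)]

lemma l2_ridge_le (hc : 0 < c) (hn : 0 < n) (hS : (S.card : ℕ∞) < rspark c X) (hl : 0 ≤ l)
    (y : Fin n → ℝ) : c * √(n : ℝ) * l2 (ridge X S l y) ≤ l2 y :=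
  (sparse_lower hc hn (supp_ridge_subset X S l y) hS).trans (l2_mulVec_ridge_le hc hn hS hl y)

/-- The ridge estimator vanishes as the ridge parameter tends to infinity. -/
lemma mul_l2_ridge_sq_le (hc : 0 < c) (hn : 0 < n) (hS : (S.card : ℕ∞) < rspark c X) (hl : 0 ≤ l)
    (y : Fin n → ℝ) : l * l2 (ridge X S l y) ^ 2 ≤ l2 y ^ 2 := by
  have h := ridge_energy hc hn hS hl y
  have h1 := dotProduct_le_l2 (X *ᵥ ridge X S l y) y
  have h2 := l2_mulVec_ridge_le hc hn hS hl y
  nlinarith [l2_nonneg y, l2_nonneg (X *ᵥ ridge X S l y), sq_nonneg (l2 (X *ᵥ ridge X S l y))]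

/-- The ridge estimator is Lipschitz in the ridge parameter, with a constant of order `1 / n`. -/
lemma l2_ridge_sub_le (hc : 0 < c) (hn : 0 < n) (hS : (S.card : ℕ∞) < rspark c X) (hl : 0 ≤ l)
    {l' : ℝ} (hl' : 0 ≤ l') (y : Fin n → ℝ) :
    c ^ 2 * n * l2 (ridge X S l y - ridge X S l' y) ≤ |l - l'| * l2 (ridge X S l' y) := by
  set w := ridge X S l y
  set w' := ridge X S l' y
  have hsub : supp (w - w') ⊆ S := (supp_sub_subset w w').trans
    (Finset.union_subset (supp_ridge_subset X S l y) (supp_ridge_subset X S l' y))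
  have h1 := ridge_normal_eq hc hn hS hl y hsub
  have h2 := ridge_normal_eq hc hn hS hl' y hsub
  have h3 := sparse_lower hc hn hsub hS
  have h4 : l2 (X *ᵥ (w - w')) ^ 2 + l * l2 (w - w') ^ 2 = (l' - l) * ((w - w') ⬝ᵥ w') := by
    have e1 : l2 (X *ᵥ (w - w')) ^ 2
        = (X *ᵥ (w - w')) ⬝ᵥ (X *ᵥ w) - (X *ᵥ (w - w')) ⬝ᵥ (X *ᵥ w') := by
      rw [l2_sq, ← dotProduct_sub, ← mulVec_sub]
    have e2 : l2 (w - w') ^ 2 = (w - w') ⬝ᵥ w - (w - w') ⬝ᵥ w' := by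
      rw [l2_sq, ← dotProduct_sub]
    rw [e1, e2]
    linear_combination h1 - h2
  have h5 : (l' - l) * ((w - w') ⬝ᵥ w') ≤ |l - l'| * (l2 (w - w') * l2 w') := by
    refine (le_abs_self _).trans ?_
    rw [abs_mul, abs_sub_comm]
    exact mul_le_mul_of_nonneg_left (abs_dotProduct_le_l2 _ _) (abs_nonneg _)
  have h6 : c ^ 2 * n * l2 (w - w') ^ 2 ≤ l2 (X *ᵥ (w - w')) ^ 2 := by
    calc c ^ 2 * n * l2 (w - w') ^ 2 = (c * √(n : ℝ) * l2 (w - w')) ^ 2 := by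
          rw [mul_pow, mul_pow, Real.sq_sqrt (Nat.cast_nonneg n)]
      _ ≤ _ := pow_le_pow_left₀ (mul_nonneg (by positivity) (l2_nonneg _)) h3 2
  by_cases h0 : l2 (w - w') = 0
  · rw [h0, mul_zero]; exact mul_nonneg (abs_nonneg _) (l2_nonneg _)
  have hpos : 0 < l2 (w - w') := lt_of_le_of_ne (l2_nonneg _) (Ne.symm h0)
  have h7 : 0 ≤ l * l2 (w - w') ^ 2 := by positivity
  refine le_of_mul_le_mul_right ?_ hpos
  nlinarith

/-- At `l = 0`, ridge regression is least squares among the vectors supported in `S`. -/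
lemma ridge_zero_least_squares (hc : 0 < c) (hn : 0 < n) (hS : (S.card : ℕ∞) < rspark c X)
    (y : Fin n → ℝ) {v : Fin p → ℝ} (hv : supp v ⊆ S) :
    l2 (y - X *ᵥ ridge X S 0 y) ≤ l2 (y - X *ᵥ v) := by
  set w := ridge X S 0 y
  have hsub : supp (v - w) ⊆ S := (supp_sub_subset v w).trans
    (Finset.union_subset hv (supp_ridge_subset X S 0 y))
  have h1 := ridge_normal_eq hc hn hS le_rfl y hsub
  rw [zero_mul, add_zero] at h1
  refine abs_le_of_sq_le_sq' ?_ (l2_nonneg _) |>.2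
  have e : y - X *ᵥ v = (y - X *ᵥ w) - X *ᵥ (v - w) := by rw [mulVec_sub]; abel
  have h2 : (X *ᵥ (v - w)) ⬝ᵥ (y - X *ᵥ w) = 0 := by rw [dotProduct_sub, h1, sub_self]
  have h3 : l2 (y - X *ᵥ v) ^ 2 = l2 (y - X *ᵥ w) ^ 2 + l2 (X *ᵥ (v - w)) ^ 2 := by
    rw [e]
    generalize y - X *ᵥ w = r at h2
    generalize X *ᵥ (v - w) = q at h2
    rw [l2_sq, l2_sq, l2_sq, sub_dotProduct, dotProduct_sub, dotProduct_sub,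
      dotProduct_comm r q, h2]
    ring
  rw [h3]
  linarith [sq_nonneg (l2 (X *ᵥ (v - w)))]

lemma continuous_ridge (X : Matrix (Fin n) (Fin p) ℝ) (S : Finset (Fin p)) (l : ℝ) :
    Continuous (ridge X S l) := by
  refine continuous_pi fun j => ?_
  by_cases hj : j ∈ S
  · simp only [ridge, hj, dite_true]
    fun_prop
  · simp only [ridge, hj, dite_false]
    fun_prop

/-- In the eigenbasis of `X_Sᵀ X_S`, the ridge estimator of `X β₀ + e`, with `β₀` supported on `S`,
acts coordinatewise. -/
lemma rotated_ridge_error (hc : 0 < c) (hn : 0 < n) (hS : (S.card : ℕ∞) < rspark c X)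
    {β₀ : Fin p → ℝ} (hβ : supp β₀ ⊆ S) (hl : 0 ≤ l) {P : Matrix S S ℝ} {d : S → ℝ}
    (hP : IsEigendecomposition (gram X S) P d) (e : Fin n → ℝ) (j : S) :
    (d j + l) * (P *ᵥ fun i : S => (ridge X S l (X *ᵥ β₀ + e) - β₀) i) j
      = (P *ᵥ ((cols X S)ᵀ *ᵥ e)) j - l * (P *ᵥ fun i : S => β₀ i) j := by
  set y := X *ᵥ β₀ + e
  have h := gram_add_mulVec_ridge hc hn hS hl y
  set w := (gram X S + l • (1 : Matrix S S ℝ))⁻¹ *ᵥ ((cols X S)ᵀ *ᵥ y) with hw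
  set b : S → ℝ := fun i => β₀ i with hb
  have e1 : (fun i : S => (ridge X S l y - β₀) i) = w - b := by
    ext i
    simp [ridge_eq_extend, extend, ← hw, hb]
  have e2 : (cols X S)ᵀ *ᵥ y = gram X S *ᵥ b + (cols X S)ᵀ *ᵥ e := by
    have : X *ᵥ β₀ = cols X S *ᵥ b := by
      rw [← mulVec_extend, hb, extend_restrict hβ]
    simp only [y]
    rw [mulVec_add, this, mulVec_mulVec, gram]
  have e3 : (gram X S + l • (1 : Matrix S S ℝ)) *ᵥ (w - b) = (cols X S)ᵀ *ᵥ e - l • b := by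
    rw [mulVec_sub, h, e2, add_mulVec, smul_mulVec, one_mulVec]
    abel
  have e4 : P *ᵥ ((gram X S + l • (1 : Matrix S S ℝ)) *ᵥ (w - b))
      = diagonal d *ᵥ (P *ᵥ (w - b)) + l • (P *ᵥ (w - b)) := by
    rw [add_mulVec, smul_mulVec, one_mulVec, mulVec_add, mulVec_mulVec, hP.mul_eq, mulVec_smul,
      mulVec_mulVec]
  have e5 := congrFun (e4.symm.trans (congrArg (P *ᵥ ·) e3)) j
  simp only [Pi.add_apply, mulVec_diagonal, Pi.smul_apply, smul_eq_mul, mulVec_sub, mulVec_smul,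
    Pi.sub_apply] at e5
  rw [e1, mulVec_sub, Pi.sub_apply]
  linear_combination e5

end Ridge

/-! ### The two penalties -/

section Penalty

variable {pen : ℝ → ℝ → ℝ} {lam t : ℝ}

lemma pen_zero (hpen : pen = hardPenalty ∨ pen = l0Penalty) (hlam : 0 < lam) : pen lam 0 = 0 := by
  rcases hpen with rfl | rfl
  · simp [hardPenalty, hlam.le]
  · simp [l0Penalty]

lemma pen_of_le (hpen : pen = hardPenalty ∨ pen = l0Penalty) (hlam : 0 < lam) (ht : lam ≤ t) :
    pen lam t = lam ^ 2 / 2 := by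
  rcases hpen with rfl | rfl
  · simp [hardPenalty, ht]
  · simp [l0Penalty, (hlam.trans_le ht).ne']

lemma hardPenalty_nonneg (hlam : 0 < lam) (ht : 0 ≤ t) : 0 ≤ hardPenalty lam t := by
  unfold hardPenalty
  have h1 : max (lam - t) 0 ≤ lam := max_le (by linarith) hlam.le
  have h2 : 0 ≤ max (lam - t) 0 := le_max_right _ _
  nlinarith

lemma hardPenalty_le_pen (hpen : pen = hardPenalty ∨ pen = l0Penalty) (hlam : 0 < lam) :
    hardPenalty lam t ≤ pen lam t := by
  rcases hpen with rfl | rfl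
  · exact le_rfl
  · unfold hardPenalty l0Penalty
    split_ifs with h
    · linarith [sq_nonneg (max (lam - t) 0)]
    · rw [not_not] at h
      subst h
      simp [hlam.le]

/-- Thresholding a signal component of size at least `b₀` costs at most a fixed multiple of the
squared estimation error of that component. -/
lemma pen_sub_ge (hpen : pen = hardPenalty ∨ pen = l0Penalty) (hlam : 0 < lam) {c b₀ x x₀ : ℝ}
    (hc : 0 < c) (hc1 : c ≤ 1) (h1 : lam < b₀) (h2 : lam ≤ b₀ * √(c ^ 2 / 2))
    (hx₀ : x₀ = 0 ∨ b₀ ≤ |x₀|) :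
    -(c ^ 2 / 4 * (x - x₀) ^ 2) ≤ pen lam |x| - pen lam |x₀| := by
  have h3 := hardPenalty_le_pen (t := |x|) hpen hlam
  rcases hx₀ with rfl | hx₀
  · rw [abs_zero, pen_zero hpen hlam]
    have := hardPenalty_nonneg hlam (abs_nonneg x)
    have : 0 ≤ c ^ 2 / 4 * (x - 0) ^ 2 := by positivity
    linarith
  · rw [pen_of_le hpen hlam (h1.le.trans hx₀)]
    refine le_trans ?_ (sub_le_sub_right h3 _)
    unfold hardPenalty
    set κ := √(c ^ 2 / 2)
    have hκ : κ ^ 2 = c ^ 2 / 2 := Real.sq_sqrt (by positivity)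
    have hκ0 : 0 ≤ κ := Real.sqrt_nonneg _
    have hκ1 : κ ≤ 1 := by nlinarith
    rcases le_total (lam - |x|) 0 with h | h
    · rw [max_eq_right h]
      have : 0 ≤ c ^ 2 / 4 * (x - x₀) ^ 2 := by positivity
      linarith
    · rw [max_eq_left h]
      have h4 : lam - |x| ≤ κ * (b₀ - |x|) := by nlinarith [abs_nonneg x]
      have h5 : b₀ - |x| ≤ |x - x₀| := by
        have := abs_sub_abs_le_abs_sub x₀ x
        rw [abs_sub_comm] at this
        linarith
      have h6 : lam - |x| ≤ κ * |x - x₀| := h4.trans (mul_le_mul_of_nonneg_left h5 hκ0)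
      have h7 : (lam - |x|) ^ 2 ≤ (κ * |x - x₀|) ^ 2 := pow_le_pow_left₀ h h6 2
      rw [mul_pow, hκ, sq_abs] at h7
      linarith

/-- A global minimizer of the univariate penalized problem that is nonzero but below the threshold
is tied with `0` and with a point beyond the threshold. -/
lemma univariate_tie (hpen : pen = hardPenalty ∨ pen = l0Penalty) (hlam : 0 < lam) {z x : ℝ}
    (hx : x ≠ 0) (hxl : |x| < lam)
    (hmin : ∀ t : ℝ, x ^ 2 / 2 - z * x + pen lam |x| ≤ t ^ 2 / 2 - z * t + pen lam |t|) :
    ∃ t₁ : ℝ, lam ≤ |t₁| ∧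
      t₁ ^ 2 / 2 - z * t₁ + pen lam |t₁| ≤ x ^ 2 / 2 - z * x + pen lam |x| ∧
      (0 : ℝ) ^ 2 / 2 - z * 0 + pen lam |(0 : ℝ)| ≤ x ^ 2 / 2 - z * x + pen lam |x| := by
  have h0 := hmin 0
  rw [abs_zero, pen_zero hpen hlam] at h0 ⊢
  rcases hpen with rfl | rfl
  · have hpx : hardPenalty lam |x| = lam * |x| - x ^ 2 / 2 := by
      rw [hardPenalty, max_eq_left (by linarith), ← sq_abs x]; ring
    have h1 := hmin lam
    have h2 := hmin (-lam)
    rw [abs_neg] at h2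
    rw [abs_of_pos hlam, pen_of_le (Or.inl rfl) hlam le_rfl] at h1 h2
    rw [hpx] at h0 h1 h2 ⊢
    rcases lt_or_gt_of_ne hx with hneg | hpos
    · rw [abs_of_neg hneg] at h0 h1 h2 hxl ⊢
      have hz : z = -lam := by
        have e1 : 0 ≤ (-x) * (-(lam + z)) := by nlinarith
        have e1' : lam + z ≤ 0 := by nlinarith [nonneg_of_mul_nonneg_right e1 (by linarith)]
        have e2 : 0 ≤ (lam + x) * (lam + z) := by nlinarith
        have e2' := nonneg_of_mul_nonneg_right e2 (by linarith)
        linarith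
      subst hz
      refine ⟨-lam, by rw [abs_neg, abs_of_pos hlam], ?_, by nlinarith⟩
      rw [abs_neg, abs_of_pos hlam, pen_of_le (Or.inl rfl) hlam le_rfl]
      nlinarith
    · rw [abs_of_pos hpos] at h0 h1 h2 hxl ⊢
      have hz : z = lam := by
        have e1 : 0 ≤ x * (z - lam) := by nlinarith
        have e1' := nonneg_of_mul_nonneg_right e1 hpos
        have e2 : 0 ≤ (lam - x) * (lam - z) := by nlinarith
        have e2' := nonneg_of_mul_nonneg_right e2 (by linarith)
        linarith
      subst hz
      refine ⟨z, by rw [abs_of_pos hlam], ?_, by nlinarith⟩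
      rw [abs_of_pos hlam, pen_of_le (Or.inl rfl) hlam le_rfl]
      nlinarith
  · exfalso
    have hpx : l0Penalty lam |x| = lam ^ 2 / 2 := by simp [l0Penalty, hx]
    rw [hpx] at h0
    have h1 := hmin z
    rw [hpx] at h1
    have hz : l0Penalty lam |z| ≤ lam ^ 2 / 2 := by
      unfold l0Penalty; split_ifs <;> nlinarith
    have hxz : x = z := by nlinarith [sq_nonneg (x - z)]
    subst hxz
    have h2 : x ^ 2 < lam ^ 2 := sq_lt_sq' (by linarith [neg_abs_le x]) (by linarith [le_abs_self x])
    nlinarith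

end Penalty

/-! ### Recovery of the support by the global minimizer -/

section Selection

variable {n p : ℕ} {c : ℝ} {X : Matrix (Fin n) (Fin p) ℝ} {pen : ℝ → ℝ → ℝ} {lam b₀ a : ℝ}
  {β₀ β : Fin p → ℝ} {e : Fin n → ℝ} {M : ℕ∞}

lemma mulVec_single_eq_col (X : Matrix (Fin n) (Fin p) ℝ) (j : Fin p) :
    X *ᵥ Pi.single j (1 : ℝ) = fun i => X i j := by
  ext i; simp

/-- A single normalized column has the singular value `1`, so the spark exceeds `1` only if `c ≤ 1`. -/
lemma le_one_of_rspark (hc : 0 < c) (hn : 0 < n) (hcol : ∀ j, l2 (fun i => X i j) = √(n : ℝ))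
    (j : Fin p) (hM : 1 < rspark c X) : c ≤ 1 := by
  have hs : supp (Pi.single j (1 : ℝ)) ⊆ {j} := by
    intro i hi
    rw [mem_supp] at hi
    by_contra h
    rw [Finset.mem_singleton] at h
    exact hi (by simp [h])
  have h := sparse_lower (X := X) hc hn hs (by simpa using hM)
  rw [mulVec_single_eq_col, hcol] at h
  have h1 : l2 (Pi.single j (1 : ℝ)) = 1 := by
    have h2 := l2_sq (Pi.single j (1 : ℝ))
    rw [single_dotProduct, one_mul, Pi.single_eq_same] at h2
    exact (pow_eq_one_iff_of_nonneg (l2_nonneg _) two_ne_zero).1 h2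
  have hn' : (0 : ℝ) < √(n : ℝ) := Real.sqrt_pos.2 (by exact_mod_cast hn)
  rw [h1] at h
  nlinarith

/-- The basic inequality of penalized least squares. -/
lemma basic_inequality (hn : 0 < n) (hβ₀ : β₀ ∈ sparseVectors p M)
    (hmin : IsMinOn (penLS pen lam X (X *ᵥ β₀ + e)) (sparseVectors p M) β) :
    l2 (X *ᵥ (β - β₀)) ^ 2 + 2 * n * ∑ j, (pen lam |β j| - pen lam |β₀ j|)
      ≤ 2 * (e ⬝ᵥ (X *ᵥ (β - β₀))) := by
  have h : penLS pen lam X (X *ᵥ β₀ + e) β ≤ penLS pen lam X (X *ᵥ β₀ + e) β₀ := hmin hβ₀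
  have hn' : (0 : ℝ) < 2 * n := by positivity
  have e1 : X *ᵥ β₀ + e - X *ᵥ β = e - X *ᵥ (β - β₀) := by rw [mulVec_sub]; abel
  have e2 : X *ᵥ β₀ + e - X *ᵥ β₀ = e := by abel
  simp only [penLS] at h
  rw [e1, e2] at h
  have e3 : l2 (e - X *ᵥ (β - β₀)) ^ 2
      = l2 e ^ 2 - 2 * (e ⬝ᵥ (X *ᵥ (β - β₀))) + l2 (X *ᵥ (β - β₀)) ^ 2 := by
    generalize X *ᵥ (β - β₀) = q
    rw [l2_sq, l2_sq, l2_sq, sub_dotProduct, dotProduct_sub, dotProduct_sub, dotProduct_comm q e]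
    ring
  rw [e3] at h
  rw [Finset.sum_sub_distrib]
  have h1 := mul_le_mul_of_nonneg_left h hn'.le
  rw [mul_add, mul_add (2 * (n : ℝ)) ((2 * (n : ℝ))⁻¹ * l2 e ^ 2), mul_inv_cancel_left₀ hn'.ne',
    mul_inv_cancel_left₀ hn'.ne'] at h1
  linarith

/-- Whatever the noise, the prediction error of a global minimizer is bounded by a multiple of the
noise alone: missing signal components would cost more in fit than they save in penalty. -/
lemma prediction_error_le (hpen : pen = hardPenalty ∨ pen = l0Penalty) (hlam : 0 < lam)
    (hc : 0 < c) (hc1 : c ≤ 1) (hn : 0 < n) (h1 : lam < b₀) (h2 : lam ≤ b₀ * √(c ^ 2 / 2))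
    (hb₀ : ∀ j, β₀ j = 0 ∨ b₀ ≤ |β₀ j|) (hβ₀ : β₀ ∈ sparseVectors p (rspark c X))
    (hβ : β ∈ sparseVectors p (rspark c X))
    (hmin : IsMinOn (penLS pen lam X (X *ᵥ β₀ + e)) (sparseVectors p (rspark c X)) β) :
    l2 (X *ᵥ (β - β₀)) ≤ 4 * l2 e := by
  have hb := basic_inequality hn hβ₀ hmin
  have hlow := sparse_lower_sub hc hn hβ hβ₀
  have hsum : -(c ^ 2 / 4 * l2 (β - β₀) ^ 2) ≤ ∑ j, (pen lam |β j| - pen lam |β₀ j|) := by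
    rw [l2_sq_eq_sum, Finset.mul_sum, ← Finset.sum_neg_distrib]
    exact Finset.sum_le_sum fun j _ => pen_sub_ge hpen hlam hc hc1 h1 h2 (hb₀ j)
  have hsq : c ^ 2 * n * l2 (β - β₀) ^ 2 ≤ l2 (X *ᵥ (β - β₀)) ^ 2 := by
    calc c ^ 2 * n * l2 (β - β₀) ^ 2 = (c * √(n : ℝ) * l2 (β - β₀)) ^ 2 := by
          rw [mul_pow, mul_pow, Real.sq_sqrt (Nat.cast_nonneg n)]
      _ ≤ _ := pow_le_pow_left₀ (mul_nonneg (by positivity) (l2_nonneg _)) hlow 2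
  have hcs := dotProduct_le_l2 e (X *ᵥ (β - β₀))
  have h3 := mul_le_mul_of_nonneg_left hsum (by positivity : (0 : ℝ) ≤ 2 * n)
  by_contra! hlt
  nlinarith [l2_nonneg e, l2_nonneg (X *ᵥ (β - β₀))]

lemma abs_noise_le (hnoise : ∀ j, |e ⬝ᵥ (fun i => X i j)| ≤ n * a) (δ : Fin p → ℝ) :
    e ⬝ᵥ (X *ᵥ δ) ≤ n * a * ∑ j, |δ j| := by
  have h : e ⬝ᵥ (X *ᵥ δ) = ∑ j, (e ⬝ᵥ (fun i => X i j)) * δ j := by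
    rw [dotProduct_mulVec]; rfl
  rw [h, Finset.mul_sum]
  refine Finset.sum_le_sum fun j _ => (le_abs_self _).trans ?_
  rw [abs_mul]
  exact mul_le_mul_of_nonneg_right (hnoise j) (abs_nonneg _)

lemma sum_abs_sq_le (δ : Fin p → ℝ) : (∑ j, |δ j|) ^ 2 ≤ l0 δ * l2 δ ^ 2 := by
  have h1 : ∑ j, |δ j| = ∑ j ∈ supp δ, |δ j| := by
    refine (Finset.sum_subset (Finset.subset_univ _) fun j _ hj => ?_).symm
    rw [mem_supp, not_not] at hj
    simp [hj]
  rw [h1]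
  refine (sq_sum_le_card_mul_sum_sq).trans ?_
  unfold l0
  gcongr
  rw [l2_sq_eq_sum]
  simp only [sq_abs]
  exact Finset.sum_le_univ_sum_of_nonneg fun i => sq_nonneg _

lemma sum_pen_eq (hpen : pen = hardPenalty ∨ pen = l0Penalty) (hlam : 0 < lam)
    (hβ : ∀ j, β j ≠ 0 → lam ≤ |β j|) : ∑ j, pen lam |β j| = lam ^ 2 / 2 * l0 β := by
  have h1 : ∑ j, pen lam |β j| = ∑ j ∈ supp β, pen lam |β j| := by
    refine (Finset.sum_subset (Finset.subset_univ _) fun j _ hj => ?_).symm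
    rw [mem_supp, not_not] at hj
    simp [hj, pen_zero hpen hlam]
  rw [h1, Finset.sum_congr rfl fun j hj => pen_of_le hpen hlam (hβ j (mem_supp.1 hj)),
    Finset.sum_const, nsmul_eq_mul, mul_comm, l0]

/-- Elimination of the error size `T` from the basic inequality: `D ≤ √((k + s) * T)` turns `hmain` into
a quadratic inequality in `√T`, which has a solution only if its discriminant is nonnegative. -/
lemma mul_le_of_completed_square {T D k s : ℝ} (hT : 0 ≤ T) (hks : 0 ≤ k + s)
    (hD : D ^ 2 ≤ (k + s) * T) (hmain : c ^ 2 * T + lam ^ 2 * (k - s) ≤ 2 * a * D) :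
    c ^ 2 * lam ^ 2 * (k - s) ≤ a ^ 2 * (k + s) := by
  rcases hT.eq_or_lt with rfl | hT
  · rw [mul_zero] at hD
    have hD0 : D = 0 := by nlinarith
    rw [hD0] at hmain
    have h1 : lam ^ 2 * (k - s) ≤ 0 := by linarith
    have h2 := mul_nonneg (sq_nonneg a) hks
    have h3 := mul_nonneg (sq_nonneg c) (neg_nonneg.2 h1)
    linarith
  · refine le_of_mul_le_mul_right ?_ hT
    have e3 : 0 ≤ (c ^ 2 * T - a * D) ^ 2 := sq_nonneg _
    have e4 := mul_le_mul_of_nonneg_left hD (sq_nonneg a)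
    have e5 := mul_le_mul_of_nonneg_left hmain (by positivity : 0 ≤ c ^ 2 * T)
    linarith

/-- Support recovery for a minimizer without components strictly between `0` and the threshold. -/
lemma supp_eq_of_thresholded (hpen : pen = hardPenalty ∨ pen = l0Penalty) (hlam : 0 < lam)
    (hc : 0 < c) (hn : 0 < n) (h1 : lam < b₀) (h2 : 2 * lam ^ 2 ≤ c ^ 2 * b₀ ^ 2)
    (hb₀ : ∀ j, β₀ j = 0 ∨ b₀ ≤ |β₀ j|)
    (hlow : (2 * l0 β₀ + 1) * a ^ 2 < c ^ 2 * lam ^ 2)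
    (hsig : 16 * (2 * l0 β₀ + 1) * a ^ 2 < c ^ 4 * b₀ ^ 2)
    (hnoise : ∀ j, |e ⬝ᵥ (fun i => X i j)| ≤ n * a)
    (hβ₀ : β₀ ∈ sparseVectors p (rspark c X)) (hβ : β ∈ sparseVectors p (rspark c X))
    (hmin : IsMinOn (penLS pen lam X (X *ᵥ β₀ + e)) (sparseVectors p (rspark c X)) β)
    (hthr : ∀ j, β j ≠ 0 → lam ≤ |β j|) : supp β = supp β₀ := by
  have hn' : (0 : ℝ) < n := by exact_mod_cast hn
  have hb := basic_inequality hn hβ₀ hmin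
  have hlow' := sparse_lower_sub hc hn hβ hβ₀
  have hsq : c ^ 2 * n * l2 (β - β₀) ^ 2 ≤ l2 (X *ᵥ (β - β₀)) ^ 2 := by
    calc c ^ 2 * n * l2 (β - β₀) ^ 2 = (c * √(n : ℝ) * l2 (β - β₀)) ^ 2 := by
          rw [mul_pow, mul_pow, Real.sq_sqrt (Nat.cast_nonneg n)]
      _ ≤ _ := pow_le_pow_left₀ (mul_nonneg (by positivity) (l2_nonneg _)) hlow' 2
  rw [Finset.sum_sub_distrib, sum_pen_eq hpen hlam hthr, sum_pen_eq hpen hlam (β := β₀)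
    (fun j hj => h1.le.trans ((hb₀ j).resolve_left hj))] at hb
  have hnz := abs_noise_le hnoise (β - β₀)
  have hD := sum_abs_sq_le (β - β₀)
  have hD0 : 0 ≤ ∑ j, |(β - β₀) j| := Finset.sum_nonneg fun j _ => abs_nonneg _
  have hcard : (l0 (β - β₀) : ℝ) ≤ l0 β + l0 β₀ := by
    have := (Finset.card_le_card (supp_sub_subset β β₀)).trans (Finset.card_union_le _ _)
    exact_mod_cast this
  have hmain : c ^ 2 * l2 (β - β₀) ^ 2 + lam ^ 2 * (l0 β - l0 β₀)
      ≤ 2 * a * ∑ j, |(β - β₀) j| := by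
    refine le_of_mul_le_mul_left ?_ hn'
    linarith
  have hD' : (∑ j, |(β - β₀) j|) ^ 2 ≤ (l0 β + l0 β₀ : ℝ) * l2 (β - β₀) ^ 2 :=
    hD.trans (mul_le_mul_of_nonneg_right hcard (sq_nonneg _))
  have ht0 := l2_nonneg (β - β₀)
  -- There are at most as many selected components as signals: completing the square in `D`.
  have hks : l0 β ≤ l0 β₀ := by
    by_contra! hlt
    have hlt' : (l0 β₀ : ℝ) + 1 ≤ l0 β := by exact_mod_cast hlt
    have hs0 : (0 : ℝ) ≤ l0 β₀ := Nat.cast_nonneg _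
    have e1 : c ^ 2 * lam ^ 2 * (l0 β - l0 β₀) ≤ a ^ 2 * (l0 β + l0 β₀) :=
      mul_le_of_completed_square (sq_nonneg _) (by positivity) hD' hmain
    have e2 : (2 * l0 β₀ + 1) * a ^ 2 * (l0 β - l0 β₀ : ℝ) < c ^ 2 * lam ^ 2 * (l0 β - l0 β₀) :=
      mul_lt_mul_of_pos_right hlow (by linarith)
    have e6 : 0 ≤ a ^ 2 * (l0 β₀ * (l0 β - l0 β₀ - 1 : ℝ)) :=
      mul_nonneg (sq_nonneg a) (mul_nonneg hs0 (by linarith))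
    linarith
  have hks' : (l0 β : ℝ) ≤ l0 β₀ := by exact_mod_cast hks
  -- A missed signal would contribute at least `b₀²` to the squared error.
  have hsub : supp β₀ \ supp β = ∅ := by
    by_contra hne
    obtain ⟨j₀, hj₀⟩ := Finset.nonempty_iff_ne_empty.2 hne
    have hb₀pos : 0 < b₀ := hlam.trans h1
    have hq1 : (1 : ℝ) ≤ (supp β₀ \ supp β).card := by
      exact_mod_cast Finset.card_pos.2 ⟨j₀, hj₀⟩
    have hcount : (l0 β₀ : ℝ) - l0 β ≤ (supp β₀ \ supp β).card := by
      have := Finset.le_card_sdiff (supp β) (supp β₀)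
      have h' : (supp β₀).card ≤ (supp β₀ \ supp β).card + (supp β).card := by omega
      have h'' : (l0 β₀ : ℝ) ≤ (supp β₀ \ supp β).card + l0 β := by exact_mod_cast h'
      linarith
    have ht : ((supp β₀ \ supp β).card : ℝ) * b₀ ^ 2 ≤ l2 (β - β₀) ^ 2 := by
      rw [l2_sq_eq_sum, ← nsmul_eq_mul, ← Finset.sum_const]
      refine (Finset.sum_le_sum (g := fun j => (β - β₀) j ^ 2) fun j hj => ?_).trans
        (Finset.sum_le_univ_sum_of_nonneg fun i => sq_nonneg _)
      rw [Finset.mem_sdiff, mem_supp, mem_supp, not_not] at hj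
      rw [Pi.sub_apply, hj.2, zero_sub, neg_sq, ← sq_abs (β₀ j)]
      exact pow_le_pow_left₀ hb₀pos.le ((hb₀ j).resolve_left hj.1) 2
    set q : ℝ := ((supp β₀ \ supp β).card : ℝ)
    have htb : b₀ ^ 2 ≤ l2 (β - β₀) ^ 2 := by nlinarith [sq_nonneg b₀]
    have htp : 0 < l2 (β - β₀) ^ 2 := lt_of_lt_of_le (by positivity) htb
    have e1 : lam ^ 2 * (l0 β₀ - l0 β) ≤ c ^ 2 * l2 (β - β₀) ^ 2 / 2 := by
      have e1a : lam ^ 2 * (l0 β₀ - l0 β : ℝ) ≤ lam ^ 2 * q :=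
        mul_le_mul_of_nonneg_left hcount (sq_nonneg _)
      have e1b := mul_le_mul_of_nonneg_right h2 (by linarith : 0 ≤ q)
      have e1c := mul_le_mul_of_nonneg_left ht (sq_nonneg c)
      linarith
    have e2 : c ^ 2 * l2 (β - β₀) ^ 2 ≤ 4 * a * ∑ j, |(β - β₀) j| := by linarith
    have e3 : (c ^ 2 * l2 (β - β₀) ^ 2) ^ 2 ≤ (4 * a * ∑ j, |(β - β₀) j|) ^ 2 :=
      pow_le_pow_left₀ (by positivity) e2 2
    have e4 : (∑ j, |(β - β₀) j|) ^ 2 ≤ (2 * l0 β₀ : ℝ) * l2 (β - β₀) ^ 2 :=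
      hD'.trans (mul_le_mul_of_nonneg_right (by linarith) htp.le)
    have e5 := mul_le_mul_of_nonneg_left e4 (by positivity : 0 ≤ 16 * a ^ 2)
    have e6 : c ^ 4 * l2 (β - β₀) ^ 2 ≤ 16 * a ^ 2 * (2 * l0 β₀) := by
      refine le_of_mul_le_mul_right ?_ htp
      linarith
    have e7 := mul_le_mul_of_nonneg_left htb (by positivity : 0 ≤ c ^ 4)
    linarith [sq_nonneg a]
  exact (Finset.eq_of_subset_of_card_le (Finset.sdiff_eq_empty_iff_subset.1 hsub) hks).symm

/-- As a function of one coordinate, the penalized residual sum of squares is, up to a constant,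
a univariate penalized quadratic. -/
lemma penLS_update (hn : 0 < n) (hcol : ∀ j, l2 (fun i => X i j) = √(n : ℝ)) (y : Fin n → ℝ)
    (β : Fin p → ℝ) (j : Fin p) : ∃ C z : ℝ, ∀ t : ℝ,
      penLS pen lam X y (Function.update β j t) = C + (t ^ 2 / 2 - z * t + pen lam |t|) := by
  have hn' : (n : ℝ) ≠ 0 := by exact_mod_cast hn.ne'
  set r := y - X *ᵥ Function.update β j 0 with hr
  refine ⟨(2 * (n : ℝ))⁻¹ * l2 r ^ 2 + ∑ i ∈ Finset.univ.erase j, pen lam |β i|,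
    (n : ℝ)⁻¹ * (r ⬝ᵥ fun i => X i j), fun t => ?_⟩
  have e1 : Function.update β j t = Function.update β j 0 + t • Pi.single j (1 : ℝ) := by
    ext i
    by_cases h : i = j
    · subst h; simp
    · simp [h]
  have e2 : y - X *ᵥ Function.update β j t = r - t • fun i => X i j := by
    rw [e1, mulVec_add, mulVec_smul, mulVec_single_eq_col, hr]; abel
  have e3 : (fun i => X i j) ⬝ᵥ (fun i => X i j) = n := by
    rw [← l2_sq, hcol, Real.sq_sqrt (Nat.cast_nonneg n)]
  have e4 : l2 (y - X *ᵥ Function.update β j t) ^ 2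
      = l2 r ^ 2 - 2 * t * (r ⬝ᵥ fun i => X i j) + t ^ 2 * n := by
    rw [e2]
    generalize (fun i => X i j) = x at e3
    generalize r = r'
    rw [l2_sq, l2_sq, sub_dotProduct, dotProduct_sub, dotProduct_sub, smul_dotProduct, smul_dotProduct,
      dotProduct_smul, dotProduct_smul, e3, dotProduct_comm x r']
    simp only [smul_eq_mul]
    ring
  have e5 : ∑ i, pen lam |Function.update β j t i|
      = pen lam |t| + ∑ i ∈ Finset.univ.erase j, pen lam |β i| := by
    rw [← Finset.add_sum_erase _ _ (Finset.mem_univ j), Function.update_self]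
    congr 1
    refine Finset.sum_congr rfl fun i hi => ?_
    rw [Function.update_of_ne (Finset.ne_of_mem_erase hi)]
  rw [penLS, e4, e5]
  field_simp
  ring

/-- Replacing a nonzero component keeps the sparsity. -/
lemma update_mem_sparseVectors {j : Fin p} (hβ : β ∈ sparseVectors p M) (hj : β j ≠ 0) (t : ℝ) :
    Function.update β j t ∈ sparseVectors p M := by
  refine two_mul_card_lt_mono (Finset.card_le_card fun i hi => ?_) hβ
  rw [mem_supp] at hi ⊢
  by_cases h : i = j
  · subst h; exact hj
  · rwa [Function.update_of_ne h] at hi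

/-- On the event that the noise is nearly uncorrelated with all covariates, every global minimizer
has the support of `β₀`. Components strictly between `0` and the threshold can occur only through
ties; each of them could be moved both to `0` and beyond the threshold, which would
give two minimizers with different supports. -/
lemma supp_eq_of_minimizer (hpen : pen = hardPenalty ∨ pen = l0Penalty) (hlam : 0 < lam)
    (hc : 0 < c) (hn : 0 < n) (hcol : ∀ j, l2 (fun i => X i j) = √(n : ℝ))
    (h1 : lam < b₀) (h2 : 2 * lam ^ 2 ≤ c ^ 2 * b₀ ^ 2)
    (hb₀ : ∀ j, β₀ j = 0 ∨ b₀ ≤ |β₀ j|)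
    (hlow : (2 * l0 β₀ + 1) * a ^ 2 < c ^ 2 * lam ^ 2)
    (hsig : 16 * (2 * l0 β₀ + 1) * a ^ 2 < c ^ 4 * b₀ ^ 2)
    (hnoise : ∀ j, |e ⬝ᵥ (fun i => X i j)| ≤ n * a)
    (hβ₀ : β₀ ∈ sparseVectors p (rspark c X)) (hβ : β ∈ sparseVectors p (rspark c X))
    (hmin : IsMinOn (penLS pen lam X (X *ᵥ β₀ + e)) (sparseVectors p (rspark c X)) β) :
    supp β = supp β₀ := by
  induction hm : ({j | β j ≠ 0 ∧ |β j| < lam} : Finset (Fin p)).card generalizing β with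
  | zero =>
    refine supp_eq_of_thresholded hpen hlam hc hn h1 h2 hb₀ hlow hsig hnoise hβ₀ hβ hmin ?_
    intro j hj
    by_contra! hlt
    rw [Finset.card_eq_zero] at hm
    have : j ∈ ({j | β j ≠ 0 ∧ |β j| < lam} : Finset (Fin p)) :=
      Finset.mem_filter.2 ⟨Finset.mem_univ j, hj, hlt⟩
    rw [hm] at this
    simp at this
  | succ m ih =>
    exfalso
    obtain ⟨j, hj⟩ := Finset.card_pos.1 (by rw [hm]; omega :
      0 < ({j | β j ≠ 0 ∧ |β j| < lam} : Finset (Fin p)).card)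
    have hj' := (Finset.mem_filter.1 hj).2
    obtain ⟨C, z, hφ⟩ := penLS_update (pen := pen) (lam := lam) hn hcol (X *ᵥ β₀ + e) β j
    have hself : penLS pen lam X (X *ᵥ β₀ + e) β
        = C + (β j ^ 2 / 2 - z * β j + pen lam |β j|) := by
      rw [← hφ, Function.update_eq_self]
    obtain ⟨t₁, ht₁, hle₁, hle₀⟩ := univariate_tie (z := z) hpen hlam hj'.1 hj'.2 fun t => by
      have : penLS pen lam X (X *ᵥ β₀ + e) β ≤ _ :=
        hmin (update_mem_sparseVectors hβ hj'.1 t)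
      rw [hself, hφ] at this
      linarith
    have hcardm : ∀ t : ℝ, (t = 0 ∨ lam ≤ |t|) →
        ({i | Function.update β j t i ≠ 0 ∧ |Function.update β j t i| < lam} :
          Finset (Fin p)).card = m := by
      intro t ht
      have : ({i | Function.update β j t i ≠ 0 ∧ |Function.update β j t i| < lam} :
          Finset (Fin p)) = ({i | β i ≠ 0 ∧ |β i| < lam} : Finset (Fin p)).erase j := by
        ext i
        rw [Finset.mem_erase, Finset.mem_filter, Finset.mem_filter]
        by_cases h : i = j
        · subst h
          rw [Function.update_self]
          rcases ht with rfl | ht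
          · simp
          · simp [ht]
        · rw [Function.update_of_ne h]
          simp [h]
      rw [this, Finset.card_erase_of_mem hj, hm]
      rfl
    have hmin' : ∀ t : ℝ, t ^ 2 / 2 - z * t + pen lam |t|
        ≤ β j ^ 2 / 2 - z * β j + pen lam |β j| →
        IsMinOn (penLS pen lam X (X *ᵥ β₀ + e)) (sparseVectors p (rspark c X))
          (Function.update β j t) := by
      intro t ht β' hβ'
      have : penLS pen lam X (X *ᵥ β₀ + e) β ≤ penLS pen lam X (X *ᵥ β₀ + e) β' := hmin hβ'
      change penLS pen lam X (X *ᵥ β₀ + e) _ ≤ penLS pen lam X (X *ᵥ β₀ + e) β'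
      rw [hφ]
      linarith
    have hs₀ := ih (update_mem_sparseVectors hβ hj'.1 0) (hmin' 0 hle₀) (hcardm 0 (Or.inl rfl))
    have hs₁ := ih (update_mem_sparseVectors hβ hj'.1 t₁) (hmin' t₁ hle₁) (hcardm t₁ (Or.inr ht₁))
    have hmem : j ∈ supp (Function.update β j t₁) := by
      rw [mem_supp, Function.update_self]
      intro h
      rw [h, abs_zero] at ht₁
      linarith
    rw [hs₁, ← hs₀, mem_supp, Function.update_self] at hmem
    exact hmem rfl

end Selection

/-! ### Gaussian noise -/

section Noise

variable {n : ℕ} {Ω : Type*} [MeasurableSpace Ω] {μ : Measure Ω} {σ : ℝ} {ε : Ω → Fin n → ℝ}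

/-- The fourth moment of the distribution `N(0, σ²)`. -/
def fourthMoment (σ : ℝ) : ℝ := ∫ x, x ^ 4 ∂gaussianReal 0 (σ ^ 2).toNNReal

lemma fourthMoment_nonneg (σ : ℝ) : 0 ≤ fourthMoment σ :=
  integral_nonneg fun x => by positivity

lemma hasLaw_noise_apply
    (hε : HasLaw ε (Measure.pi fun _ : Fin n => gaussianReal 0 (σ ^ 2).toNNReal) μ)
    (i : Fin n) :
    HasLaw (fun ω => ε ω i) (gaussianReal 0 (σ ^ 2).toNNReal) μ :=
  (measurePreserving_eval (fun _ : Fin n => gaussianReal 0 (σ ^ 2).toNNReal) i).fun_comp_hasLaw hε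

lemma iIndepFun_noise
    (hε : HasLaw ε (Measure.pi fun _ : Fin n => gaussianReal 0 (σ ^ 2).toNNReal) μ) :
    iIndepFun (fun i ω => ε ω i) μ := by
  have := hε.isProbabilityMeasure
  exact (iIndepFun_iff_hasLaw_pi_pi (hasLaw_noise_apply hε)).2 hε

lemma memLp_noise_apply
    (hε : HasLaw ε (Measure.pi fun _ : Fin n => gaussianReal 0 (σ ^ 2).toNNReal) μ)
    (i : Fin n) (q : NNReal) : MemLp (fun ω => ε ω i) q μ := by
  have h := hasLaw_noise_apply hε i
  have h1 := memLp_id_gaussianReal (μ := 0) (v := (σ ^ 2).toNNReal) q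
  rw [← h.map_eq] at h1
  exact (memLp_map_measure_iff aestronglyMeasurable_id h.aemeasurable).1 h1

lemma memLp_noise_dotProduct
    (hε : HasLaw ε (Measure.pi fun _ : Fin n => gaussianReal 0 (σ ^ 2).toNNReal) μ)
    (u : Fin n → ℝ) : MemLp (fun ω => ε ω ⬝ᵥ u) 2 μ := by
  have : (fun ω => ε ω ⬝ᵥ u) = fun ω => ∑ i, ε ω i * u i := rfl
  rw [this]
  exact memLp_finsetSum _ fun i _ => (memLp_noise_apply hε i 2).mul_const (u i)

lemma integral_noise_dotProduct
    (hε : HasLaw ε (Measure.pi fun _ : Fin n => gaussianReal 0 (σ ^ 2).toNNReal) μ)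
    (u : Fin n → ℝ) : ∫ ω, ε ω ⬝ᵥ u ∂μ = 0 := by
  have := hε.isProbabilityMeasure
  simp only [dotProduct]
  rw [integral_finsetSum _ fun i _ =>
    ((memLp_noise_apply hε i 1).integrable (by simp)).mul_const (u i)]
  refine Finset.sum_eq_zero fun i _ => ?_
  rw [integral_mul_const, (hasLaw_noise_apply hε i).integral_eq, integral_id_gaussianReal, zero_mul]

lemma integral_noise_dotProduct_sq
    (hε : HasLaw ε (Measure.pi fun _ : Fin n => gaussianReal 0 (σ ^ 2).toNNReal) μ)
    (u : Fin n → ℝ) :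
    ∫ ω, (ε ω ⬝ᵥ u) ^ 2 ∂μ = σ ^ 2 * (u ⬝ᵥ u) := by
  have := hε.isProbabilityMeasure
  have h1 := variance_of_integral_eq_zero (memLp_noise_dotProduct hε u).aemeasurable
    (integral_noise_dotProduct hε u)
  rw [← h1]
  have h2 : (fun ω => ε ω ⬝ᵥ u) = ∑ i, fun ω => u i * ε ω i := by
    ext ω; simp [dotProduct, mul_comm]
  have hind := iIndepFun_noise hε
  rw [h2, IndepFun.variance_sum (fun i _ => (memLp_noise_apply hε i 2).const_mul (u i))]
  · simp only [dotProduct, Finset.mul_sum]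
    refine Finset.sum_congr rfl fun i _ => ?_
    rw [variance_const_mul, (hasLaw_noise_apply hε i).variance_eq, variance_id_gaussianReal,
      Real.coe_toNNReal _ (sq_nonneg σ)]
    ring
  · intro i _ j _ hij
    exact (hind.indepFun hij).comp (measurable_const_mul (u i)) (measurable_const_mul (u j))

/-- The Gaussian tail bound for one linear functional of the noise. -/
lemma measure_noise_dotProduct_gt_le
    (hε : HasLaw ε (Measure.pi fun _ : Fin n => gaussianReal 0 (σ ^ 2).toNNReal) μ)
    {u : Fin n → ℝ} {N t : ℝ} (hu : u ⬝ᵥ u = N)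
    (ht : 0 ≤ t) :
    μ.real {ω | t < |ε ω ⬝ᵥ u|} ≤ 2 * Real.exp (-t ^ 2 / (2 * (σ ^ 2 * N))) := by
  have := hε.isProbabilityMeasure
  have hcoord : ∀ i, HasSubgaussianMGF (fun ω => ε ω i) (σ ^ 2).toNNReal μ := by
    intro i
    have h := hasLaw_noise_apply hε i
    refine (HasSubgaussianMGF.id_map_iff h.aemeasurable).1 ?_
    rw [h.map_eq]
    refine ⟨fun t => integrable_exp_mul_gaussianReal t, fun t => ?_⟩
    rw [mgf_id_gaussianReal]
    simp
  have hsum : HasSubgaussianMGF (fun ω => ε ω ⬝ᵥ u)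
      (∑ i, NNReal.mk (u i ^ 2) (sq_nonneg _) * (σ ^ 2).toNNReal) μ := by
    have h2 : (fun ω => ε ω ⬝ᵥ u) = fun ω => ∑ i, u i * ε ω i := by
      ext ω; simp [dotProduct, mul_comm]
    rw [h2]
    refine HasSubgaussianMGF.sum_of_iIndepFun ?_ fun i _ => (hcoord i).const_mul (u i)
    exact (iIndepFun_noise hε).comp (fun i x => u i * x) fun i => measurable_const_mul (u i)
  have hpar : ((∑ i, NNReal.mk (u i ^ 2) (sq_nonneg _) * (σ ^ 2).toNNReal : NNReal) : ℝ) = σ ^ 2 * N := by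
    rw [← hu, NNReal.coe_sum]
    simp only [dotProduct, Finset.mul_sum, NNReal.coe_mul, Real.coe_toNNReal _ (sq_nonneg σ)]
    refine Finset.sum_congr rfl fun i _ => ?_
    rw [NNReal.coe_mk]
    ring
  have h1 := hsum.measure_ge_le ht
  have h2 := hsum.neg.measure_ge_le ht
  rw [hpar] at h1 h2
  have hsub : {ω | t < |ε ω ⬝ᵥ u|} ⊆ {ω | t ≤ ε ω ⬝ᵥ u} ∪ {ω | t ≤ (-fun ω => ε ω ⬝ᵥ u) ω} := by
    intro ω hω
    rcases lt_abs.1 (show t < |ε ω ⬝ᵥ u| from hω) with h | h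
    · exact Or.inl h.le
    · exact Or.inr h.le
  calc μ.real {ω | t < |ε ω ⬝ᵥ u|}
      ≤ μ.real {ω | t ≤ ε ω ⬝ᵥ u} + μ.real {ω | t ≤ (-fun ω => ε ω ⬝ᵥ u) ω} :=
        (measureReal_mono hsub).trans (measureReal_union_le _ _)
    _ ≤ _ := by linarith

lemma integrable_noise_sq
    (hε : HasLaw ε (Measure.pi fun _ : Fin n => gaussianReal 0 (σ ^ 2).toNNReal) μ) :
    Integrable (fun ω => l2 (ε ω) ^ 2) μ := by
  simp only [l2_sq_eq_sum]
  exact integrable_finsetSum _ fun i _ => (memLp_noise_apply hε i 2).integrable_sq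

lemma integrable_noise_four
    (hε : HasLaw ε (Measure.pi fun _ : Fin n => gaussianReal 0 (σ ^ 2).toNNReal) μ)
    (i : Fin n) : Integrable (fun ω => ε ω i ^ 4) μ := by
  have := (memLp_noise_apply hε i 4).integrable_norm_pow (p := 4) (by norm_num)
  refine this.congr (ae_of_all _ fun ω => ?_)
  simp only [Real.norm_eq_abs]
  exact Even.pow_abs ⟨2, rfl⟩ _

lemma integral_noise_four
    (hε : HasLaw ε (Measure.pi fun _ : Fin n => gaussianReal 0 (σ ^ 2).toNNReal) μ)
    (i : Fin n) : ∫ ω, ε ω i ^ 4 ∂μ = fourthMoment σ :=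
  (hasLaw_noise_apply hε i).integral_comp (f := fun x => x ^ 4) (by fun_prop)

/-- Jensen's inequality for the mean of the squared noise components. -/
lemma noise_sq_sq_le (e : Fin n → ℝ) :
    ((n : ℝ)⁻¹ * l2 e ^ 2) ^ 2 ≤ (n : ℝ)⁻¹ * ∑ i, e i ^ 4 := by
  rcases Nat.eq_zero_or_pos n with rfl | hn
  · simp
  have hn' : (0 : ℝ) < n := by exact_mod_cast hn
  have h := sq_sum_le_card_mul_sum_sq (s := (Finset.univ : Finset (Fin n))) (f := fun i => e i ^ 2)
  rw [Finset.card_univ, Fintype.card_fin] at h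
  simp only [← pow_mul] at h
  rw [mul_pow, l2_sq_eq_sum]
  calc (n : ℝ)⁻¹ ^ 2 * (∑ i, e i ^ 2) ^ 2 ≤ (n : ℝ)⁻¹ ^ 2 * (n * ∑ i, e i ^ 4) := by gcongr
    _ = _ := by field_simp

/-- On an event of probability at most `π²` the mean squared noise contributes only `O(π)`. -/
lemma setIntegral_noise_le
    (hε : HasLaw ε (Measure.pi fun _ : Fin n => gaussianReal 0 (σ ^ 2).toNNReal) μ)
    (hn : 0 < n) {A : Set Ω} {π : ℝ} (hπ : 0 < π)
    (hA : μ.real A ≤ π ^ 2) :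
    ∫ ω in A, (n : ℝ)⁻¹ * l2 (ε ω) ^ 2 ∂μ ≤ (fourthMoment σ + 1) / 2 * π := by
  have := hε.isProbabilityMeasure
  have hn' : (0 : ℝ) < n := by exact_mod_cast hn
  have hi4 : Integrable (fun ω => (n : ℝ)⁻¹ * ∑ i, ε ω i ^ 4) μ :=
    (integrable_finsetSum _ fun i _ => integrable_noise_four hε i).const_mul _
  have hm4 : ∫ ω, (n : ℝ)⁻¹ * ∑ i, ε ω i ^ 4 ∂μ = fourthMoment σ := by
    rw [integral_const_mul, integral_finsetSum _ fun i _ => integrable_noise_four hε i]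
    simp only [integral_noise_four hε, Finset.sum_const, Finset.card_univ, Fintype.card_fin,
      nsmul_eq_mul]
    field_simp
  calc ∫ ω in A, (n : ℝ)⁻¹ * l2 (ε ω) ^ 2 ∂μ
      ≤ ∫ ω in A, (π / 2 * ((n : ℝ)⁻¹ * ∑ i, ε ω i ^ 4) + π⁻¹ / 2) ∂μ := by
        refine integral_mono ((integrable_noise_sq hε).const_mul _).integrableOn
          ((hi4.const_mul _).add (integrable_const _)).integrableOn fun ω => ?_
        have h1 := noise_sq_sq_le (ε ω)
        set T := (n : ℝ)⁻¹ * l2 (ε ω) ^ 2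
        have h2 : 0 ≤ π⁻¹ / 2 * (π * T - 1) ^ 2 := by positivity
        have h3 : π⁻¹ / 2 * (π * T - 1) ^ 2 = π / 2 * T ^ 2 - T + π⁻¹ / 2 := by
          field_simp; ring
        have h4 := mul_le_mul_of_nonneg_left h1 (by positivity : 0 ≤ π / 2)
        simp only
        linarith
    _ = π / 2 * ∫ ω in A, (n : ℝ)⁻¹ * ∑ i, ε ω i ^ 4 ∂μ + μ.real A * (π⁻¹ / 2) := by
        rw [integral_add (hi4.const_mul _).integrableOn (integrable_const _).integrableOn,
          integral_const_mul, setIntegral_const, smul_eq_mul]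
    _ ≤ π / 2 * fourthMoment σ + π ^ 2 * (π⁻¹ / 2) := by
        gcongr
        rw [← hm4]
        exact setIntegral_le_integral hi4 (ae_of_all _ fun ω => by positivity)
    _ = _ := by field_simp

end Noise

/-! ### The risk as a function of the ridge parameter -/

section Refit

variable {n p : ℕ} {c c₃ l l' σ : ℝ} {X : Matrix (Fin n) (Fin p) ℝ} {β₀ : Fin p → ℝ}
  {e : Fin n → ℝ} {S : Finset (Fin p)}

/-- The noise norm on the scale on which it enters the estimation error. -/
def noiseLevel (e : Fin n → ℝ) : ℝ := (√(n : ℝ))⁻¹ * l2 e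

lemma noiseLevel_nonneg (e : Fin n → ℝ) : 0 ≤ noiseLevel e :=
  mul_nonneg (by positivity) (l2_nonneg _)

lemma noiseLevel_sq (e : Fin n → ℝ) : noiseLevel e ^ 2 = (n : ℝ)⁻¹ * l2 e ^ 2 := by
  rw [noiseLevel, mul_pow, inv_pow, Real.sq_sqrt (Nat.cast_nonneg n)]

/-- A bound for the refitted estimator on any set of columns below the robust spark, and for its
error. -/
def errorBound (c c₃ : ℝ) (β₀ : Fin p → ℝ) (e : Fin n → ℝ) : ℝ :=
  l2 β₀ + c⁻¹ * (c₃ * l2 β₀ + noiseLevel e)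

lemma card_lt_rspark {M : ℕ∞} (h : 2 * (S.card : ℕ∞) < M) : (S.card : ℕ∞) < M :=
  lt_of_le_of_lt (by rw [two_mul]; exact le_self_add) h

lemma l2_ridge_response_le (hc : 0 < c) (hn : 0 < n)
    (hup : ∀ δ : Fin p → ℝ, 2 * (l0 δ : ℕ∞) < rspark c X → l2 δ = 1 →
      (√(n : ℝ))⁻¹ * l2 (X *ᵥ δ) ≤ c₃)
    (hβ₀ : β₀ ∈ sparseVectors p (rspark c X)) (hS : 2 * (S.card : ℕ∞) < rspark c X) (hl : 0 ≤ l)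
    (e : Fin n → ℝ) :
    l2 (ridge X S l (X *ᵥ β₀ + e)) ≤ c⁻¹ * (c₃ * l2 β₀ + noiseLevel e) := by
  have hn' : (0 : ℝ) < √(n : ℝ) := Real.sqrt_pos.2 (by exact_mod_cast hn)
  have h1 := l2_ridge_le hc hn (card_lt_rspark hS) hl (X *ᵥ β₀ + e)
  have h2 := l2_add_le (X *ᵥ β₀) e
  have h3 := sparse_upper_le hn hup hβ₀
  rw [noiseLevel, ← div_eq_inv_mul, le_div_iff₀ hc]
  refine le_of_mul_le_mul_left ?_ hn'
  rw [mul_add, mul_inv_cancel_left₀ hn'.ne']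
  linarith

lemma tendsto_of_l2_sub {ι : Type*} {F : Filter ι} {f : ι → Fin p → ℝ} {a : Fin p → ℝ}
    (h : Tendsto (fun i => l2 (f i - a)) F (𝓝 0)) : Tendsto f F (𝓝 a) := by
  rw [tendsto_pi_nhds]
  intro j
  rw [tendsto_iff_norm_sub_tendsto_zero]
  exact squeeze_zero (fun _ => norm_nonneg _) (fun i => abs_apply_le_l2 (f i - a) j) h

lemma tendsto_ridge_nhdsWithin (hc : 0 < c) (hn : 0 < n) (hS : (S.card : ℕ∞) < rspark c X)
    (hl : 0 ≤ l) (y : Fin n → ℝ) :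
    Tendsto (fun t => ridge X S t y) (𝓝[Set.Ici 0] l) (𝓝 (ridge X S l y)) := by
  have hn' : (0 : ℝ) < n := by exact_mod_cast hn
  refine tendsto_of_l2_sub ?_
  have h0 : Tendsto (fun t => (c ^ 2 * n)⁻¹ * (|t - l| * l2 (ridge X S l y)))
      (𝓝[Set.Ici 0] l) (𝓝 0) := by
    have : Continuous fun t => (c ^ 2 * n)⁻¹ * (|t - l| * l2 (ridge X S l y)) := by fun_prop
    have h := (this.tendsto l).mono_left (nhdsWithin_le_nhds (s := Set.Ici 0))
    simpa using h
  refine squeeze_zero' (Eventually.of_forall fun _ => l2_nonneg _) ?_ h0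
  filter_upwards [self_mem_nhdsWithin] with t ht
  have := l2_ridge_sub_le hc hn hS ht hl y
  rw [← div_eq_inv_mul, le_div_iff₀ (by positivity)]
  linarith

/-- For large ridge parameters the estimator degenerates to zero. -/
lemma tendsto_ridge_atTop (hc : 0 < c) (hn : 0 < n) (hS : (S.card : ℕ∞) < rspark c X)
    (y : Fin n → ℝ) : Tendsto (fun t => ridge X S t y) atTop (𝓝 0) := by
  refine tendsto_of_l2_sub ?_
  simp only [sub_zero]
  have h0 : Tendsto (fun t : ℝ => √(l2 y ^ 2 / t)) atTop (𝓝 0) := by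
    have := (tendsto_const_nhds (x := l2 y ^ 2)).div_atTop (tendsto_id (α := ℝ) (x := atTop))
    simpa using this.sqrt
  refine squeeze_zero' (Eventually.of_forall fun _ => l2_nonneg _) ?_ h0
  filter_upwards [eventually_gt_atTop 0] with t ht
  have := mul_l2_ridge_sq_le hc hn hS ht.le y
  refine Real.le_sqrt_of_sq_le ?_
  rw [le_div_iff₀ ht]
  linarith

variable {Ω : Type*} {ε : Ω → Fin n → ℝ}
  {bh : Ω → Fin p → ℝ} {loss : (Fin p → ℝ) → ℝ} {A : ℝ}

lemma l2_refitError_le (hc : 0 < c) (hn : 0 < n)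
    (hup : ∀ δ : Fin p → ℝ, 2 * (l0 δ : ℕ∞) < rspark c X → l2 δ = 1 →
      (√(n : ℝ))⁻¹ * l2 (X *ᵥ δ) ≤ c₃)
    (hβ₀ : β₀ ∈ sparseVectors p (rspark c X)) {ω : Ω} (hb : bh ω ∈ sparseVectors p (rspark c X))
    (hl : 0 ≤ l) : l2 (refitError X β₀ ε bh l ω) ≤ errorBound c c₃ β₀ (ε ω) := by
  have := l2_ridge_response_le hc hn hup hβ₀ (S := supp (bh ω)) hb hl (ε ω)
  have h2 := l2_sub_le (ridge X (supp (bh ω)) l (X *ᵥ β₀ + ε ω)) β₀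
  unfold refitError errorBound response
  linarith

lemma measurableSet_supp_eq (S : Finset (Fin p)) : MeasurableSet {β : Fin p → ℝ | supp β = S} := by
  have : {β : Fin p → ℝ | supp β = S} = ⋂ j, {β | β j ≠ 0 ↔ j ∈ S} := by
    ext β
    simp [Finset.ext_iff, mem_supp]
  rw [this]
  refine MeasurableSet.iInter fun j => ?_
  have h0 : MeasurableSet {β : Fin p → ℝ | β j ≠ 0} :=
    (measurable_pi_apply j : Measurable fun β : Fin p → ℝ => β j)
      (measurableSet_singleton (0 : ℝ)).compl
  by_cases hj : j ∈ S
  · simpa [hj] using h0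
  · convert h0.compl using 1
    ext β
    simp [hj]

lemma measurable_ridge_supp (X : Matrix (Fin n) (Fin p) ℝ) (l : ℝ) :
    Measurable fun q : (Fin p → ℝ) × (Fin n → ℝ) => ridge X (supp q.1) l q.2 := by
  have : (fun q : (Fin p → ℝ) × (Fin n → ℝ) => ridge X (supp q.1) l q.2) =
      fun q => ∑ S : Finset (Fin p), if q.1 ∈ {β : Fin p → ℝ | supp β = S} then ridge X S l q.2
        else 0 := by
    ext q : 1
    simp
  rw [this]
  refine Finset.measurable_sum _ fun S _ => Measurable.ite ?_ ?_ measurable_const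
  · exact measurable_fst (measurableSet_supp_eq S)
  · exact (continuous_ridge X S l).measurable.comp measurable_snd

variable [MeasurableSpace Ω] {μ : Measure Ω}

lemma aemeasurable_refitError (hε : AEMeasurable ε μ) (hb : AEMeasurable bh μ) (l : ℝ) :
    AEMeasurable (refitError X β₀ ε bh l) μ := by
  have h1 : AEMeasurable (fun ω => (bh ω, response X β₀ ε ω)) μ :=
    hb.prodMk (aemeasurable_const.add hε)
  exact ((measurable_ridge_supp X l).comp_aemeasurable h1).sub_const β₀

lemma errorBound_sq_le (hc : 0 < c) (β₀ : Fin p → ℝ) (e : Fin n → ℝ) :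
    errorBound c c₃ β₀ e ^ 2
      ≤ 2 * ((1 + c₃ / c) ^ 2 + 1 / c ^ 2) * (l2 β₀ ^ 2 + (n : ℝ)⁻¹ * l2 e ^ 2) := by
  have h : errorBound c c₃ β₀ e = (1 + c₃ / c) * l2 β₀ + 1 / c * noiseLevel e := by
    unfold errorBound; field_simp; ring
  rw [h, ← noiseLevel_sq]
  have h1 : (1 / c) ^ 2 = 1 / c ^ 2 := by rw [div_pow, one_pow]
  rw [← h1]
  nlinarith [sq_nonneg ((1 + c₃ / c) * l2 β₀ - 1 / c * noiseLevel e),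
    sq_nonneg ((1 + c₃ / c) * noiseLevel e), sq_nonneg (1 / c * l2 β₀)]

lemma integrable_lossBound [IsProbabilityMeasure μ] (hc : 0 < c)
    (hA : 0 ≤ A)
    (hε : HasLaw ε (Measure.pi fun _ : Fin n => gaussianReal 0 (σ ^ 2).toNNReal) μ) :
    Integrable (fun ω => A * (1 + errorBound c c₃ β₀ (ε ω) ^ 2)) μ := by
  have h1 : Integrable (fun ω => A * (1 + 2 * ((1 + c₃ / c) ^ 2 + 1 / c ^ 2) *
      (l2 β₀ ^ 2 + (n : ℝ)⁻¹ * l2 (ε ω) ^ 2))) μ := by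
    have h2 : Integrable (fun ω => l2 β₀ ^ 2 + (n : ℝ)⁻¹ * l2 (ε ω) ^ 2) μ :=
      (integrable_const _).add ((integrable_noise_sq hε).const_mul _)
    exact ((integrable_const 1).add (h2.const_mul _)).const_mul A
  refine h1.mono' ?_ (ae_of_all _ fun ω => ?_)
  · have : Continuous fun e : Fin n → ℝ => A * (1 + errorBound c c₃ β₀ e ^ 2) := by
      unfold errorBound noiseLevel
      have := continuous_l2 (m := n)
      fun_prop
    exact (this.measurable.comp_aemeasurable hε.aemeasurable).aestronglyMeasurable
  · rw [Real.norm_of_nonneg (by positivity)]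
    have := errorBound_sq_le (c₃ := c₃) hc β₀ (ε ω)
    gcongr

variable (hc : 0 < c) (hn : 0 < n)
    (hup : ∀ δ : Fin p → ℝ, 2 * (l0 δ : ℕ∞) < rspark c X → l2 δ = 1 →
      (√(n : ℝ))⁻¹ * l2 (X *ᵥ δ) ≤ c₃)
    (hβ₀ : β₀ ∈ sparseVectors p (rspark c X))
    (hε : HasLaw ε (Measure.pi fun _ : Fin n => gaussianReal 0 (σ ^ 2).toNNReal) μ)
    (hbm : AEMeasurable bh μ) (hb : ∀ᵐ ω ∂μ, bh ω ∈ sparseVectors p (rspark c X))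
    (hloss : Continuous loss) (hA : 0 ≤ A) (hgrow : ∀ v, |loss v| ≤ A * (1 + l2 v ^ 2))

include hc hn hup hβ₀ hb hgrow hA in
lemma ae_norm_loss_le :
    ∀ᵐ ω ∂μ, ∀ l, 0 ≤ l → ‖loss (refitError X β₀ ε bh l ω)‖
      ≤ A * (1 + errorBound c c₃ β₀ (ε ω) ^ 2) := by
  filter_upwards [hb] with ω hω l hl
  refine (hgrow _).trans ?_
  have := l2_refitError_le (ε := ε) hc hn hup hβ₀ hω hl
  have h0 := l2_nonneg (refitError X β₀ ε bh l ω)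
  gcongr

variable [IsProbabilityMeasure μ]

include hc hn hup hβ₀ hε hbm hb hloss hA hgrow

lemma integrable_loss (hl : 0 ≤ l) :
    Integrable (fun ω => loss (refitError X β₀ ε bh l ω)) μ := by
  refine (integrable_lossBound (c₃ := c₃) hc hA hε (β₀ := β₀)).mono' ?_ ?_
  · exact (hloss.measurable.comp_aemeasurable
      (aemeasurable_refitError hε.aemeasurable hbm l)).aestronglyMeasurable
  · filter_upwards [ae_norm_loss_le hc hn hup hβ₀ hb hA hgrow (ε := ε)] with ω hω
    exact hω l hl

lemma tendsto_risk_of_tendsto_ridge {F : Filter ℝ} [F.IsCountablyGenerated]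
    (hF : ∀ᶠ t in F, 0 ≤ t) {r : Ω → Fin p → ℝ}
    (hr : ∀ᵐ ω ∂μ, Tendsto (fun t => ridge X (supp (bh ω)) t (response X β₀ ε ω)) F (𝓝 (r ω))) :
    Tendsto (fun t => risk μ loss (refitError X β₀ ε bh t)) F
      (𝓝 (risk μ loss fun ω => r ω - β₀)) := by
  refine tendsto_integral_filter_of_dominated_convergence
    (fun ω => A * (1 + errorBound c c₃ β₀ (ε ω) ^ 2)) ?_ ?_
    (integrable_lossBound hc hA hε (β₀ := β₀)) ?_
  · exact Eventually.of_forall fun t => (hloss.measurable.comp_aemeasurable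
      (aemeasurable_refitError hε.aemeasurable hbm t)).aestronglyMeasurable
  · filter_upwards [hF] with t ht
    filter_upwards [ae_norm_loss_le hc hn hup hβ₀ hb hA hgrow (ε := ε)] with ω hω
    exact hω t ht
  · filter_upwards [hr] with ω hω
    exact (hloss.tendsto _).comp (hω.sub_const β₀)

/-- The minimum of the risk over `l ≥ 0` is attained as soon as the risk at `l = 0` is below the
loss of the zero estimator, which is the limit of the risk at infinity. -/
lemma exists_isOptimalRidge (h0 : risk μ loss (refitError X β₀ ε bh 0) < loss (-β₀)) :
    ∃ l, IsOptimalRidge μ loss (refitError X β₀ ε bh) l := by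
  have hcont : ContinuousOn (fun t => risk μ loss (refitError X β₀ ε bh t)) (Set.Ici 0) := by
    intro t ht
    refine tendsto_risk_of_tendsto_ridge hc hn hup hβ₀ hε hbm hb hloss hA hgrow
      self_mem_nhdsWithin (r := fun ω => ridge X (supp (bh ω)) t (response X β₀ ε ω)) ?_
    filter_upwards [hb] with ω hω
    exact tendsto_ridge_nhdsWithin hc hn (card_lt_rspark hω) ht _
  have htop : Tendsto (fun t => risk μ loss (refitError X β₀ ε bh t)) atTop (𝓝 (loss (-β₀))) := by
    have := tendsto_risk_of_tendsto_ridge hc hn hup hβ₀ hε hbm hb hloss hA hgrow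
      (eventually_ge_atTop 0) (r := fun _ => 0) (by
        filter_upwards [hb] with ω hω
        exact tendsto_ridge_atTop hc hn (card_lt_rspark hω) _)
    simpa [risk] using this
  obtain ⟨T, hT⟩ := eventually_atTop.1 (htop.eventually (lt_mem_nhds h0))
  obtain ⟨l, hl, hmin⟩ := (isCompact_Icc (a := (0 : ℝ)) (b := max T 0)).exists_isMinOn
    ⟨0, le_rfl, le_max_right _ _⟩ (hcont.mono Set.Icc_subset_Ici_self)
  refine ⟨l, fun t ht => integrable_loss hc hn hup hβ₀ hε hbm hb hloss hA hgrow ht, hl.1,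
    fun t ht => ?_⟩
  rcases le_total t (max T 0) with h | h
  · exact hmin ⟨ht, h⟩
  · exact (hmin ⟨le_rfl, le_max_right _ _⟩).trans (hT t ((le_max_left _ _).trans h)).le

end Refit

/-! ### Quadratic risks: the oracle part and the remainder -/

section Quadratic

variable {n p m : ℕ} {c c₃ κ l l' σ : ℝ} {X : Matrix (Fin n) (Fin p) ℝ} {β₀ : Fin p → ℝ}
  {A : Matrix (Fin m) (Fin p) ℝ} {Ω : Type*} {ε : Ω → Fin n → ℝ} {bh : Ω → Fin p → ℝ} {ω : Ω}

/-- The quadratic loss `‖A v‖₂²`. -/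
def quadLoss (A : Matrix (Fin m) (Fin p) ℝ) (v : Fin p → ℝ) : ℝ := l2 (A *ᵥ v) ^ 2

lemma sqLoss_eq_quadLoss : (sqLoss : (Fin p → ℝ) → ℝ) = quadLoss (1 : Matrix (Fin p) (Fin p) ℝ) := by
  ext v; simp [sqLoss, quadLoss]

lemma predLoss_eq_quadLoss : predLoss X = quadLoss ((√(n : ℝ))⁻¹ • X) := by
  ext v
  rw [predLoss, quadLoss, smul_mulVec, l2_smul, mul_pow, sq_abs, inv_pow,
    Real.sq_sqrt (Nat.cast_nonneg n)]

lemma continuous_quadLoss : Continuous (quadLoss A) := by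
  unfold quadLoss
  have := continuous_l2 (m := m)
  fun_prop

lemma exists_quadLoss_le (A : Matrix (Fin m) (Fin p) ℝ) :
    ∃ C, 0 ≤ C ∧ ∀ v, |quadLoss A v| ≤ C * (1 + l2 v ^ 2) := by
  refine ⟨∑ i, l2 (A i) ^ 2, Finset.sum_nonneg fun i _ => sq_nonneg _, fun v => ?_⟩
  rw [quadLoss, abs_of_nonneg (sq_nonneg _), l2_sq_eq_sum, Finset.sum_mul]
  refine Finset.sum_le_sum fun i _ => ?_
  have h1 : (A *ᵥ v) i ^ 2 ≤ (l2 (A i) * l2 v) ^ 2 := by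
    rw [← sq_abs]
    exact pow_le_pow_left₀ (abs_nonneg _) (abs_dotProduct_le_l2 (A i) v) 2
  nlinarith [sq_nonneg (l2 (A i))]

lemma l0_ridge_le (X : Matrix (Fin n) (Fin p) ℝ) (S : Finset (Fin p)) (l : ℝ) (y : Fin n → ℝ) :
    l0 (ridge X S l y) ≤ S.card :=
  Finset.card_le_card (supp_ridge_subset X S l y)

lemma errorBound_nonneg (hc : 0 < c) (hc₃ : 0 < c₃) (e : Fin n → ℝ) :
    0 ≤ errorBound c c₃ β₀ e := by
  have := l2_nonneg β₀
  have := noiseLevel_nonneg e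
  unfold errorBound
  positivity

variable (hc : 0 < c) (hc₃ : 0 < c₃) (hn : 0 < n)
    (hup : ∀ δ : Fin p → ℝ, 2 * (l0 δ : ℕ∞) < rspark c X → l2 δ = 1 →
      (√(n : ℝ))⁻¹ * l2 (X *ᵥ δ) ≤ c₃)
    (hβ₀ : β₀ ∈ sparseVectors p (rspark c X))
    (hκ : 0 ≤ κ) (hA : ∀ u ∈ sparseVectors p (rspark c X), l2 (A *ᵥ u) ≤ κ * l2 u)

include hc hn hup hβ₀ hκ hA in
lemma l2_mulVec_refitError_le (hb : bh ω ∈ sparseVectors p (rspark c X)) (hl : 0 ≤ l) :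
    l2 (A *ᵥ refitError X β₀ ε bh l ω) ≤ κ * errorBound c c₃ β₀ (ε ω) := by
  have h1 := l2_ridge_response_le hc hn hup hβ₀ (S := supp (bh ω)) hb hl (ε ω)
  have h2 := hA _ (two_mul_card_lt_mono
    (l0_ridge_le X (supp (bh ω)) l (X *ᵥ β₀ + ε ω)) hb : _ ∈ sparseVectors p (rspark c X))
  have h3 := l2_sub_le (A *ᵥ ridge X (supp (bh ω)) l (X *ᵥ β₀ + ε ω)) (A *ᵥ β₀)
  have h4 := hA β₀ hβ₀
  have h5 := mul_le_mul_of_nonneg_left h1 hκ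
  rw [← mulVec_sub] at h3
  unfold refitError errorBound response
  linarith

include hc hn hup hβ₀ hκ hA in
lemma quadLoss_refitError_le (hb : bh ω ∈ sparseVectors p (rspark c X)) (hl : 0 ≤ l) :
    quadLoss A (refitError X β₀ ε bh l ω) ≤ κ ^ 2 * errorBound c c₃ β₀ (ε ω) ^ 2 := by
  rw [← mul_pow]
  exact pow_le_pow_left₀ (l2_nonneg _) (l2_mulVec_refitError_le hc hn hup hβ₀ hκ hA hb hl) 2

include hc hc₃ hn hup hβ₀ hκ hA in
lemma abs_quadLoss_sub_le (hb : bh ω ∈ sparseVectors p (rspark c X)) (hl : 0 ≤ l) (hl' : 0 ≤ l') :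
    |quadLoss A (refitError X β₀ ε bh l ω) - quadLoss A (refitError X β₀ ε bh l' ω)|
      ≤ 2 * κ ^ 2 / (c ^ 2 * n) * |l - l'| * errorBound c c₃ β₀ (ε ω) ^ 2 := by
  have hn' : (0 : ℝ) < n := by exact_mod_cast hn
  set E := errorBound c c₃ β₀ (ε ω) with hE
  have hE0 : 0 ≤ E := errorBound_nonneg hc hc₃ _
  have h1 := l2_mulVec_refitError_le (ε := ε) hc hn hup hβ₀ hκ hA hb hl
  have h2 := l2_mulVec_refitError_le (ε := ε) hc hn hup hβ₀ hκ hA hb hl'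
  set S := supp (bh ω) with hS
  set y := X *ᵥ β₀ + ε ω with hy
  have h3 : l2 (ridge X S l y - ridge X S l' y) ≤ (c ^ 2 * n)⁻¹ * (|l - l'| * E) := by
    have := l2_ridge_sub_le hc hn (card_lt_rspark hb) hl hl' y
    have h4 := l2_ridge_response_le hc hn hup hβ₀ (S := S) hb hl' (ε ω)
    have h5 : l2 (ridge X S l' y) ≤ E := by
      rw [hE, errorBound]
      linarith [l2_nonneg β₀]
    rw [← div_eq_inv_mul, le_div_iff₀ (by positivity)]
    have := mul_le_mul_of_nonneg_left h5 (abs_nonneg (l - l'))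
    linarith
  have hsp : ridge X S l y - ridge X S l' y ∈ sparseVectors p (rspark c X) :=
    two_mul_card_lt_mono (Finset.card_le_card ((supp_sub_subset _ _).trans
      (Finset.union_subset (supp_ridge_subset X S l y) (supp_ridge_subset X S l' y)))) hb
  have h6 := (hA _ hsp).trans (mul_le_mul_of_nonneg_left h3 hκ)
  have e1 : refitError X β₀ ε bh l ω = refitError X β₀ ε bh l' ω
      + (ridge X S l y - ridge X S l' y) := by
    unfold refitError response
    rw [← hy, ← hS]; abel
  have h7 : |l2 (A *ᵥ refitError X β₀ ε bh l ω) - l2 (A *ᵥ refitError X β₀ ε bh l' ω)|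
      ≤ l2 (A *ᵥ (ridge X S l y - ridge X S l' y)) := by
    have h8 : A *ᵥ (ridge X S l y - ridge X S l' y)
        = A *ᵥ refitError X β₀ ε bh l ω - A *ᵥ refitError X β₀ ε bh l' ω := by
      rw [e1, mulVec_add]; abel
    rw [h8]
    have := abs_norm_sub_norm_le (WithLp.toLp 2 (A *ᵥ refitError X β₀ ε bh l ω))
      (WithLp.toLp 2 (A *ᵥ refitError X β₀ ε bh l' ω))
    simpa [l2] using this
  unfold quadLoss
  rw [sq_sub_sq, abs_mul, abs_of_nonneg (add_nonneg (l2_nonneg _) (l2_nonneg _)), mul_comm]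
  calc _ ≤ (κ * ((c ^ 2 * n)⁻¹ * (|l - l'| * E))) * (κ * E + κ * E) :=
        mul_le_mul (h7.trans h6) (add_le_add h1 h2) (add_nonneg (l2_nonneg _) (l2_nonneg _))
          (by positivity)
    _ = _ := by field_simp; ring

variable [MeasurableSpace Ω] {μ : Measure Ω} [IsProbabilityMeasure μ] {bad : Set Ω}
    (hε : HasLaw ε (Measure.pi fun _ : Fin n => gaussianReal 0 (σ ^ 2).toNNReal) μ)
    (hbm : AEMeasurable bh μ) (hb : ∀ᵐ ω ∂μ, bh ω ∈ sparseVectors p (rspark c X))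
    (hbad : ∀ᵐ ω ∂μ, ω ∉ bad → supp (bh ω) = supp β₀)

/-- The part of the quadratic risk that is due to the event on which the support may be missed:
the excess of the actual loss over the loss of the oracle that knows the support. -/
def remainder (μ : Measure Ω) (A : Matrix (Fin m) (Fin p) ℝ) (X : Matrix (Fin n) (Fin p) ℝ)
    (β₀ : Fin p → ℝ) (ε : Ω → Fin n → ℝ) (bh : Ω → Fin p → ℝ) (bad : Set Ω) (l : ℝ) : ℝ :=
  ∫ ω in bad, (quadLoss A (refitError X β₀ ε bh l ω)
    - quadLoss A (refitError X β₀ ε (fun _ => β₀) l ω)) ∂μ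

/-- The scale of the remainder: the mean, over the bad event, of the squares of the two quantities that
bound the estimation error, the signal and the normalized noise. -/
def badMass (μ : Measure Ω) (β₀ : Fin p → ℝ) (ε : Ω → Fin n → ℝ) (bad : Set Ω) : ℝ :=
  ∫ ω in bad, (l2 β₀ ^ 2 + (n : ℝ)⁻¹ * l2 (ε ω) ^ 2) ∂μ

lemma badMass_le
    (hε : HasLaw ε (Measure.pi fun _ : Fin n => gaussianReal 0 (σ ^ 2).toNNReal) μ)
    (hn : 0 < n) {π : ℝ} (hπ : 0 < π) (hP : μ.real bad ≤ π ^ 2) :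
    badMass μ β₀ ε bad ≤ l2 β₀ ^ 2 * π ^ 2 + (fourthMoment σ + 1) / 2 * π := by
  unfold badMass
  rw [integral_add (integrable_const _).integrableOn
    ((integrable_noise_sq hε).const_mul _).integrableOn, setIntegral_const, smul_eq_mul, mul_comm]
  exact add_le_add (mul_le_mul_of_nonneg_left hP (sq_nonneg _)) (setIntegral_noise_le hε hn hπ hP)

include hc hn hup hβ₀ hε hbm hb in
lemma integrable_quadLoss (hl : 0 ≤ l) :
    Integrable (fun ω => quadLoss A (refitError X β₀ ε bh l ω)) μ := by
  obtain ⟨C, hC0, hC⟩ := exists_quadLoss_le A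
  exact integrable_loss hc hn hup hβ₀ hε hbm hb continuous_quadLoss hC0 hC hl

include hc hn hup hβ₀ hε hbm hb hbad in
/-- Splitting of the risk into the oracle risk, for the true support, and the remainder. -/
lemma risk_quadLoss_eq (hl : 0 ≤ l) :
    risk μ (quadLoss A) (refitError X β₀ ε bh l)
      = risk μ (quadLoss A) (refitError X β₀ ε (fun _ => β₀) l)
        + remainder μ A X β₀ ε bh bad l := by
  have h1 := integrable_quadLoss (A := A) hc hn hup hβ₀ hε hbm hb hl
  have h2 := integrable_quadLoss (A := A) hc hn hup hβ₀ hε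
    (aemeasurable_const (b := β₀)) (ae_of_all _ fun _ => hβ₀) hl
  unfold remainder
  rw [setIntegral_eq_integral_of_ae_compl_eq_zero, integral_sub h1 h2]
  · unfold risk; ring
  · filter_upwards [hbad] with ω hω h
    unfold refitError
    rw [hω h, sub_self]

include hc hn hup hβ₀ hκ hA hε hb

lemma abs_remainder_le (hl : 0 ≤ l) :
    |remainder μ A X β₀ ε bh bad l|
      ≤ κ ^ 2 * (2 * ((1 + c₃ / c) ^ 2 + 1 / c ^ 2)) * badMass μ β₀ ε bad := by
  have hint : Integrable (fun ω => l2 β₀ ^ 2 + (n : ℝ)⁻¹ * l2 (ε ω) ^ 2) μ :=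
    (integrable_const _).add ((integrable_noise_sq hε).const_mul _)
  unfold remainder badMass
  rw [← integral_const_mul, ← Real.norm_eq_abs]
  refine norm_integral_le_of_norm_le (hint.const_mul _).integrableOn ?_
  refine ae_restrict_of_ae ?_
  filter_upwards [hb] with ω hω
  have h1 := quadLoss_refitError_le (ε := ε) hc hn hup hβ₀ hκ hA hω hl
  have h2 := quadLoss_refitError_le (ε := ε) (bh := fun _ => β₀) (ω := ω) hc hn hup hβ₀ hκ hA
    hβ₀ hl
  have h3 : 0 ≤ quadLoss A (refitError X β₀ ε bh l ω) := sq_nonneg _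
  have h4 : 0 ≤ quadLoss A (refitError X β₀ ε (fun _ => β₀) l ω) := sq_nonneg _
  have h5 := mul_le_mul_of_nonneg_left (errorBound_sq_le (c₃ := c₃) hc β₀ (ε ω)) (sq_nonneg κ)
  rw [Real.norm_eq_abs, abs_le]
  constructor <;> linarith

include hc₃ hbm in
/-- The Lipschitz constant of the remainder is smaller than its size by a factor of order `n`, since
the ridge estimator varies with `l` on the scale of the eigenvalues of the Gram matrix. -/
lemma abs_remainder_sub_le (hl : 0 ≤ l) (hl' : 0 ≤ l') :
    |remainder μ A X β₀ ε bh bad l - remainder μ A X β₀ ε bh bad l'|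
      ≤ 4 * κ ^ 2 / (c ^ 2 * n) * (2 * ((1 + c₃ / c) ^ 2 + 1 / c ^ 2)) * badMass μ β₀ ε bad
        * |l - l'| := by
  have hint : Integrable (fun ω => l2 β₀ ^ 2 + (n : ℝ)⁻¹ * l2 (ε ω) ^ 2) μ :=
    (integrable_const _).add ((integrable_noise_sq hε).const_mul _)
  have hβc : ∀ t, 0 ≤ t →
      Integrable (fun ω => quadLoss A (refitError X β₀ ε (fun _ => β₀) t ω)) μ := fun t ht =>
    integrable_quadLoss hc hn hup hβ₀ hε aemeasurable_const (ae_of_all _ fun _ => hβ₀) ht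
  have hbc : ∀ t, 0 ≤ t → Integrable (fun ω => quadLoss A (refitError X β₀ ε bh t ω)) μ :=
    fun t ht => integrable_quadLoss hc hn hup hβ₀ hε hbm hb ht
  have hdiff : ∀ t, 0 ≤ t → IntegrableOn (fun ω => quadLoss A (refitError X β₀ ε bh t ω)
      - quadLoss A (refitError X β₀ ε (fun _ => β₀) t ω)) bad μ :=
    fun t ht => ((hbc t ht).sub (hβc t ht)).integrableOn
  unfold remainder badMass
  rw [← integral_sub (hdiff l hl) (hdiff l' hl'), mul_right_comm, ← integral_const_mul,
    ← Real.norm_eq_abs]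
  refine norm_integral_le_of_norm_le (hint.const_mul _).integrableOn ?_
  refine ae_restrict_of_ae ?_
  filter_upwards [hb] with ω hω
  have h1 := abs_quadLoss_sub_le (ε := ε) hc hc₃ hn hup hβ₀ hκ hA hω hl hl'
  have h2 := abs_quadLoss_sub_le (ε := ε) (bh := fun _ => β₀) (ω := ω) hc hc₃ hn hup hβ₀ hκ hA
    hβ₀ hl hl'
  have h5 := mul_le_mul_of_nonneg_left (errorBound_sq_le (c₃ := c₃) hc β₀ (ε ω))
    (by positivity : 0 ≤ 4 * κ ^ 2 / (c ^ 2 * n) * |l - l'|)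
  have h6 : 4 * κ ^ 2 / (c ^ 2 * n) * |l - l'| * errorBound c c₃ β₀ (ε ω) ^ 2
      = 2 * (2 * κ ^ 2 / (c ^ 2 * n) * |l - l'| * errorBound c c₃ β₀ (ε ω) ^ 2) := by ring
  rw [h6] at h5
  rw [Real.norm_eq_abs]
  rw [abs_le] at h1 h2 ⊢
  constructor <;> linarith

end Quadratic

section Oracle

variable {n p : ℕ} {c l σ : ℝ} {X : Matrix (Fin n) (Fin p) ℝ} {β₀ : Fin p → ℝ}
  {Ω : Type*} [MeasurableSpace Ω] {μ : Measure Ω} {ε : Ω → Fin n → ℝ}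

/-- The exact risk of ridge regression on the true support, for a loss that is diagonal in the
eigenbasis of the Gram matrix. -/
lemma risk_oracle (hc : 0 < c) (hn : 0 < n) (hβ₀ : β₀ ∈ sparseVectors p (rspark c X)) (hl : 0 ≤ l)
    (hε : HasLaw ε (Measure.pi fun _ : Fin n => gaussianReal 0 (σ ^ 2).toNNReal) μ)
    {P : Matrix (supp β₀) (supp β₀) ℝ} {d w : supp β₀ → ℝ}
    (hP : IsEigendecomposition (gram X (supp β₀)) P d) (hd : ∀ j, 0 < d j)
    {loss : (Fin p → ℝ) → ℝ}
    (hloss : ∀ v, supp v ⊆ supp β₀ → loss v = ∑ j, w j * (P *ᵥ fun i : supp β₀ => v i) j ^ 2) :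
    risk μ loss (refitError X β₀ ε (fun _ => β₀) l)
      = ∑ j, w j * ((l ^ 2 * rotated β₀ P j ^ 2 + d j * σ ^ 2) / (d j + l) ^ 2) := by
  have := hε.isProbabilityMeasure
  set u : supp β₀ → Fin n → ℝ := fun j => cols X (supp β₀) *ᵥ P j with hu
  have hz : ∀ e : Fin n → ℝ, ∀ j, (P *ᵥ ((cols X (supp β₀))ᵀ *ᵥ e)) j = e ⬝ᵥ u j := by
    intro e j
    rw [hu]
    change P j ⬝ᵥ ((cols X (supp β₀))ᵀ *ᵥ e) = _
    rw [dotProduct_mulVec, vecMul_transpose, dotProduct_comm]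
  have huu : ∀ j, u j ⬝ᵥ u j = d j := by
    intro j
    rw [hu]
    simp only
    rw [mulVec_dotProduct_mulVec]
    have h1 : P * gram X (supp β₀) * Pᵀ = diagonal d := by
      rw [hP.mul_eq, Matrix.mul_assoc, hP.mul_transpose, Matrix.mul_one]
    have h2 := congrFun (congrFun h1 j) j
    rw [diagonal_apply_eq, Matrix.mul_assoc] at h2
    rw [← h2]
    rfl
  have hpt : ∀ ω, loss (refitError X β₀ ε (fun _ => β₀) l ω)
      = ∑ j, w j / (d j + l) ^ 2 * ((ε ω ⬝ᵥ u j) ^ 2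
        - 2 * l * rotated β₀ P j * (ε ω ⬝ᵥ u j) + l ^ 2 * rotated β₀ P j ^ 2) := by
    intro ω
    have hsub : supp (refitError X β₀ ε (fun _ => β₀) l ω) ⊆ supp β₀ :=
      (supp_sub_subset _ _).trans
        (Finset.union_subset (supp_ridge_subset _ _ _ _) (Finset.Subset.refl _))
    rw [hloss _ hsub]
    refine Finset.sum_congr rfl fun j _ => ?_
    have h1 := rotated_ridge_error hc hn (card_lt_rspark hβ₀) (Finset.Subset.refl _) hl hP (ε ω) j
    have hdl : d j + l ≠ 0 := (add_pos_of_pos_of_nonneg (hd j) hl).ne'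
    rw [hz] at h1
    have h2 : (P *ᵥ fun i : supp β₀ => refitError X β₀ ε (fun _ => β₀) l ω i) j
        = (ε ω ⬝ᵥ u j - l * rotated β₀ P j) / (d j + l) := by
      rw [eq_div_iff hdl, mul_comm]
      exact h1
    rw [h2]
    field_simp
    ring
  unfold risk
  simp only [hpt]
  have hi1 : ∀ j, Integrable (fun ω => (ε ω ⬝ᵥ u j) ^ 2) μ := fun j =>
    (memLp_noise_dotProduct hε (u j)).integrable_sq
  have hi2 : ∀ j, Integrable (fun ω => ε ω ⬝ᵥ u j) μ := fun j =>
    (memLp_noise_dotProduct hε (u j)).integrable (by simp)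
  have hi3 : ∀ j, Integrable (fun ω => (ε ω ⬝ᵥ u j) ^ 2
        - 2 * l * rotated β₀ P j * (ε ω ⬝ᵥ u j)) μ := fun j =>
    (hi1 j).sub ((hi2 j).const_mul _)
  have hi4 : ∀ j, Integrable (fun ω => (ε ω ⬝ᵥ u j) ^ 2
        - 2 * l * rotated β₀ P j * (ε ω ⬝ᵥ u j) + l ^ 2 * rotated β₀ P j ^ 2) μ := fun j =>
    (hi3 j).add (integrable_const _)
  rw [integral_finsetSum _ fun j _ => (hi4 j).const_mul _]
  refine Finset.sum_congr rfl fun j _ => ?_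
  rw [integral_const_mul, integral_add (hi3 j) (integrable_const _),
    integral_sub (hi1 j) ((hi2 j).const_mul _), integral_const_mul,
    integral_noise_dotProduct hε, integral_noise_dotProduct_sq hε, huu, integral_const]
  simp only [probReal_univ, smul_eq_mul]
  ring

lemma sqLoss_eq_sum_rotated {P : Matrix (supp β₀) (supp β₀) ℝ} {d : supp β₀ → ℝ}
    (hP : IsEigendecomposition (gram X (supp β₀)) P d) {v : Fin p → ℝ} (hv : supp v ⊆ supp β₀) :
    sqLoss v = ∑ j, 1 * (P *ᵥ fun i : supp β₀ => v i) j ^ 2 := by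
  simp only [one_mul]
  rw [← hP.dotProduct_self, ← dotProduct_extend, extend_restrict hv, sqLoss, l2_sq]

lemma predLoss_eq_sum_rotated {P : Matrix (supp β₀) (supp β₀) ℝ} {d : supp β₀ → ℝ}
    (hP : IsEigendecomposition (gram X (supp β₀)) P d) {v : Fin p → ℝ} (hv : supp v ⊆ supp β₀) :
    predLoss X v = ∑ j, (n : ℝ)⁻¹ * d j * (P *ᵥ fun i : supp β₀ => v i) j ^ 2 := by
  simp only [mul_assoc]
  rw [← Finset.mul_sum, ← hP.dotProduct_mulVec_self, gram, ← mulVec_dotProduct_mulVec,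
    ← mulVec_extend, extend_restrict hv, predLoss, l2_sq]

lemma sum_rotated_sq {P : Matrix (supp β₀) (supp β₀) ℝ} {d : supp β₀ → ℝ}
    (hP : IsEigendecomposition (gram X (supp β₀)) P d) :
    ∑ j, rotated β₀ P j ^ 2 = l2 β₀ ^ 2 := by
  have := sqLoss_eq_sum_rotated hP (Finset.Subset.refl (supp β₀))
  simp only [one_mul] at this
  exact this.symm

end Oracle

/-! ### Location of the minimizer of a perturbed ridge risk -/

section Location

variable {ι : Type*} [Fintype ι] {d w b : ι → ℝ} {σ l : ℝ}

/-- The ridge risk on the true support, as a function of the ridge parameter: `d` are the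
eigenvalues, `b` the rotated signal and `w` the weights of the loss. -/
def leadRisk (d w b : ι → ℝ) (σ l : ℝ) : ℝ :=
  ∑ j, w j * ((l ^ 2 * b j ^ 2 + d j * σ ^ 2) / (d j + l) ^ 2)

/-- The minimizer of `leadRisk` to first order in `l / d`. -/
def leadOpt (d w b : ι → ℝ) (σ : ℝ) : ℝ :=
  σ ^ 2 * (∑ j, w j / d j ^ 2) / ∑ j, w j * b j ^ 2 / d j ^ 2

lemma hasDerivAt_leadRisk (hd : ∀ j, 0 < d j) (hl : 0 ≤ l) :
    HasDerivAt (leadRisk d w b σ)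
      (2 * (l * (∑ j, w j * b j ^ 2 * (d j / (d j + l) ^ 3))
        - σ ^ 2 * ∑ j, w j * (d j / (d j + l) ^ 3))) l := by
  have h : HasDerivAt (leadRisk d w b σ)
      (∑ j, w j * (2 * d j * (l * b j ^ 2 - σ ^ 2) / (d j + l) ^ 3)) l := by
    unfold leadRisk
    refine HasDerivAt.fun_sum fun j _ => HasDerivAt.const_mul _ ?_
    have hdl : d j + l ≠ 0 := (add_pos_of_pos_of_nonneg (hd j) hl).ne'
    have h1 : HasDerivAt (fun t : ℝ => t ^ 2 * b j ^ 2 + d j * σ ^ 2) (2 * l * b j ^ 2) l := by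
      simpa using ((hasDerivAt_pow 2 l).mul_const (b j ^ 2)).add_const (d j * σ ^ 2)
    have h2 : HasDerivAt (fun t : ℝ => (d j + t) ^ 2) (2 * (d j + l)) l := by
      simpa using ((hasDerivAt_id l).const_add (d j)).fun_pow 2
    convert h1.fun_div h2 (pow_ne_zero 2 hdl) using 1
    field_simp
    ring
  convert h using 1
  rw [Finset.mul_sum, Finset.mul_sum, ← Finset.sum_sub_distrib, Finset.mul_sum]
  refine Finset.sum_congr rfl fun j _ => ?_
  ring

/-- One-sided difference quotients from the right; the case `l = 0` is included. -/
lemma neg_le_deriv_of_perturbed_min {f : ℝ → ℝ} {f' ρ : ℝ} (hf : HasDerivAt f f' l) (hl : 0 ≤ l)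
    (hmin : ∀ t, 0 ≤ t → f l ≤ f t + ρ * |l - t|) : -ρ ≤ f' := by
  have h := (hasDerivAt_iff_tendsto_slope.1 hf).mono_left
    (nhdsWithin_mono l (show Set.Ioi l ⊆ {l}ᶜ from fun x hx => ne_of_gt hx))
  refine ge_of_tendsto h ?_
  filter_upwards [self_mem_nhdsWithin] with t ht
  have ht' : 0 < t - l := sub_pos.2 ht
  have h1 := hmin t (hl.trans (le_of_lt ht))
  rw [abs_sub_comm, abs_of_pos ht'] at h1
  rw [slope_def_field, le_div_iff₀ ht']
  linarith

lemma deriv_le_of_perturbed_min {f : ℝ → ℝ} {f' ρ : ℝ} (hf : HasDerivAt f f' l) (hl : 0 < l)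
    (hmin : ∀ t, 0 ≤ t → f l ≤ f t + ρ * |l - t|) : f' ≤ ρ := by
  have h := (hasDerivAt_iff_tendsto_slope.1 hf).mono_left
    (nhdsWithin_mono l (show Set.Iio l ⊆ {l}ᶜ from fun x hx => ne_of_lt hx))
  refine le_of_tendsto h ?_
  filter_upwards [self_mem_nhdsWithin, nhdsWithin_le_nhds (lt_mem_nhds hl)] with t ht ht0
  have ht' : 0 < l - t := sub_pos.2 ht
  have h1 := hmin t ht0.le
  rw [abs_of_pos ht'] at h1
  rw [slope_def_field, ← neg_div_neg_eq, neg_sub, neg_sub, div_le_iff₀ ht']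
  linarith

/-- The factor `x / (x + l) ^ 3` in the derivative of the leading risk is `1 / x ^ 2` up to a relative
error of order `l / x`. -/
lemma shrinkage_defect_bounds {x : ℝ} (hx : 0 < x) (hl : 0 ≤ l) :
    0 ≤ 1 / x ^ 2 - x / (x + l) ^ 3 ∧ 1 / x ^ 2 - x / (x + l) ^ 3 ≤ 3 * l / x ^ 3 := by
  have hxl : 0 < x + l := by linarith
  have e : 1 / x ^ 2 - x / (x + l) ^ 3 = (3 * x ^ 2 * l + 3 * x * l ^ 2 + l ^ 3)
      / (x ^ 2 * (x + l) ^ 3) := by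
    field_simp
    ring
  rw [e]
  constructor
  · positivity
  · rw [div_le_div_iff₀ (by positivity) (by positivity)]
    have : 0 ≤ 3 * l * (x ^ 2 * (x + l) ^ 3)
        - (3 * x ^ 2 * l + 3 * x * l ^ 2 + l ^ 3) * x ^ 3 := by
      have e2 : 3 * l * (x ^ 2 * (x + l) ^ 3)
          - (3 * x ^ 2 * l + 3 * x * l ^ 2 + l ^ 3) * x ^ 3
          = 6 * x ^ 4 * l ^ 2 + 8 * x ^ 3 * l ^ 3 + 3 * x ^ 2 * l ^ 4 := by ring
      rw [e2]; positivity
    linarith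

variable {N B α γ w₀ w₁ : ℝ} (hN : 0 < N) (hα : 0 < α) (hdl : ∀ j, α * N ≤ d j)
    (hdu : ∀ j, d j ≤ γ * N) (hw₀ : 0 < w₀) (hwl : ∀ j, w₀ ≤ w j) (hw₁ : 0 < w₁) (hwu : ∀ j, w j ≤ w₁)
    (hB : ∑ j, b j ^ 2 = B ^ 2)

include hN hα hdl hdu hw₀ hwl hB in
/-- Lower bound for the denominator of `leadOpt`. -/
lemma le_sum_signal : w₀ * B ^ 2 / (γ * N) ^ 2 ≤ ∑ j, w j * b j ^ 2 / d j ^ 2 := by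
  rw [← hB, Finset.mul_sum, Finset.sum_div]
  refine Finset.sum_le_sum fun j _ => ?_
  have hd := (mul_pos hα hN).trans_le (hdl j)
  have := hdu j
  have := hwl j
  have := hw₀.trans_le (hwl j)
  gcongr

include hN hα hdl hw₀ hwl hw₁ hwu in
/-- Upper bound for the numerator of `leadOpt`. -/
lemma sum_weights_le : ∑ j, w j / d j ^ 2 ≤ w₁ * Fintype.card ι / (α * N) ^ 2 := by
  have : w₁ * Fintype.card ι / (α * N) ^ 2 = ∑ _j : ι, w₁ / (α * N) ^ 2 := by
    rw [Finset.sum_const, Finset.card_univ, nsmul_eq_mul]; ring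
  rw [this]
  refine Finset.sum_le_sum fun j _ => ?_
  have hd := (mul_pos hα hN).trans_le (hdl j)
  have h1 := hdl j
  have h2 := hwu j
  have h3 := hw₀.trans_le (hwl j)
  have h4 := mul_pos hα hN
  gcongr

include hN hα hdl hdu hw₀ hwl hw₁ hwu hB in
lemma leadOpt_le (hB0 : 0 < B) (hγ : 0 < γ) :
    leadOpt d w b σ ≤ σ ^ 2 * w₁ * γ ^ 2 / (α ^ 2 * w₀) * (Fintype.card ι / B ^ 2) := by
  have h1 := le_sum_signal hN hα hdl hdu hw₀ hwl hB
  have h2 := sum_weights_le hN hα hdl hw₀ hwl hw₁ hwu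
  have hpos : 0 < w₀ * B ^ 2 / (γ * N) ^ 2 := by positivity
  unfold leadOpt
  have h3 : 0 ≤ w₁ * Fintype.card ι / (α * N) ^ 2 := by positivity
  calc _ ≤ σ ^ 2 * (w₁ * Fintype.card ι / (α * N) ^ 2) / (w₀ * B ^ 2 / (γ * N) ^ 2) := by
        gcongr
    _ = _ := by field_simp

include hN hα hdl hdu hw₀ hwl hw₁ hwu hB in
/-- If `l` minimizes a function that differs from `leadRisk` by a perturbation with small Lipschitz
constant `ρ`, then `l` is close to the first-order minimizer of `leadRisk`. -/
lemma abs_sub_leadOpt_le {ρ C₁ β : ℝ} (hγ : 0 < γ) (hβ : 0 < β) (hβB : β ≤ B)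
    (hsN : (Fintype.card ι : ℝ) ≤ N) (hC₁ : 0 ≤ C₁)
    (hρ : ρ ≤ C₁ * ((Fintype.card ι : ℝ) ^ 2 / (N ^ 3 * B ^ 2)))
    (hl : 0 ≤ l) (hlN : l ≤ N)
    (hmin : ∀ t, 0 ≤ t → leadRisk d w b σ l ≤ leadRisk d w b σ t + ρ * |l - t|) {C₂ : ℝ}
    (hC₂ : C₂ = (C₁ / β ^ 2 + σ ^ 2 * w₁ / α ^ 2) * ((γ + 1) ^ 3 / (w₀ * α))) :
    |l - leadOpt d w b σ| ≤ (C₁ + 3 * C₂ * w₁ * (C₂ + σ ^ 2) / α ^ 3) * (γ ^ 2 / w₀)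
      * ((Fintype.card ι : ℝ) ^ 2 / (N * B ^ 4)) := by
  have hB0 : 0 < B := hβ.trans_le hβB
  have hd : ∀ j, 0 < d j := fun j => (mul_pos hα hN).trans_le (hdl j)
  have hw : ∀ j, 0 < w j := fun j => hw₀.trans_le (hwl j)
  have hderiv := hasDerivAt_leadRisk (w := w) (b := b) (σ := σ) hd hl
  set s : ℝ := (Fintype.card ι : ℝ) with hs
  have hs0 : 0 ≤ s := Nat.cast_nonneg _
  set S₁ := ∑ j, w j * b j ^ 2 * (d j / (d j + l) ^ 3) with hS₁
  set S₂ := ∑ j, w j * (d j / (d j + l) ^ 3) with hS₂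
  set A := ∑ j, w j * b j ^ 2 / d j ^ 2 with hA
  set D := ∑ j, w j / d j ^ 2 with hD
  have hρ0 : 0 ≤ ρ := by
    have := hmin (l + 1) (by linarith)
    have h1 := neg_le_deriv_of_perturbed_min hderiv hl hmin
    by_contra! hneg
    rcases hl.eq_or_lt with h0 | h0
    · have h2 : 0 ≤ S₂ := Finset.sum_nonneg fun j _ =>
        mul_nonneg (hw j).le (div_nonneg (hd j).le (pow_nonneg (add_nonneg (hd j).le hl) 3))
      rw [← h0] at h1
      nlinarith [mul_nonneg (sq_nonneg σ) h2]
    · linarith [deriv_le_of_perturbed_min hderiv h0 hmin]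
  have hS₂0 : 0 ≤ S₂ := Finset.sum_nonneg fun j _ =>
    mul_nonneg (hw j).le (div_nonneg (hd j).le (pow_nonneg (add_nonneg (hd j).le hl) 3))
  have hF1 : -ρ ≤ l * S₁ - σ ^ 2 * S₂ := by
    have := neg_le_deriv_of_perturbed_min hderiv hl hmin
    linarith
  -- At the boundary `l = 0` the derivative is automatically nonpositive.
  have hF2 : l * S₁ - σ ^ 2 * S₂ ≤ ρ := by
    rcases hl.eq_or_lt with h0 | h0
    · rw [← h0]
      nlinarith [mul_nonneg (sq_nonneg σ) hS₂0]
    · have := deriv_le_of_perturbed_min hderiv h0 hmin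
      linarith
  have hAS : 0 ≤ A - S₁ ∧ A - S₁ ≤ 3 * l * w₁ * B ^ 2 / (α * N) ^ 3 := by
    have e : A - S₁ = ∑ j, w j * b j ^ 2 * (1 / d j ^ 2 - d j / (d j + l) ^ 3) := by
      rw [hA, hS₁, ← Finset.sum_sub_distrib]
      exact Finset.sum_congr rfl fun j _ => by ring
    rw [e]
    refine ⟨Finset.sum_nonneg fun j _ => mul_nonneg (mul_nonneg (hw j).le (sq_nonneg _))
      (shrinkage_defect_bounds (hd j) hl).1, ?_⟩
    rw [← hB, Finset.mul_sum, Finset.sum_div]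
    refine Finset.sum_le_sum fun j _ => ?_
    have h1 := (shrinkage_defect_bounds (hd j) hl).2
    have h2 := hdl j
    have h3 := hw j
    have h4 := hwu j
    have h5 := mul_pos hα hN
    have h6 := hd j
    calc w j * b j ^ 2 * (1 / d j ^ 2 - d j / (d j + l) ^ 3)
        ≤ w j * b j ^ 2 * (3 * l / d j ^ 3) := by gcongr
      _ ≤ w₁ * b j ^ 2 * (3 * l / (α * N) ^ 3) := by gcongr
      _ = _ := by ring
  have hDS : 0 ≤ D - S₂ ∧ D - S₂ ≤ 3 * l * w₁ * s / (α * N) ^ 3 := by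
    have e : D - S₂ = ∑ j, w j * (1 / d j ^ 2 - d j / (d j + l) ^ 3) := by
      rw [hD, hS₂, ← Finset.sum_sub_distrib]
      exact Finset.sum_congr rfl fun j _ => by ring
    rw [e]
    refine ⟨Finset.sum_nonneg fun j _ => mul_nonneg (hw j).le
      (shrinkage_defect_bounds (hd j) hl).1, ?_⟩
    have e2 : 3 * l * w₁ * s / (α * N) ^ 3 = ∑ _j : ι, w₁ * (3 * l / (α * N) ^ 3) := by
      rw [Finset.sum_const, Finset.card_univ, nsmul_eq_mul, hs]; ring
    rw [e2]
    refine Finset.sum_le_sum fun j _ => ?_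
    have h1 := (shrinkage_defect_bounds (hd j) hl).2
    have h2 := hdl j
    have h3 := hw j
    have h4 := hwu j
    have h5 := mul_pos hα hN
    have h6 := hd j
    calc w j * (1 / d j ^ 2 - d j / (d j + l) ^ 3)
        ≤ w j * (3 * l / d j ^ 3) := by gcongr
      _ ≤ w₁ * (3 * l / (α * N) ^ 3) := by gcongr
  have hS₁l : w₀ * α * B ^ 2 / ((γ + 1) ^ 3 * N ^ 2) ≤ S₁ := by
    rw [hS₁, ← hB, Finset.mul_sum, Finset.sum_div]
    refine Finset.sum_le_sum fun j _ => ?_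
    have h1 : d j + l ≤ (γ + 1) * N := by linarith [hdu j]
    have h2 := hdl j
    have h3 := hwl j
    have h4 := hd j
    have h5 : 0 < d j + l := by linarith
    have h6 := hw j
    calc w₀ * α * b j ^ 2 / ((γ + 1) ^ 3 * N ^ 2)
        = w₀ * b j ^ 2 * (α * N / ((γ + 1) * N) ^ 3) := by field_simp
      _ ≤ _ := by gcongr
  have hD' := sum_weights_le hN hα hdl hw₀ hwl hw₁ hwu
  rw [← hD, ← hs] at hD'
  have hρ' : ρ ≤ C₁ / β ^ 2 * (s / N ^ 2) := by
    refine hρ.trans ?_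
    calc C₁ * (s ^ 2 / (N ^ 3 * B ^ 2)) = C₁ * (s / N) * (s / N ^ 2) / B ^ 2 := by field_simp
      _ ≤ C₁ * 1 * (s / N ^ 2) / β ^ 2 := by
        have : s / N ≤ 1 := (div_le_one hN).2 hsN
        gcongr
      _ = _ := by ring
  -- A crude bound for `l` of the right order.
  have hlC : l ≤ C₂ * (s / B ^ 2) := by
    have h1 : l * (w₀ * α * B ^ 2 / ((γ + 1) ^ 3 * N ^ 2))
        ≤ (C₁ / β ^ 2 + σ ^ 2 * w₁ / α ^ 2) * (s / N ^ 2) := by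
      calc l * (w₀ * α * B ^ 2 / ((γ + 1) ^ 3 * N ^ 2)) ≤ l * S₁ := by gcongr
        _ ≤ ρ + σ ^ 2 * S₂ := by linarith
        _ ≤ C₁ / β ^ 2 * (s / N ^ 2) + σ ^ 2 * (w₁ * s / (α * N) ^ 2) := by
          have : S₂ ≤ w₁ * s / (α * N) ^ 2 := by linarith [hDS.1]
          gcongr
        _ = _ := by field_simp
    have h2 : l = l * (w₀ * α * B ^ 2 / ((γ + 1) ^ 3 * N ^ 2))
        * ((γ + 1) ^ 3 * N ^ 2 / (w₀ * α * B ^ 2)) := by field_simp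
    rw [h2, hC₂]
    calc _ ≤ (C₁ / β ^ 2 + σ ^ 2 * w₁ / α ^ 2) * (s / N ^ 2)
          * ((γ + 1) ^ 3 * N ^ 2 / (w₀ * α * B ^ 2)) := by gcongr
      _ = _ := by field_simp
  have hAl := le_sum_signal hN hα hdl hdu hw₀ hwl hB
  rw [← hA] at hAl
  have hA0 : 0 < A := lt_of_lt_of_le (by positivity) hAl
  have hdiff : |l * A - σ ^ 2 * D| ≤ (C₁ + 3 * C₂ * w₁ * (C₂ + σ ^ 2) / α ^ 3)
      * (s ^ 2 / (N ^ 3 * B ^ 2)) := by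
    have h1 : 0 ≤ l * (A - S₁) := mul_nonneg hl hAS.1
    have h2 : 0 ≤ σ ^ 2 * (D - S₂) := mul_nonneg (sq_nonneg _) hDS.1
    have h3 : l * (A - S₁) ≤ l * (3 * l * w₁ * B ^ 2 / (α * N) ^ 3) :=
      mul_le_mul_of_nonneg_left hAS.2 hl
    have h4 : σ ^ 2 * (D - S₂) ≤ σ ^ 2 * (3 * l * w₁ * s / (α * N) ^ 3) :=
      mul_le_mul_of_nonneg_left hDS.2 (sq_nonneg _)
    have hlB : l * B ^ 2 ≤ C₂ * s := by
      have := mul_le_mul_of_nonneg_right hlC (sq_nonneg B)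
      rwa [mul_assoc, div_mul_cancel₀ _ (by positivity)] at this
    have h5 : l * (3 * l * w₁ * B ^ 2 / (α * N) ^ 3) + σ ^ 2 * (3 * l * w₁ * s / (α * N) ^ 3)
        ≤ 3 * C₂ * w₁ * (C₂ + σ ^ 2) / α ^ 3 * (s ^ 2 / (N ^ 3 * B ^ 2)) := by
      have h6 : l * (l * B ^ 2 + σ ^ 2 * s) ≤ C₂ * (s / B ^ 2) * (C₂ * s + σ ^ 2 * s) := by
        gcongr
        exact hl.trans hlC
      calc _ = 3 * w₁ / (α * N) ^ 3 * (l * (l * B ^ 2 + σ ^ 2 * s)) := by ring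
        _ ≤ 3 * w₁ / (α * N) ^ 3 * (C₂ * (s / B ^ 2) * (C₂ * s + σ ^ 2 * s)) := by gcongr
        _ = _ := by field_simp
    have hsplit : l * A - σ ^ 2 * D
        = (l * S₁ - σ ^ 2 * S₂) + (l * (A - S₁) - σ ^ 2 * (D - S₂)) := by ring
    rw [hsplit, add_mul, abs_le]
    constructor <;> linarith
  have hLeq : l - leadOpt d w b σ = (l * A - σ ^ 2 * D) / A := by
    unfold leadOpt
    rw [← hA, ← hD]
    field_simp
  rw [hLeq, abs_div, abs_of_pos hA0]
  have hK0 : 0 ≤ (C₁ + 3 * C₂ * w₁ * (C₂ + σ ^ 2) / α ^ 3) * (s ^ 2 / (N ^ 3 * B ^ 2)) :=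
    (abs_nonneg _).trans hdiff
  calc _ ≤ (C₁ + 3 * C₂ * w₁ * (C₂ + σ ^ 2) / α ^ 3) * (s ^ 2 / (N ^ 3 * B ^ 2))
        / (w₀ * B ^ 2 / (γ * N) ^ 2) := by gcongr
    _ = _ := by field_simp

end Location

/-! ### Consequences of the conditions on one regression problem -/

section Problem

variable {n p : ℕ} {Ω : Type*} [MeasurableSpace Ω] {σ c c₂ c₃ b lam : ℝ} {pen : ℝ → ℝ → ℝ}
  {μ : Measure Ω} {X : Matrix (Fin n) (Fin p) ℝ} {β₀ : Fin p → ℝ} {ε : Ω → Fin n → ℝ}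
  {βhat : Ω → Fin p → ℝ}

/-- The event that the noise is noticeably correlated with some covariate. -/
def badEvent (c₂ : ℝ) (X : Matrix (Fin n) (Fin p) ℝ) (ε : Ω → Fin n → ℝ) : Set Ω :=
  {ω | ∃ j, n * (c₂ * √(Real.log (ptilde n p) / n)) < |ε ω ⬝ᵥ fun i => X i j|}

/-- The square root of the bound for the probability of `badEvent`. -/
def badRate (σ c₂ : ℝ) (n p : ℕ) : ℝ := √2 * ptilde n p ^ (1 / 2 - c₂ ^ 2 / (4 * σ ^ 2))

lemma le_ptilde (n p : ℕ) : (n : ℝ) ≤ ptilde n p := le_max_left _ _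

lemma ptilde_pos (hn : 0 < n) (p : ℕ) : 0 < ptilde n p :=
  lt_of_lt_of_le (by exact_mod_cast hn) (le_ptilde n p)

lemma one_le_ptilde (hn : 0 < n) (p : ℕ) : 1 ≤ ptilde n p :=
  le_trans (by exact_mod_cast hn) (le_ptilde n p)

lemma badRate_pos (hn : 0 < n) : 0 < badRate σ c₂ n p :=
  mul_pos (by positivity) (Real.rpow_pos_of_pos (ptilde_pos hn p) _)

lemma c₂_sq_ge (hσ : 0 < σ) (hc₂ : √10 * σ ≤ c₂) : 10 * σ ^ 2 ≤ c₂ ^ 2 := by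
  have h := pow_le_pow_left₀ (by positivity) hc₂ 2
  rwa [mul_pow, Real.sq_sqrt (by norm_num)] at h

lemma badRate_le (hσ : 0 < σ) (hc₂ : √10 * σ ≤ c₂) (hn : 0 < n) :
    badRate σ c₂ n p ≤ √2 / ptilde n p ^ 2 := by
  have hp := ptilde_pos hn p
  have h1 : (1 / 2 - c₂ ^ 2 / (4 * σ ^ 2) : ℝ) ≤ -2 := by
    have := c₂_sq_ge hσ hc₂
    have h2 : 5 / 2 ≤ c₂ ^ 2 / (4 * σ ^ 2) := by
      rw [le_div_iff₀ (by positivity)]; linarith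
    linarith
  have h2 := Real.rpow_le_rpow_of_exponent_le (one_le_ptilde hn p) h1
  have h3 : ptilde n p ^ (-2 : ℝ) = (ptilde n p ^ 2)⁻¹ := by
    rw [Real.rpow_neg hp.le]; norm_cast
  rw [h3] at h2
  rw [badRate, div_eq_mul_inv]
  exact mul_le_mul_of_nonneg_left h2 (Real.sqrt_nonneg _)

lemma measure_badEvent_le
    (hε : HasLaw ε (Measure.pi fun _ : Fin n => gaussianReal 0 (σ ^ 2).toNNReal) μ)
    (hσ : 0 < σ) (hc₂ : 0 < c₂) (hn : 0 < n) (hcol : ∀ j, l2 (fun i => X i j) = √(n : ℝ)) :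
    μ.real (badEvent c₂ X ε) ≤ badRate σ c₂ n p ^ 2 := by
  have := hε.isProbabilityMeasure
  have hn' : (0 : ℝ) < n := by exact_mod_cast hn
  have hp := ptilde_pos hn p
  have hlog : 0 ≤ Real.log (ptilde n p) := Real.log_nonneg (one_le_ptilde hn p)
  set t := n * (c₂ * √(Real.log (ptilde n p) / n)) with ht
  have hone : ∀ j, μ.real {ω | t < |ε ω ⬝ᵥ fun i => X i j|}
      ≤ 2 * ptilde n p ^ (-(c₂ ^ 2 / (2 * σ ^ 2))) := by
    intro j
    have h1 : (fun i => X i j) ⬝ᵥ (fun i => X i j) = n := by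
      rw [← l2_sq, hcol, Real.sq_sqrt hn'.le]
    refine (measure_noise_dotProduct_gt_le hε h1 (by positivity)).trans (le_of_eq ?_)
    rw [Real.rpow_def_of_pos hp]
    congr 2
    rw [ht, mul_pow, mul_pow, Real.sq_sqrt (by positivity)]
    field_simp
  have hunion : badEvent c₂ X ε = ⋃ j : Fin p, {ω | t < |ε ω ⬝ᵥ fun i => X i j|} := by
    ext ω; simp [badEvent, ht]
  calc μ.real (badEvent c₂ X ε) ≤ ∑ j : Fin p, μ.real {ω | t < |ε ω ⬝ᵥ fun i => X i j|} := by
        rw [hunion]; exact measureReal_iUnion_fintype_le _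
    _ ≤ ∑ _j : Fin p, 2 * ptilde n p ^ (-(c₂ ^ 2 / (2 * σ ^ 2))) :=
        Finset.sum_le_sum fun j _ => hone j
    _ = p * (2 * ptilde n p ^ (-(c₂ ^ 2 / (2 * σ ^ 2)))) := by
        rw [Finset.sum_const, Finset.card_univ, Fintype.card_fin, nsmul_eq_mul]
    _ ≤ ptilde n p * (2 * ptilde n p ^ (-(c₂ ^ 2 / (2 * σ ^ 2)))) := by
        have : (p : ℝ) ≤ ptilde n p := le_max_right _ _
        gcongr
    _ = badRate σ c₂ n p ^ 2 := by
        rw [badRate, mul_pow, Real.sq_sqrt (by norm_num),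
          ← Real.rpow_natCast (ptilde n p ^ (1 / 2 - c₂ ^ 2 / (4 * σ ^ 2))), ← Real.rpow_mul hp.le]
        have : ptilde n p * (2 * ptilde n p ^ (-(c₂ ^ 2 / (2 * σ ^ 2))))
            = 2 * (ptilde n p ^ (1 : ℝ) * ptilde n p ^ (-(c₂ ^ 2 / (2 * σ ^ 2)))) := by
          rw [Real.rpow_one]; ring
        rw [this, ← Real.rpow_add hp]
        congr 2
        push_cast
        field_simp
        ring

/-- On the event of misselection the mean squared noise contributes `O(1 / n²)`. -/
lemma setIntegral_badEvent_le
    (hε : HasLaw ε (Measure.pi fun _ : Fin n => gaussianReal 0 (σ ^ 2).toNNReal) μ)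
    (hσ : 0 < σ) (hc₂ : √10 * σ ≤ c₂) (hn : 0 < n)
    (hcol : ∀ j, l2 (fun i => X i j) = √(n : ℝ)) :
    ∫ ω in badEvent c₂ X ε, (n : ℝ)⁻¹ * l2 (ε ω) ^ 2 ∂μ
      ≤ (fourthMoment σ + 1) / 2 * √2 / n ^ 2 := by
  have hn' : (0 : ℝ) < n := by exact_mod_cast hn
  have hc₂' : 0 < c₂ := lt_of_lt_of_le (by positivity) hc₂
  have hm := fourthMoment_nonneg σ
  have h1 := setIntegral_noise_le hε hn (badRate_pos hn) (measure_badEvent_le hε hσ hc₂' hn hcol)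
  have h2 := badRate_le (p := p) hσ hc₂ hn
  have h3 : √2 / ptilde n p ^ 2 ≤ √2 / n ^ 2 := by
    have := le_ptilde n p
    gcongr
  calc _ ≤ (fourthMoment σ + 1) / 2 * badRate σ c₂ n p := h1
    _ ≤ (fourthMoment σ + 1) / 2 * (√2 / n ^ 2) := by
      gcongr
      exact h2.trans h3
    _ = _ := by ring

/-- Also true for `β₀ = 0`, where `minSignal` is the junk value of an empty infimum. -/
lemma minSignal_le (β₀ : Fin p → ℝ) (j : Fin p) : β₀ j = 0 ∨ minSignal β₀ ≤ |β₀ j| := by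
  by_cases h : β₀ j = 0
  · exact Or.inl h
  · exact Or.inr (ciInf_le (Set.finite_range fun j : supp β₀ => |β₀ j|).bddBelow
      (⟨j, mem_supp.2 h⟩ : supp β₀))

namespace Conditions

/-- The lower bound on `‖β₀‖₂` excludes the zero vector. -/
lemma one_le_l0 (H : Conditions σ c c₂ c₃ b pen μ X β₀ ε lam βhat) (hb : 0 < b) :
    1 ≤ l0 β₀ := by
  rw [Nat.one_le_iff_ne_zero]
  intro h0
  have h1 : β₀ = 0 := by
    ext j
    by_contra hj
    have : j ∈ supp β₀ := mem_supp.2 hj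
    rw [l0, Finset.card_eq_zero] at h0
    rw [h0] at this
    simp at this
  have := H.norm_lower
  rw [h1, l2_zero] at this
  linarith

/-- The constant `c` is automatically at most `1`, as the columns are normalized. -/
lemma c_le_one (H : Conditions σ c c₂ c₃ b pen μ X β₀ ε lam βhat) (hc : 0 < c) (hb : 0 < b)
    (hn : 0 < n) : c ≤ 1 := by
  obtain ⟨j, _⟩ := Finset.card_pos.1 (H.one_le_l0 hb)
  refine le_one_of_rspark hc hn H.column_norm j (lt_of_le_of_lt ?_ H.sparse)
  have : (1 : ℕ∞) ≤ 2 * (1 : ℕ) := by norm_num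
  refine this.trans ?_
  gcongr
  exact H.one_le_l0 hb

lemma lam_pos (H : Conditions σ c c₂ c₃ b pen μ X β₀ ε lam βhat) (hc : 0 < c) (hc₂ : 0 < c₂) :
    0 < lam :=
  lt_of_le_of_lt (by positivity) H.lam_lower

lemma lam_lt (H : Conditions σ c c₂ c₃ b pen μ X β₀ ε lam βhat) (hc : 0 < c) (hc₂ : 0 < c₂) :
    lam < minSignal β₀ ∧ lam < minSignal β₀ * √(c ^ 2 / 2) := by
  have h1 := H.lam_upper
  have h2 := H.lam_pos hc hc₂
  have h0 : 0 < minSignal β₀ := by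
    by_contra! hneg
    have : 0 ≤ min 1 √(c ^ 2 / 2) := le_min zero_le_one (Real.sqrt_nonneg _)
    nlinarith
  exact ⟨h1.trans_le (mul_le_of_le_one_right h0.le (min_le_left _ _)),
    h1.trans_le (mul_le_mul_of_nonneg_left (min_le_right _ _) h0.le)⟩

/-- Support recovery outside `badEvent`. -/
lemma ae_supp_eq (H : Conditions σ c c₂ c₃ b pen μ X β₀ ε lam βhat)
    (hpen : pen = hardPenalty ∨ pen = l0Penalty) (hc : 0 < c) (hc₂ : 0 < c₂) (hn : 0 < n) :
    ∀ᵐ ω ∂μ, ω ∉ badEvent c₂ X ε → supp (βhat ω) = supp β₀ := by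
  have hn' : (0 : ℝ) < n := by exact_mod_cast hn
  have hlog : 0 ≤ Real.log (ptilde n p) := Real.log_nonneg (one_le_ptilde hn p)
  have hlam := H.lam_pos hc hc₂
  obtain ⟨h1, h2⟩ := H.lam_lt hc hc₂
  set a := c₂ * √(Real.log (ptilde n p) / n) with ha
  set Q := c₂ * √((2 * l0 β₀ + 1) * Real.log (ptilde n p) / n) with hQ
  have hQ0 : 0 ≤ Q := by positivity
  have hQa : Q ^ 2 = (2 * l0 β₀ + 1) * a ^ 2 := by
    rw [hQ, ha, mul_pow, mul_pow, Real.sq_sqrt (by positivity), Real.sq_sqrt (by positivity)]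
    ring
  have hQl : Q < c * lam := by
    have := H.lam_lower
    rwa [mul_assoc, ← hQ, inv_mul_lt_iff₀ hc] at this
  have hQb : 4 * Q < c ^ 2 * minSignal β₀ := by
    have h3 := H.signal
    rw [mul_assoc, ← hQ, mul_assoc] at h3
    have h4 : 4 / c ≤ max √(16 / c ^ 2) 1 := by
      refine le_max_of_le_left (le_of_eq ?_)
      rw [Real.sqrt_div (by norm_num), Real.sqrt_sq hc.le]
      norm_num
    have h5 : 4 / c * (c⁻¹ * Q) < minSignal β₀ :=
      lt_of_le_of_lt (mul_le_mul_of_nonneg_right h4 (by positivity)) h3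
    have h6 : 4 / c * (c⁻¹ * Q) = 4 * Q / c ^ 2 := by field_simp
    rw [h6, div_lt_iff₀ (by positivity)] at h5
    linarith
  filter_upwards [H.feasible, H.minimizer] with ω hf hm hω
  refine supp_eq_of_minimizer (b₀ := minSignal β₀) (a := a) (e := ε ω) hpen hlam hc hn
    H.column_norm h1 ?_ (minSignal_le β₀) ?_ ?_ ?_ H.sparse hf hm
  · have := pow_le_pow_left₀ hlam.le h2.le 2
    rw [mul_pow, Real.sq_sqrt (by positivity)] at this
    linarith
  · have := pow_lt_pow_left₀ hQl hQ0 two_ne_zero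
    rw [hQa, mul_pow] at this
    linarith
  · have := pow_lt_pow_left₀ hQb (by positivity) two_ne_zero
    have e : (4 * Q) ^ 2 = 16 * Q ^ 2 := by ring
    rw [e, hQa] at this
    linarith
  · intro j
    by_contra! hlt
    exact hω ⟨j, hlt⟩

/-- At `l = 0` the refitted estimator never errs by more than a multiple of the noise, whether or
not the support is recovered. -/
lemma ae_refitError_zero_le (H : Conditions σ c c₂ c₃ b pen μ X β₀ ε lam βhat)
    (hpen : pen = hardPenalty ∨ pen = l0Penalty) (hc : 0 < c) (hc₂ : 0 < c₂) (hb : 0 < b)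
    (hn : 0 < n) :
    ∀ᵐ ω ∂μ, predLoss X (refitError X β₀ ε βhat 0 ω) ≤ 36 * ((n : ℝ)⁻¹ * l2 (ε ω) ^ 2) ∧
      sqLoss (refitError X β₀ ε βhat 0 ω) ≤ 36 / c ^ 2 * ((n : ℝ)⁻¹ * l2 (ε ω) ^ 2) := by
  have hn' : (0 : ℝ) < n := by exact_mod_cast hn
  have hlam := H.lam_pos hc hc₂
  obtain ⟨h1, h2⟩ := H.lam_lt hc hc₂
  filter_upwards [H.feasible, H.minimizer] with ω hf hm
  have h3 := prediction_error_le (e := ε ω) hpen hlam hc (H.c_le_one hc hb hn) hn h1 h2.le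
    (minSignal_le β₀) H.sparse hf hm
  have h4 := ridge_zero_least_squares hc hn (card_lt_rspark hf) (X *ᵥ β₀ + ε ω)
    (Finset.Subset.refl (supp (βhat ω)))
  set w := ridge X (supp (βhat ω)) 0 (X *ᵥ β₀ + ε ω) with hw
  have h5 : l2 (X *ᵥ (w - β₀)) ≤ 6 * l2 (ε ω) := by
    have e1 : X *ᵥ (w - β₀) = ε ω - (X *ᵥ β₀ + ε ω - X *ᵥ w) := by rw [mulVec_sub]; abel
    have e2 : X *ᵥ β₀ + ε ω - X *ᵥ βhat ω = ε ω - X *ᵥ (βhat ω - β₀) := by rw [mulVec_sub]; abel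
    rw [e2] at h4
    rw [e1]
    have h6 := l2_sub_le (ε ω) (X *ᵥ β₀ + ε ω - X *ᵥ w)
    have h7 := l2_sub_le (ε ω) (X *ᵥ (βhat ω - β₀))
    linarith
  have hwf : w ∈ sparseVectors p (rspark c X) :=
    two_mul_card_lt_mono (l0_ridge_le X (supp (βhat ω)) 0 _) hf
  have h6 : c * √(n : ℝ) * l2 (w - β₀) ≤ l2 (X *ᵥ (w - β₀)) := sparse_lower_sub hc hn hwf H.sparse
  have herr : refitError X β₀ ε βhat 0 ω = w - β₀ := rfl
  rw [herr]
  have h7 := pow_le_pow_left₀ (l2_nonneg _) h5 2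
  have h8 := pow_le_pow_left₀ (mul_nonneg (by positivity) (l2_nonneg _)) (h6.trans h5) 2
  rw [mul_pow] at h7
  rw [mul_pow, mul_pow, mul_pow, Real.sq_sqrt hn'.le] at h8
  constructor
  · rw [predLoss]
    calc (n : ℝ)⁻¹ * l2 (X *ᵥ (w - β₀)) ^ 2 ≤ (n : ℝ)⁻¹ * (6 ^ 2 * l2 (ε ω) ^ 2) := by gcongr
      _ = _ := by ring
  · rw [sqLoss]
    have e : 36 / c ^ 2 * ((n : ℝ)⁻¹ * l2 (ε ω) ^ 2) = 6 ^ 2 * l2 (ε ω) ^ 2 / (c ^ 2 * n) := by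
      field_simp; ring
    rw [e, le_div_iff₀ (by positivity)]
    linarith

/-- The eigenvalues of the Gram matrix of the true support are of the order of `n`. -/
lemma eigenvalue_bounds (H : Conditions σ c c₂ c₃ b pen μ X β₀ ε lam βhat) (hc : 0 < c)
    (hn : 0 < n) {t : ℝ}
    (ht : Module.End.HasEigenvalue (Matrix.toLin' (gram X (supp β₀))) t) :
    c ^ 2 * n ≤ t ∧ t ≤ c₃ ^ 2 * n := by
  obtain ⟨v, hv, hv'⟩ := exists_rayleigh ht
  rw [gram, ← mulVec_dotProduct_mulVec] at hv'
  constructor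
  · have := sparse_lower_cols hc hn (card_lt_rspark H.sparse) v
    rw [hv'] at this
    exact le_of_mul_le_mul_right this hv
  · have h1 := sparse_upper_le hn H.sparse_upper
      (two_mul_card_lt_mono (Finset.card_le_card (supp_extend_subset (supp β₀) v)) H.sparse)
    have h2 := pow_le_pow_left₀ (l2_nonneg _) h1 2
    rw [mul_pow, mul_pow, Real.sq_sqrt (Nat.cast_nonneg n), l2_sq, l2_sq, dotProduct_extend,
      mulVec_extend, hv'] at h2
    exact le_of_mul_le_mul_right h2 hv

lemma eigenvalue_mem (H : Conditions σ c c₂ c₃ b pen μ X β₀ ε lam βhat) (hc : 0 < c)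
    (hn : 0 < n) {P : Matrix (supp β₀) (supp β₀) ℝ} {d : supp β₀ → ℝ}
    (hP : IsEigendecomposition (gram X (supp β₀)) P d) (j : supp β₀) :
    0 < minEig (gram X (supp β₀)) ∧ minEig (gram X (supp β₀)) ≤ d j ∧
      d j ≤ maxEig (gram X (supp β₀)) := by
  have hn' : (0 : ℝ) < n := by exact_mod_cast hn
  have hj := hP.hasEigenvalue j
  refine ⟨?_, csInf_le ⟨c ^ 2 * n, fun t ht => (H.eigenvalue_bounds hc hn ht).1⟩ hj,
    le_csSup ⟨c₃ ^ 2 * n, fun t ht => (H.eigenvalue_bounds hc hn ht).2⟩ hj⟩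
  exact lt_of_lt_of_le (by positivity)
    (le_csInf ⟨_, hj⟩ fun t ht => (H.eigenvalue_bounds hc hn ht).1)

/-- The signals exceed the scale `√(s / n)` of the estimation error by a factor that tends to infinity. -/
lemma c₂_mul_sqrt_lt (H : Conditions σ c c₂ c₃ b pen μ X β₀ ε lam βhat) (hc : 0 < c)
    (hc₂ : 0 < c₂) (hb : 0 < b) (hn : 0 < n) :
    c₂ * √(Real.log n) * √(l0 β₀ : ℝ) < √(n : ℝ) * minSignal β₀ := by
  have hn' : (0 : ℝ) < n := by exact_mod_cast hn
  have hln : 0 ≤ Real.log n := Real.log_nonneg (by exact_mod_cast hn)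
  have hlog : Real.log n ≤ Real.log (ptilde n p) := Real.log_le_log hn' (le_ptilde n p)
  have hs0 : (0 : ℝ) ≤ l0 β₀ := Nat.cast_nonneg _
  have h1 := H.signal
  have hc1 := H.c_le_one hc hb hn
  set R := √((2 * l0 β₀ + 1) * Real.log (ptilde n p) / n) with hR
  have hR0 : 0 ≤ R := Real.sqrt_nonneg _
  have h2 : c₂ * R ≤ max √(16 / c ^ 2) 1 * c⁻¹ * c₂ * R := by
    have h3 : 1 ≤ max √(16 / c ^ 2) 1 * c⁻¹ :=
      one_le_mul_of_one_le_of_one_le (le_max_right _ _) ((one_le_inv₀ hc).2 hc1)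
    rw [mul_assoc]
    exact le_mul_of_one_le_left (by positivity) h3
  have h4 : √(n : ℝ) * (c₂ * R) < √(n : ℝ) * minSignal β₀ :=
    mul_lt_mul_of_pos_left (lt_of_le_of_lt h2 h1) (Real.sqrt_pos.2 hn')
  refine lt_of_le_of_lt ?_ h4
  have h5 : √(Real.log n) * √(l0 β₀ : ℝ) ≤ √(n : ℝ) * R := by
    rw [hR, ← Real.sqrt_mul hln, ← Real.sqrt_mul hn'.le, mul_div_cancel₀ _ hn'.ne']
    refine Real.sqrt_le_sqrt ?_
    nlinarith
  calc c₂ * √(Real.log n) * √(l0 β₀ : ℝ) = c₂ * (√(Real.log n) * √(l0 β₀ : ℝ)) := by ring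
    _ ≤ c₂ * (√(n : ℝ) * R) := by gcongr
    _ = _ := by ring

end Conditions

end Problem

/-! ### The minimal quadratic risks -/

/-- For `l > n` the shrinkage bias is of the order of the whole signal, so a small leading risk
forces `l ≤ n`; there `d j + l` is still of the order of `n`. -/
lemma le_of_leadRisk_lt {ι : Type*} [Fintype ι] {d w b : ι → ℝ} {σ l N B γ w₀ : ℝ} (hN : 0 < N)
    (hγ : 0 < γ) (hd : ∀ j, 0 < d j) (hdu : ∀ j, d j ≤ γ * N) (hw₀ : 0 < w₀)
    (hwl : ∀ j, w₀ ≤ w j) (hB : ∑ j, b j ^ 2 = B ^ 2)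
    (h : leadRisk d w b σ l < w₀ * B ^ 2 / (γ + 1) ^ 2) : l ≤ N := by
  by_contra! hlt
  have hl : 0 < l := hN.trans hlt
  refine absurd h (not_lt.2 ?_)
  rw [← hB, Finset.mul_sum, Finset.sum_div]
  refine Finset.sum_le_sum fun j _ => ?_
  have h1 : d j + l ≤ (γ + 1) * l := by
    have := mul_lt_mul_of_pos_left hlt hγ
    linarith [hdu j]
  have h2 := hd j
  have h3 := hwl j
  have h4 := hw₀.trans_le h3
  calc w₀ * b j ^ 2 / (γ + 1) ^ 2 = w₀ * (l ^ 2 * b j ^ 2 / ((γ + 1) * l) ^ 2) := by field_simp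
    _ ≤ w j * ((l ^ 2 * b j ^ 2 + d j * σ ^ 2) / (d j + l) ^ 2) := by
      gcongr
      have : 0 ≤ d j * σ ^ 2 := by positivity
      linarith

section QuadraticRisk

universe u

/-- Risk at `l = 0`: the variance of least squares on the true support, plus the contribution of
the event of misselection, where the error is bounded by the noise. -/
lemma risk_zero_le {σ c c₂ c₃ b κ₀ v lam : ℝ} (hσ : 0 < σ) (hc : 0 < c) (hc₂ : √10 * σ ≤ c₂)
    (hb : 0 < b) (hκ₀ : 0 ≤ κ₀) {n p m : ℕ} {Ω : Type*} [MeasurableSpace Ω] {pen : ℝ → ℝ → ℝ}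
    {μ : Measure Ω} {X : Matrix (Fin n) (Fin p) ℝ} {β₀ : Fin p → ℝ} {ε : Ω → Fin n → ℝ}
    {βhat : Ω → Fin p → ℝ} {A : Matrix (Fin m) (Fin p) ℝ}
    {P : Matrix (supp β₀) (supp β₀) ℝ} {d w : supp β₀ → ℝ}
    (hpen : pen = hardPenalty ∨ pen = l0Penalty)
    (H : Conditions σ c c₂ c₃ b pen μ X β₀ ε lam βhat) (hn : 0 < n)
    (hP : IsEigendecomposition (gram X (supp β₀)) P d)
    (hloss : ∀ v, supp v ⊆ supp β₀ →
      quadLoss A v = ∑ j, w j * (P *ᵥ fun i : supp β₀ => v i) j ^ 2)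
    (hzero : ∀ᵐ ω ∂μ, quadLoss A (refitError X β₀ ε βhat 0 ω)
      ≤ κ₀ * ((n : ℝ)⁻¹ * l2 (ε ω) ^ 2))
    (hw : ∀ j, w j / d j ≤ v / n) :
    risk μ (quadLoss A) (refitError X β₀ ε βhat 0)
      ≤ (σ ^ 2 * v + κ₀ * ((fourthMoment σ + 1) / 2 * √2)) * (l0 β₀ / n) := by
  have := H.gaussian.isProbabilityMeasure
  have hn' : (0 : ℝ) < n := by exact_mod_cast hn
  have hc₂' : 0 < c₂ := lt_of_lt_of_le (by positivity) hc₂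
  have hd : ∀ j, 0 < d j := fun j => lt_of_lt_of_le (by positivity)
    (H.eigenvalue_bounds hc hn (hP.hasEigenvalue j)).1
  rw [risk_quadLoss_eq (bad := badEvent c₂ X ε) hc hn H.sparse_upper H.sparse H.gaussian
    H.measurable H.feasible (H.ae_supp_eq hpen hc hc₂' hn) le_rfl,
    risk_oracle hc hn H.sparse le_rfl H.gaussian hP hd hloss]
  have h1 : ∑ j, w j * ((0 ^ 2 * rotated β₀ P j ^ 2 + d j * σ ^ 2) / (d j + 0) ^ 2)
      ≤ σ ^ 2 * v * (l0 β₀ / n) := by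
    calc _ ≤ ∑ _j : supp β₀, σ ^ 2 * (v / n) := by
          refine Finset.sum_le_sum fun j _ => ?_
          have h := mul_le_mul_of_nonneg_left (hw j) (sq_nonneg σ)
          have := (hd j).ne'
          refine le_trans (le_of_eq ?_) h
          have e : (0 : ℝ) ^ 2 * rotated β₀ P j ^ 2 + d j * σ ^ 2 = d j * σ ^ 2 := by ring
          rw [e, add_zero]
          field_simp
      _ = _ := by
          rw [Finset.sum_const, Finset.card_univ, nsmul_eq_mul, Fintype.card_coe, l0]
          ring
  have h2 : remainder μ A X β₀ ε βhat (badEvent c₂ X ε) 0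
      ≤ κ₀ * ((fourthMoment σ + 1) / 2 * √2) * (l0 β₀ / n) := by
    have hi1 := integrable_quadLoss (A := A) (l := 0) hc hn H.sparse_upper H.sparse H.gaussian
      H.measurable H.feasible le_rfl
    have hi2 := integrable_quadLoss (A := A) (l := 0) hc hn H.sparse_upper H.sparse H.gaussian
      (aemeasurable_const (b := β₀)) (ae_of_all _ fun _ => H.sparse) le_rfl
    have hdiff : Integrable (fun ω => quadLoss A (refitError X β₀ ε βhat 0 ω)
      - quadLoss A (refitError X β₀ ε (fun _ => β₀) 0 ω)) μ := hi1.sub hi2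
    have h3 : remainder μ A X β₀ ε βhat (badEvent c₂ X ε) 0
        ≤ ∫ ω in badEvent c₂ X ε, κ₀ * ((n : ℝ)⁻¹ * l2 (ε ω) ^ 2) ∂μ := by
      refine integral_mono_ae hdiff.integrableOn
        (((integrable_noise_sq H.gaussian).const_mul _).const_mul _).integrableOn
        (ae_restrict_of_ae ?_)
      filter_upwards [hzero] with ω hω
      have : 0 ≤ quadLoss A (refitError X β₀ ε (fun _ => β₀) 0 ω) := sq_nonneg _
      linarith
    rw [integral_const_mul] at h3
    have hm := fourthMoment_nonneg σ
    have h4 : (fourthMoment σ + 1) / 2 * √2 / n ^ 2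
        ≤ (fourthMoment σ + 1) / 2 * √2 * (l0 β₀ / n) := by
      rw [div_eq_mul_inv]
      refine mul_le_mul_of_nonneg_left ?_ (by positivity)
      have hs1 : (1 : ℝ) ≤ l0 β₀ := by exact_mod_cast H.one_le_l0 hb
      have hn1 : (1 : ℝ) ≤ n := by exact_mod_cast hn
      rw [← one_div, div_le_div_iff₀ (by positivity) hn']
      nlinarith [mul_le_mul_of_nonneg_right hs1 (sq_nonneg (n : ℝ))]
    have h5 := mul_le_mul_of_nonneg_left
      ((setIntegral_badEvent_le H.gaussian hσ hc₂ hn H.column_norm).trans h4) hκ₀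
    linarith
  linarith

/-- The minimal risk for a quadratic loss that is diagonal in the eigenbasis of the Gram matrix of
the true support, with weights bounded above and below. -/
theorem quadratic_risk {σ c c₂ c₃ b K κ w₀ w₁ C₀ : ℝ} (hσ : 0 < σ) (hc : 0 < c)
    (hc₂ : √10 * σ ≤ c₂) (hc₃ : 0 < c₃) (hb : 0 < b) (hK : 0 < K) (hκ : 0 < κ) (hw₀ : 0 < w₀)
    (hw₁ : 0 < w₁) (hC₀ : 0 < C₀) :
    ∃ C : ℝ, 0 < C ∧ ∃ η : ℝ, 0 < η ∧ ∀ {n p m : ℕ} {Ω : Type u} [MeasurableSpace Ω]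
      {pen : ℝ → ℝ → ℝ} {μ : Measure Ω} {X : Matrix (Fin n) (Fin p) ℝ} {β₀ : Fin p → ℝ}
      {ε : Ω → Fin n → ℝ} {lam : ℝ} {βhat : Ω → Fin p → ℝ} {A : Matrix (Fin m) (Fin p) ℝ}
      {P : Matrix (supp β₀) (supp β₀) ℝ} {d w : supp β₀ → ℝ},
      (pen = hardPenalty ∨ pen = l0Penalty) →
      Conditions σ c c₂ c₃ b pen μ X β₀ ε lam βhat → 0 < n →
      IsEigendecomposition (gram X (supp β₀)) P d →
      (∀ u ∈ sparseVectors p (rspark c X), l2 (A *ᵥ u) ≤ κ * l2 u) →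
      (∀ v, supp v ⊆ supp β₀ →
        quadLoss A v = ∑ j, w j * (P *ᵥ fun i : supp β₀ => v i) j ^ 2) →
      (∀ j, w₀ ≤ w j) → (∀ j, w j ≤ w₁) →
      risk μ (quadLoss A) (refitError X β₀ ε βhat 0) ≤ C₀ * (l0 β₀ / n) →
      (l0 β₀ : ℝ) ≤ η * n → (l0 β₀ : ℝ) ≤ n →
      (∃ l, IsOptimalRidge μ (quadLoss A) (refitError X β₀ ε βhat) l) ∧
      ∀ l, IsOptimalRidge μ (quadLoss A) (refitError X β₀ ε βhat) l →
        risk μ (quadLoss A) (refitError X β₀ ε βhat l) ≤ C₀ * (l0 β₀ / n) ∧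
        (ptilde n p ^ (1 / 2 - c₂ ^ 2 / (4 * σ ^ 2)) * l2 β₀ ^ 4
            ≤ K * ((l0 β₀ : ℝ) ^ 2 / (n : ℝ) ^ 2) →
          leadOpt d w (rotated β₀ P) σ ≤ C * (l0 β₀ / l2 β₀ ^ 2) ∧
          |l - leadOpt d w (rotated β₀ P) σ| ≤ C * ((l0 β₀ : ℝ) ^ 2 / (n * l2 β₀ ^ 4)) ∧
          leadRisk d w (rotated β₀ P) σ l ≤ C * (l0 β₀ / n) ∧
          |risk μ (quadLoss A) (refitError X β₀ ε βhat l) - leadRisk d w (rotated β₀ P) σ l|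
            ≤ C * ((l0 β₀ : ℝ) ^ 2 / ((n : ℝ) ^ 2 * l2 β₀ ^ 2))) := by
  have hm := fourthMoment_nonneg σ
  set CE := 2 * ((1 + c₃ / c) ^ 2 + 1 / c ^ 2) with hCE
  have hCE0 : 0 < CE := by positivity
  set Cb := √2 + (fourthMoment σ + 1) / (2 * b ^ 2) with hCb
  have hCb0 : 0 < Cb := by positivity
  set CR := κ ^ 2 * CE * (Cb * √2 * K) with hCR
  have hCR0 : 0 < CR := by positivity
  set C₁ := 4 / c ^ 2 * CR with hC₁
  have hC₁0 : 0 < C₁ := by positivity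
  set C₂ := (C₁ / b ^ 2 + σ ^ 2 * w₁ / (c ^ 2) ^ 2) * ((c₃ ^ 2 + 1) ^ 3 / (w₀ * c ^ 2)) with hC₂
  have hC₂0 : 0 < C₂ := by positivity
  set Cl := (C₁ + 3 * C₂ * w₁ * (C₂ + σ ^ 2) / (c ^ 2) ^ 3) * ((c₃ ^ 2) ^ 2 / w₀) with hCl
  have hCl0 : 0 < Cl := by positivity
  set CL := σ ^ 2 * w₁ * (c₃ ^ 2) ^ 2 / ((c ^ 2) ^ 2 * w₀) with hCL
  have hCL0 : 0 < CL := by positivity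
  set Cd := C₀ + CR / b ^ 2 with hCd
  have hCd0 : 0 < Cd := by positivity
  refine ⟨CL + Cl + Cd + CR, by positivity, w₀ * b ^ 2 / ((c₃ ^ 2 + 1) ^ 2 * (Cd + 1)),
    by positivity, ?_⟩
  intro n p m Ω _ pen μ X β₀ ε lam βhat A P d w hpen H hn hP hA hloss hwl hwu h0 hη hsn
  have := H.gaussian.isProbabilityMeasure
  have hn' : (0 : ℝ) < n := by exact_mod_cast hn
  have hc₂' : 0 < c₂ := lt_of_lt_of_le (by positivity) hc₂
  have hs1 : (1 : ℝ) ≤ l0 β₀ := by exact_mod_cast H.one_le_l0 hb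
  have hdl : ∀ j, c ^ 2 * n ≤ d j := fun j =>
    (H.eigenvalue_bounds hc hn (hP.hasEigenvalue j)).1
  have hdu : ∀ j, d j ≤ c₃ ^ 2 * n := fun j =>
    (H.eigenvalue_bounds hc hn (hP.hasEigenvalue j)).2
  have hd : ∀ j, 0 < d j := fun j => lt_of_lt_of_le (by positivity) (hdl j)
  have hB := sum_rotated_sq hP
  have hcard : (Fintype.card (supp β₀) : ℝ) = l0 β₀ := by rw [Fintype.card_coe, l0]
  have hbB := H.norm_lower
  set s : ℝ := (l0 β₀ : ℝ) with hs
  set B : ℝ := l2 β₀ with hBdef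
  have hB0 : 0 < B := hb.trans_le hbB
  have hsmall : Cd * (s / n) < w₀ * b ^ 2 / (c₃ ^ 2 + 1) ^ 2 := by
    have h1 : s / n ≤ w₀ * b ^ 2 / ((c₃ ^ 2 + 1) ^ 2 * (Cd + 1)) := (div_le_iff₀ hn').2 hη
    have h2 : 0 < s / n := by positivity
    calc Cd * (s / n) < (Cd + 1) * (s / n) := by linarith
      _ ≤ (Cd + 1) * (w₀ * b ^ 2 / ((c₃ ^ 2 + 1) ^ 2 * (Cd + 1))) := by gcongr
      _ = _ := by field_simp
  have hbB2 : w₀ * b ^ 2 / (c₃ ^ 2 + 1) ^ 2 ≤ w₀ * B ^ 2 / (c₃ ^ 2 + 1) ^ 2 := by gcongr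
  have hrisk : ∀ l, 0 ≤ l → risk μ (quadLoss A) (refitError X β₀ ε βhat l)
      = leadRisk d w (rotated β₀ P) σ l + remainder μ A X β₀ ε βhat (badEvent c₂ X ε) l := by
    intro l hl
    rw [risk_quadLoss_eq (bad := badEvent c₂ X ε) hc hn H.sparse_upper H.sparse H.gaussian
      H.measurable H.feasible (H.ae_supp_eq hpen hc hc₂' hn) hl,
      risk_oracle hc hn H.sparse hl H.gaussian hP hd hloss, leadRisk]
  have hlt : risk μ (quadLoss A) (refitError X β₀ ε βhat 0) < quadLoss A (-β₀) := by
    have h1 : quadLoss A (-β₀) = quadLoss A β₀ := by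
      rw [quadLoss, quadLoss, mulVec_neg, l2_neg]
    rw [h1, hloss β₀ (Finset.Subset.refl _)]
    have h2 : w₀ * B ^ 2 ≤ ∑ j, w j * (P *ᵥ fun i : supp β₀ => β₀ i) j ^ 2 := by
      rw [← hB, Finset.mul_sum]
      exact Finset.sum_le_sum fun j _ => mul_le_mul_of_nonneg_right (hwl j) (sq_nonneg _)
    refine lt_of_lt_of_le ?_ h2
    have h3 : w₀ * B ^ 2 / (c₃ ^ 2 + 1) ^ 2 ≤ w₀ * B ^ 2 :=
      div_le_self (by positivity) (one_le_pow₀ (by linarith [sq_nonneg c₃]))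
    have h4 : C₀ * (s / n) ≤ Cd * (s / n) := by
      have : 0 ≤ CR / b ^ 2 := by positivity
      gcongr
      linarith
    linarith
  obtain ⟨Cg, hCg0, hCg⟩ := exists_quadLoss_le A
  refine ⟨exists_isOptimalRidge hc hn H.sparse_upper H.sparse H.gaussian H.measurable H.feasible
    continuous_quadLoss hCg0 hCg hlt, fun l hopt => ?_⟩
  have hR0 : risk μ (quadLoss A) (refitError X β₀ ε βhat l) ≤ C₀ * (s / n) :=
    (hopt.2.2 0 le_rfl).trans h0
  refine ⟨hR0, fun hlevel => ?_⟩
  have hl := hopt.2.1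
  set π := badRate σ c₂ n p with hπ
  have hπ0 : 0 < π := badRate_pos hn
  have hπ2 : π ≤ √2 := by
    refine (badRate_le hσ hc₂ hn).trans (div_le_self (by positivity) ?_)
    exact one_le_pow₀ (one_le_ptilde hn p)
  -- The only use of the level condition: it makes `badRate * ‖β₀‖²` small.
  have hmass : badMass μ β₀ ε (badEvent c₂ X ε) ≤ Cb * √2 * K * (s ^ 2 / (n ^ 2 * B ^ 2)) := by
    have h1 := badMass_le (β₀ := β₀) H.gaussian hn hπ0
      (measure_badEvent_le H.gaussian hσ hc₂' hn H.column_norm)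
    have h2 : B ^ 2 * π ^ 2 + (fourthMoment σ + 1) / 2 * π ≤ Cb * (π * B ^ 2) := by
      have h3 : (fourthMoment σ + 1) / 2 * π
          ≤ (fourthMoment σ + 1) / (2 * b ^ 2) * (π * B ^ 2) := by
        calc (fourthMoment σ + 1) / 2 * π
            = (fourthMoment σ + 1) / (2 * b ^ 2) * (π * b ^ 2) := by field_simp
          _ ≤ _ := by gcongr
      have h4 : B ^ 2 * π ^ 2 ≤ √2 * (π * B ^ 2) := by
        calc B ^ 2 * π ^ 2 = π * (π * B ^ 2) := by ring
          _ ≤ _ := by gcongr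
      rw [hCb, add_mul]
      linarith
    have h5 : π * B ^ 2 ≤ √2 * K * (s ^ 2 / (n ^ 2 * B ^ 2)) := by
      calc π * B ^ 2 = √2 * (ptilde n p ^ (1 / 2 - c₂ ^ 2 / (4 * σ ^ 2)) * B ^ 4) / B ^ 2 := by
            rw [hπ, badRate]; field_simp
        _ ≤ √2 * (K * (s ^ 2 / n ^ 2)) / B ^ 2 := by gcongr
        _ = _ := by field_simp
    calc _ ≤ Cb * (π * B ^ 2) := h1.trans h2
      _ ≤ Cb * (√2 * K * (s ^ 2 / (n ^ 2 * B ^ 2))) := by gcongr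
      _ = _ := by ring
  have hrem : |remainder μ A X β₀ ε βhat (badEvent c₂ X ε) l| ≤ CR * (s ^ 2 / (n ^ 2 * B ^ 2)) := by
    refine (abs_remainder_le (c₃ := c₃) hc hn H.sparse_upper H.sparse hκ.le hA H.gaussian
      H.feasible hl).trans ?_
    rw [hCR, ← hCE, mul_assoc (κ ^ 2 * CE)]
    gcongr
  have hlead : leadRisk d w (rotated β₀ P) σ l ≤ Cd * (s / n) := by
    have h1 := hrisk l hl
    have h2 := (abs_le.1 hrem).1
    have h3 : s ^ 2 / (n ^ 2 * B ^ 2) ≤ s / n / b ^ 2 := by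
      calc s ^ 2 / (n ^ 2 * B ^ 2) = (s / n) * (s / n) / B ^ 2 := by field_simp
        _ ≤ 1 * (s / n) / b ^ 2 := by
          have : s / n ≤ 1 := (div_le_one hn').2 hsn
          gcongr
        _ = _ := by rw [one_mul]
    have h4 := mul_le_mul_of_nonneg_left h3 hCR0.le
    have h5 : CR * (s / n / b ^ 2) = CR / b ^ 2 * (s / n) := by ring
    rw [hCd, add_mul]
    linarith
  have hlN : l ≤ n := le_of_leadRisk_lt hn' (by positivity) hd hdu hw₀ hwl hB
    (lt_of_le_of_lt hlead (hsmall.trans_le hbB2))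
  set ρ := 4 * κ ^ 2 / (c ^ 2 * n) * CE * badMass μ β₀ ε (badEvent c₂ X ε) with hρ
  have hρle : ρ ≤ C₁ * ((Fintype.card (supp β₀) : ℝ) ^ 2 / ((n : ℝ) ^ 3 * B ^ 2)) := by
    rw [hcard]
    calc ρ ≤ 4 * κ ^ 2 / (c ^ 2 * n) * CE * (Cb * √2 * K * (s ^ 2 / (n ^ 2 * B ^ 2))) := by
          rw [hρ]; gcongr
      _ = _ := by rw [hC₁, hCR]; field_simp
  -- `l` minimizes `leadRisk` up to the variation of the remainder.
  have hmin : ∀ t, 0 ≤ t → leadRisk d w (rotated β₀ P) σ l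
      ≤ leadRisk d w (rotated β₀ P) σ t + ρ * |l - t| := by
    intro t ht
    have h1 := hopt.2.2 t ht
    rw [hrisk l hl, hrisk t ht] at h1
    have h2 := abs_remainder_sub_le (c₃ := c₃) (bad := badEvent c₂ X ε) hc hc₃ hn H.sparse_upper
      H.sparse hκ.le hA H.gaussian H.measurable H.feasible hl ht
    rw [← hCE, ← hρ] at h2
    have h3 := (abs_le.1 h2).1
    linarith
  have hloc := abs_sub_leadOpt_le hn' (by positivity : 0 < c ^ 2) hdl hdu hw₀ hwl hw₁ hwu hB
    (by positivity : 0 < c₃ ^ 2) hb hbB (by rw [hcard]; exact hsn) hC₁0.le hρle hl hlN hmin hC₂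
  have hopt_le := leadOpt_le (σ := σ) hn' (by positivity : 0 < c ^ 2) hdl hdu hw₀ hwl hw₁ hwu hB hB0
    (by positivity : 0 < c₃ ^ 2)
  rw [hcard] at hloc hopt_le
  rw [← hCl] at hloc
  rw [← hCL] at hopt_le
  refine ⟨hopt_le.trans ?_, hloc.trans ?_, hlead.trans ?_, ?_⟩
  · gcongr; linarith
  · gcongr; linarith
  · gcongr; linarith
  · rw [hrisk l hl, add_sub_cancel_left]
    refine hrem.trans ?_
    gcongr; linarith

end QuadraticRisk

/-! ### The `L_q`- and `L_∞`-risks -/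

section OtherLosses

variable {n p : ℕ} {q : ℝ}

lemma rpow_le_one_add_sq {x : ℝ} (hx : 0 ≤ x) (hq : 1 ≤ q) (hq2 : q ≤ 2) :
    x ^ q ≤ 1 + x ^ 2 := by
  rcases le_total x 1 with h | h
  · have := Real.rpow_le_one hx h (by linarith : 0 ≤ q)
    nlinarith [sq_nonneg x]
  · have := Real.rpow_le_rpow_of_exponent_le h hq2
    rw [Real.rpow_two] at this
    linarith

lemma sqrt_mul_rpow (hn : 0 < n) {x : ℝ} (hx : 0 ≤ x) (q : ℝ) :
    x ^ q = (√(n : ℝ) * x) ^ q / (n : ℝ) ^ (q / 2) := by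
  have hn' : (0 : ℝ) < n := by exact_mod_cast hn
  have h : √(n : ℝ) ^ q = (n : ℝ) ^ (q / 2) := by
    rw [Real.sqrt_eq_rpow, ← Real.rpow_mul hn'.le]
    congr 1
    ring
  rw [Real.mul_rpow (Real.sqrt_nonneg _) hx, h, mul_div_cancel_left₀]
  exact (Real.rpow_pos_of_pos hn' _).ne'

/-- Comparison of the `L_q`-loss with the sparsity and the squared loss, at the scale `n ^ (-1/2)`
of the coordinatewise errors. -/
lemma lqLoss_le (hn : 0 < n) (hq : 1 ≤ q) (hq2 : q ≤ 2) (v : Fin p → ℝ) :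
    lqLoss q v ≤ (l0 v + n * sqLoss v) / (n : ℝ) ^ (q / 2) := by
  have hn' : (0 : ℝ) < n := by exact_mod_cast hn
  have h : ∀ j, |v j| ^ q
      ≤ ((if v j ≠ 0 then (1 : ℝ) else 0) + n * v j ^ 2) / (n : ℝ) ^ (q / 2) := by
    intro j
    by_cases hj : v j = 0
    · simp [hj, Real.zero_rpow (by linarith : q ≠ 0)]
    · rw [sqrt_mul_rpow hn (abs_nonneg _), if_pos hj]
      gcongr
      have := rpow_le_one_add_sq (x := √(n : ℝ) * |v j|) (by positivity) hq hq2
      rwa [mul_pow, Real.sq_sqrt hn'.le, sq_abs] at this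
  refine (Finset.sum_le_sum fun j _ => h j).trans (le_of_eq ?_)
  rw [← Finset.sum_div, Finset.sum_add_distrib, ← Finset.mul_sum, ← l2_sq_eq_sum, sqLoss,
    Finset.sum_boole]
  rfl

lemma abs_lqLoss_le (hq : 1 ≤ q) (hq2 : q ≤ 2) (v : Fin p → ℝ) :
    |lqLoss q v| ≤ (p + 1) * (1 + l2 v ^ 2) := by
  have h0 : 0 ≤ lqLoss q v := Finset.sum_nonneg fun j _ => Real.rpow_nonneg (abs_nonneg _) _
  have h1 : lqLoss q v ≤ p + l2 v ^ 2 := by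
    refine (Finset.sum_le_sum fun j _ => rpow_le_one_add_sq (abs_nonneg (v j)) hq hq2).trans ?_
    simp [Finset.sum_add_distrib, l2_sq_eq_sum]
  rw [abs_of_nonneg h0]
  nlinarith [mul_nonneg (Nat.cast_nonneg (α := ℝ) p) (sq_nonneg (l2 v))]

lemma continuous_lqLoss (hq : 0 ≤ q) : Continuous (lqLoss q : (Fin p → ℝ) → ℝ) := by
  unfold lqLoss
  exact continuous_finsetSum _ fun j _ =>
    (continuous_apply j).abs.rpow_const fun _ => Or.inr hq

lemma supLoss_le_l2 (v : Fin p → ℝ) : supLoss v ≤ l2 v :=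
  (pi_norm_le_iff_of_nonneg (l2_nonneg v)).2 fun j => abs_apply_le_l2 v j

lemma l2_le_of_pos {a : ℝ} (ha : 0 < a) (v : Fin p → ℝ) :
    l2 v ≤ 1 / 2 * (a + a⁻¹ * sqLoss v) := by
  have h : 1 / 2 * (a + a⁻¹ * sqLoss v) - l2 v = (a - l2 v) ^ 2 / (2 * a) := by
    rw [sqLoss]; field_simp; ring
  have : 0 ≤ (a - l2 v) ^ 2 / (2 * a) := by positivity
  linarith

end OtherLosses

section OtherRisks

variable {n p : ℕ} {Ω : Type*} [MeasurableSpace Ω] {σ c c₂ c₃ b lam q C₀ : ℝ}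
  {pen : ℝ → ℝ → ℝ} {μ : Measure Ω} {X : Matrix (Fin n) (Fin p) ℝ} {β₀ : Fin p → ℝ}
  {ε : Ω → Fin n → ℝ} {βhat : Ω → Fin p → ℝ}

/-- Even after multiplication by `p`, the largest possible support size, the bad event is negligible. -/
lemma p_mul_measure_badEvent_le
    (hε : HasLaw ε (Measure.pi fun _ : Fin n => gaussianReal 0 (σ ^ 2).toNNReal) μ)
    (hσ : 0 < σ) (hc₂ : √10 * σ ≤ c₂) (hn : 0 < n)
    (hcol : ∀ j, l2 (fun i => X i j) = √(n : ℝ)) : p * μ.real (badEvent c₂ X ε) ≤ 2 := by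
  have hc₂' : 0 < c₂ := lt_of_lt_of_le (by positivity) hc₂
  have h1 := measure_badEvent_le hε hσ hc₂' hn hcol
  have h2 := pow_le_pow_left₀ (badRate_pos hn).le (badRate_le (p := p) hσ hc₂ hn) 2
  have hP := one_le_ptilde hn p
  have hp : (p : ℝ) ≤ ptilde n p := le_max_right _ _
  rw [div_pow, Real.sq_sqrt zero_le_two] at h2
  have h3 : (0 : ℝ) ≤ 2 / (ptilde n p ^ 2) ^ 2 := by positivity
  calc p * μ.real (badEvent c₂ X ε) ≤ ptilde n p * (2 / (ptilde n p ^ 2) ^ 2) :=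
        mul_le_mul hp (h1.trans h2) measureReal_nonneg (by linarith)
    _ = 2 / ptilde n p ^ 3 := by field_simp
    _ ≤ 2 := div_le_self zero_le_two (one_le_pow₀ hP)

lemma integrable_sqLoss (H : Conditions σ c c₂ c₃ b pen μ X β₀ ε lam βhat) (hc : 0 < c)
    (hn : 0 < n) {l : ℝ} (hl : 0 ≤ l) :
    Integrable (fun ω => sqLoss (refitError X β₀ ε βhat l ω)) μ := by
  have := H.gaussian.isProbabilityMeasure
  rw [sqLoss_eq_quadLoss]
  exact integrable_quadLoss hc hn H.sparse_upper H.sparse H.gaussian H.measurable H.feasible hl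

/-- The support of the refitted estimator is contained in that of `β₀` outside the bad event and
has at most `p` elements on it, so its expected size is of order `s`. -/
lemma risk_lqLoss_zero_le (H : Conditions σ c c₂ c₃ b pen μ X β₀ ε lam βhat)
    (hpen : pen = hardPenalty ∨ pen = l0Penalty) (hσ : 0 < σ) (hc : 0 < c)
    (hc₂ : √10 * σ ≤ c₂) (hb : 0 < b) (hn : 0 < n) (hq : 1 ≤ q) (hq2 : q ≤ 2)
    (h0 : risk μ sqLoss (refitError X β₀ ε βhat 0) ≤ C₀ * (l0 β₀ / n)) :
    risk μ (lqLoss q) (refitError X β₀ ε βhat 0)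
      ≤ (3 + C₀) * (l0 β₀ / (n : ℝ) ^ (q / 2)) := by
  have := H.gaussian.isProbabilityMeasure
  have hn' : (0 : ℝ) < n := by exact_mod_cast hn
  have hc₂' : 0 < c₂ := lt_of_lt_of_le (by positivity) hc₂
  have hs1 : (1 : ℝ) ≤ l0 β₀ := by exact_mod_cast H.one_le_l0 hb
  -- `badEvent` need not be measurable, as `ε` is only almost everywhere measurable.
  set T := toMeasurable μ (badEvent c₂ X ε) with hT
  have hTm : MeasurableSet T := measurableSet_toMeasurable _ _
  have hTμ : p * μ.real T ≤ 2 := by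
    rw [hT, measureReal_def, measure_toMeasurable, ← measureReal_def]
    exact p_mul_measure_badEvent_le H.gaussian hσ hc₂ hn H.column_norm
  have hi := integrable_sqLoss H hc hn le_rfl
  have hind : Integrable (T.indicator fun _ => (p : ℝ)) μ :=
    (integrable_const _).indicator hTm
  have hi1 : Integrable (fun ω => l0 β₀ + T.indicator (fun _ => (p : ℝ)) ω) μ :=
    (integrable_const _).add hind
  have hsupp : ∀ᵐ ω ∂μ, (l0 (refitError X β₀ ε βhat 0 ω) : ℝ)
      ≤ l0 β₀ + T.indicator (fun _ => (p : ℝ)) ω := by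
    filter_upwards [H.ae_supp_eq hpen hc hc₂' hn] with ω hω
    by_cases hωT : ω ∈ T
    · rw [Set.indicator_of_mem hωT]
      have h1 : l0 (refitError X β₀ ε βhat 0 ω) ≤ p := by
        simpa [l0] using Finset.card_le_univ (supp (refitError X β₀ ε βhat 0 ω))
      have h2 : (l0 (refitError X β₀ ε βhat 0 ω) : ℝ) ≤ p := by exact_mod_cast h1
      linarith
    · rw [Set.indicator_of_notMem hωT, add_zero]
      have h1 := hω fun h => hωT (subset_toMeasurable _ _ h)
      have h2 : supp (refitError X β₀ ε βhat 0 ω) ⊆ supp β₀ := by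
        refine (supp_sub_subset _ _).trans (Finset.union_subset ?_ (Finset.Subset.refl _))
        rw [← h1]
        exact supp_ridge_subset _ _ _ _
      exact_mod_cast Finset.card_le_card h2
  have h1 : risk μ (lqLoss q) (refitError X β₀ ε βhat 0)
      ≤ ∫ ω, (l0 β₀ + T.indicator (fun _ => (p : ℝ)) ω
        + n * sqLoss (refitError X β₀ ε βhat 0 ω)) / (n : ℝ) ^ (q / 2) ∂μ := by
    refine integral_mono_of_nonneg
      (ae_of_all _ fun ω => Finset.sum_nonneg fun j _ => Real.rpow_nonneg (abs_nonneg _) _)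
      ((hi1.add (hi.const_mul _)).div_const _) ?_
    filter_upwards [hsupp] with ω hω
    refine (lqLoss_le hn hq hq2 _).trans ?_
    gcongr
  have h2 : ∫ ω, (l0 β₀ + T.indicator (fun _ => (p : ℝ)) ω
        + n * sqLoss (refitError X β₀ ε βhat 0 ω)) / (n : ℝ) ^ (q / 2) ∂μ
      = (l0 β₀ + p * μ.real T + n * risk μ sqLoss (refitError X β₀ ε βhat 0))
        / (n : ℝ) ^ (q / 2) := by
    rw [integral_div, integral_add hi1 (hi.const_mul _),
      integral_add (integrable_const _) hind, integral_const_mul, integral_indicator_const _ hTm]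
    simp [risk, mul_comm]
  rw [h2] at h1
  refine h1.trans ?_
  rw [← mul_div_assoc]
  gcongr
  have h3 := mul_le_mul_of_nonneg_left h0 hn'.le
  have h4 : n * (C₀ * (l0 β₀ / n)) = C₀ * l0 β₀ := by field_simp
  linarith

/-- The maximum norm is at most the Euclidean norm, and `2 * ‖v‖₂ ≤ a + ‖v‖₂ ^ 2 / a` for
`a = √(s / n)` reduces the claim to the squared risk. -/
lemma risk_supLoss_zero_le (H : Conditions σ c c₂ c₃ b pen μ X β₀ ε lam βhat) (hc : 0 < c)
    (hb : 0 < b) (hn : 0 < n)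
    (h0 : risk μ sqLoss (refitError X β₀ ε βhat 0) ≤ C₀ * (l0 β₀ / n)) :
    risk μ supLoss (refitError X β₀ ε βhat 0) ≤ (1 + C₀) / 2 * √((l0 β₀ : ℝ) / n) := by
  have := H.gaussian.isProbabilityMeasure
  have hn' : (0 : ℝ) < n := by exact_mod_cast hn
  have hs1 : (1 : ℝ) ≤ l0 β₀ := by exact_mod_cast H.one_le_l0 hb
  set a := √((l0 β₀ : ℝ) / n) with ha
  have ha0 : 0 < a := Real.sqrt_pos.2 (by positivity)
  have ha2 : (l0 β₀ : ℝ) / n = a ^ 2 := (Real.sq_sqrt (by positivity)).symm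
  have hi := integrable_sqLoss H hc hn le_rfl
  have h1 : risk μ supLoss (refitError X β₀ ε βhat 0)
      ≤ ∫ ω, 1 / 2 * (a + a⁻¹ * sqLoss (refitError X β₀ ε βhat 0 ω)) ∂μ := by
    refine integral_mono_of_nonneg (ae_of_all _ fun ω => norm_nonneg _)
      (((integrable_const a).add (hi.const_mul _)).const_mul _) (ae_of_all _ fun ω => ?_)
    exact (supLoss_le_l2 _).trans (l2_le_of_pos ha0 _)
  rw [integral_const_mul, integral_add (integrable_const a) (hi.const_mul _),
    integral_const_mul] at h1
  have h2 : ∫ ω, sqLoss (refitError X β₀ ε βhat 0 ω) ∂μ ≤ C₀ * a ^ 2 := by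
    rw [← ha2]; exact h0
  have h3 := mul_le_mul_of_nonneg_left h2 (inv_pos.2 ha0).le
  have h4 : a⁻¹ * (C₀ * a ^ 2) = C₀ * a := by field_simp
  simp only [integral_const, probReal_univ, smul_eq_mul, one_mul] at h1
  linarith

/-- Existence of an optimal ridge parameter for the `L_q`-risk: `n ^ (1/2)` times the smallest
signal exceeds any given constant, so estimating by zero is worse than refitting. -/
lemma exists_optimal_lqLoss (H : Conditions σ c c₂ c₃ b pen μ X β₀ ε lam βhat)
    (hpen : pen = hardPenalty ∨ pen = l0Penalty) (hσ : 0 < σ) (hc : 0 < c)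
    (hc₂ : √10 * σ ≤ c₂) (hb : 0 < b) (hn : 0 < n) (hq : 1 ≤ q) (hq2 : q ≤ 2) (hC₀ : 0 ≤ C₀)
    (h0 : risk μ sqLoss (refitError X β₀ ε βhat 0) ≤ C₀ * (l0 β₀ / n))
    (hlarge : 3 + C₀ < c₂ * √(Real.log n)) :
    ∃ l, IsOptimalRidge μ (lqLoss q) (refitError X β₀ ε βhat) l ∧
      risk μ (lqLoss q) (refitError X β₀ ε βhat l)
        ≤ (3 + C₀) * (l0 β₀ / (n : ℝ) ^ (q / 2)) := by
  have := H.gaussian.isProbabilityMeasure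
  have hn' : (0 : ℝ) < n := by exact_mod_cast hn
  have hc₂' : 0 < c₂ := lt_of_lt_of_le (by positivity) hc₂
  have hs1 : (1 : ℝ) ≤ l0 β₀ := by exact_mod_cast H.one_le_l0 hb
  have h1 := risk_lqLoss_zero_le H hpen hσ hc hc₂ hb hn hq hq2 h0
  have hsig : 3 + C₀ < √(n : ℝ) * minSignal β₀ := by
    have h2 := H.c₂_mul_sqrt_lt hc hc₂' hb hn
    have h3 : c₂ * √(Real.log n) ≤ c₂ * √(Real.log n) * √(l0 β₀ : ℝ) :=
      le_mul_of_one_le_right (by positivity) (Real.one_le_sqrt.2 hs1)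
    linarith
  have hlt : (3 + C₀) * (l0 β₀ / (n : ℝ) ^ (q / 2)) < lqLoss q (-β₀) := by
    have hNq : 0 < (n : ℝ) ^ (q / 2) := Real.rpow_pos_of_pos hn' _
    calc (3 + C₀) * (l0 β₀ / (n : ℝ) ^ (q / 2))
        = l0 β₀ * ((3 + C₀) / (n : ℝ) ^ (q / 2)) := by ring
      _ < l0 β₀ * ((√(n : ℝ) * minSignal β₀) / (n : ℝ) ^ (q / 2)) := by gcongr
      _ = ∑ _j ∈ supp β₀, (√(n : ℝ) * minSignal β₀) / (n : ℝ) ^ (q / 2) := by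
        rw [Finset.sum_const, nsmul_eq_mul, l0]
      _ ≤ ∑ j ∈ supp β₀, |(-β₀) j| ^ q := by
        refine Finset.sum_le_sum fun j hj => ?_
        rw [Pi.neg_apply, abs_neg, sqrt_mul_rpow hn (abs_nonneg _)]
        have h2 := (minSignal_le β₀ j).resolve_left (mem_supp.1 hj)
        have h3 : √(n : ℝ) * minSignal β₀ ≤ √(n : ℝ) * |β₀ j| := by gcongr
        gcongr
        exact h3.trans (Real.self_le_rpow_of_one_le (by linarith) hq)
      _ ≤ lqLoss q (-β₀) :=
        Finset.sum_le_univ_sum_of_nonneg fun j => Real.rpow_nonneg (abs_nonneg _) _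
  obtain ⟨l, hl⟩ := exists_isOptimalRidge hc hn H.sparse_upper H.sparse H.gaussian H.measurable
    H.feasible (continuous_lqLoss (by linarith : 0 ≤ q)) (by positivity : (0 : ℝ) ≤ p + 1)
    (abs_lqLoss_le hq hq2) (lt_of_le_of_lt h1 hlt)
  exact ⟨l, hl, (hl.2.2 0 le_rfl).trans h1⟩

lemma exists_optimal_supLoss (H : Conditions σ c c₂ c₃ b pen μ X β₀ ε lam βhat)
    (hc : 0 < c) (hc₂ : 0 < c₂) (hb : 0 < b) (hn : 0 < n) (hC₀ : 0 ≤ C₀)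
    (h0 : risk μ sqLoss (refitError X β₀ ε βhat 0) ≤ C₀ * (l0 β₀ / n))
    (hlarge : 3 + C₀ < c₂ * √(Real.log n)) :
    ∃ l, IsOptimalRidge μ supLoss (refitError X β₀ ε βhat) l ∧
      risk μ supLoss (refitError X β₀ ε βhat l) ≤ (1 + C₀) / 2 * √((l0 β₀ : ℝ) / n) := by
  have := H.gaussian.isProbabilityMeasure
  have hn' : (0 : ℝ) < n := by exact_mod_cast hn
  have hs1 : 1 ≤ l0 β₀ := H.one_le_l0 hb
  have hs0 : (0 : ℝ) < l0 β₀ := by exact_mod_cast hs1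
  have h1 := risk_supLoss_zero_le H hc hb hn h0
  have hlt : (1 + C₀) / 2 * √((l0 β₀ : ℝ) / n) < supLoss (-β₀) := by
    obtain ⟨j, hj⟩ := Finset.card_pos.1 hs1
    have h2 : minSignal β₀ ≤ supLoss (-β₀) :=
      ((minSignal_le β₀ j).resolve_left (mem_supp.1 hj)).trans
        (by rw [supLoss, norm_neg]; exact norm_le_pi_norm β₀ j)
    refine lt_of_lt_of_le ?_ h2
    rw [Real.sqrt_div hs0.le, ← mul_div_assoc, div_lt_iff₀ (Real.sqrt_pos.2 hn'),
      mul_comm (minSignal β₀)]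
    refine lt_of_le_of_lt ?_ (H.c₂_mul_sqrt_lt hc hc₂ hb hn)
    gcongr
    linarith
  obtain ⟨l, hl⟩ := exists_isOptimalRidge hc hn H.sparse_upper H.sparse H.gaussian H.measurable
    H.feasible (loss := supLoss) continuous_norm zero_le_one
    (fun v => by
      rw [supLoss, abs_norm, one_mul]
      have h2 := supLoss_le_l2 v
      have h3 := l2_le_of_pos one_pos v
      have h4 := sq_nonneg (l2 v)
      rw [supLoss] at h2
      rw [sqLoss] at h3
      linarith) (lt_of_le_of_lt h1 hlt)
  exact ⟨l, hl, (hl.2.2 0 le_rfl).trans h1⟩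

end OtherRisks

/-! ### The leading terms of the optimal ridge parameters -/

/-- `leadOpt` is `σ²` times a ratio of weighted sums of `1` and of `b j ^ 2`, with the same weights
`w j / d j ^ 2`; bounds for these weights bound the ratio. -/
lemma leadOpt_mem {ι : Type*} [Fintype ι] {d w b : ι → ℝ} {σ B r₀ r₁ : ℝ} (hr₀ : 0 < r₀)
    (hr₁ : 0 < r₁) (h₀ : ∀ j, r₀ ≤ w j / d j ^ 2) (h₁ : ∀ j, w j / d j ^ 2 ≤ r₁) (hB0 : 0 < B)
    (hB : ∑ j, b j ^ 2 = B ^ 2) :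
    Fintype.card ι * σ ^ 2 / B ^ 2 * (r₀ / r₁) ≤ leadOpt d w b σ ∧
      leadOpt d w b σ ≤ Fintype.card ι * σ ^ 2 / B ^ 2 * (r₁ / r₀) := by
  have hN₀ : Fintype.card ι * r₀ ≤ ∑ j, w j / d j ^ 2 := by
    rw [← nsmul_eq_mul, ← Finset.card_univ, ← Finset.sum_const]
    exact Finset.sum_le_sum fun j _ => h₀ j
  have hN₁ : ∑ j, w j / d j ^ 2 ≤ Fintype.card ι * r₁ := by
    rw [← nsmul_eq_mul, ← Finset.card_univ, ← Finset.sum_const]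
    exact Finset.sum_le_sum fun j _ => h₁ j
  have e : ∀ j, w j * b j ^ 2 / d j ^ 2 = w j / d j ^ 2 * b j ^ 2 := fun j => by ring
  have hD₀ : r₀ * B ^ 2 ≤ ∑ j, w j * b j ^ 2 / d j ^ 2 := by
    rw [← hB, Finset.mul_sum]
    exact Finset.sum_le_sum fun j _ => by
      rw [e]; exact mul_le_mul_of_nonneg_right (h₀ j) (sq_nonneg _)
  have hD₁ : ∑ j, w j * b j ^ 2 / d j ^ 2 ≤ r₁ * B ^ 2 := by
    rw [← hB, Finset.mul_sum]
    exact Finset.sum_le_sum fun j _ => by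
      rw [e]; exact mul_le_mul_of_nonneg_right (h₁ j) (sq_nonneg _)
  have hD : 0 < ∑ j, w j * b j ^ 2 / d j ^ 2 := lt_of_lt_of_le (by positivity) hD₀
  have hN : 0 ≤ ∑ j, w j / d j ^ 2 := le_trans (by positivity) hN₀
  constructor
  · calc Fintype.card ι * σ ^ 2 / B ^ 2 * (r₀ / r₁)
        = σ ^ 2 * (Fintype.card ι * r₀) / (r₁ * B ^ 2) := by field_simp
      _ ≤ _ := by unfold leadOpt; gcongr
  · calc leadOpt d w b σ ≤ σ ^ 2 * (Fintype.card ι * r₁) / (r₀ * B ^ 2) := by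
          unfold leadOpt; gcongr
      _ = _ := by field_simp

/-! ### The squared `L₂`-risk and the prediction risk -/

section Quadratic

universe u

/-- The bound for the two quadratic risks at `l = 0`, in units of `s / n`. -/
def zeroRiskConst (σ c : ℝ) : ℝ := (σ ^ 2 + 36 * ((fourthMoment σ + 1) / 2 * √2)) / c ^ 2

lemma zeroRiskConst_pos {σ c : ℝ} (hc : 0 < c) : 0 < zeroRiskConst σ c := by
  have := fourthMoment_nonneg σ
  unfold zeroRiskConst
  positivity

section Problem

variable {n p : ℕ} {Ω : Type*} [MeasurableSpace Ω] {σ c c₂ c₃ b lam : ℝ}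
  {pen : ℝ → ℝ → ℝ} {μ : Measure Ω} {X : Matrix (Fin n) (Fin p) ℝ} {β₀ : Fin p → ℝ}
  {ε : Ω → Fin n → ℝ} {βhat : Ω → Fin p → ℝ}

lemma risk_sqLoss_zero_le (hσ : 0 < σ) (hc : 0 < c) (hc₂ : √10 * σ ≤ c₂) (hb : 0 < b)
    (hpen : pen = hardPenalty ∨ pen = l0Penalty)
    (H : Conditions σ c c₂ c₃ b pen μ X β₀ ε lam βhat) (hn : 0 < n) :
    risk μ sqLoss (refitError X β₀ ε βhat 0) ≤ zeroRiskConst σ c * (l0 β₀ / n) := by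
  have hn' : (0 : ℝ) < n := by exact_mod_cast hn
  have hc₂' : 0 < c₂ := lt_of_lt_of_le (by positivity) hc₂
  obtain ⟨P, d, hP⟩ := exists_isEigendecomposition (gram_transpose X (supp β₀))
  have h := risk_zero_le (A := (1 : Matrix (Fin p) (Fin p) ℝ)) (w := fun _ => 1)
    (v := 1 / c ^ 2) hσ hc hc₂ hb (by positivity : 0 ≤ 36 / c ^ 2) hpen H hn hP
    (fun v hv => by rw [← sqLoss_eq_quadLoss]; exact sqLoss_eq_sum_rotated hP hv)
    (by
      rw [← sqLoss_eq_quadLoss]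
      exact (H.ae_refitError_zero_le hpen hc hc₂' hb hn).mono fun ω h => h.2)
    (fun j => by
      rw [div_div]
      exact one_div_le_one_div_of_le (by positivity)
        (H.eigenvalue_bounds hc hn (hP.hasEigenvalue j)).1)
  rw [← sqLoss_eq_quadLoss] at h
  refine h.trans (le_of_eq ?_)
  rw [zeroRiskConst]
  ring

lemma risk_predLoss_zero_le (hσ : 0 < σ) (hc : 0 < c) (hc₂ : √10 * σ ≤ c₂) (hb : 0 < b)
    (hpen : pen = hardPenalty ∨ pen = l0Penalty)
    (H : Conditions σ c c₂ c₃ b pen μ X β₀ ε lam βhat) (hn : 0 < n) :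
    risk μ (predLoss X) (refitError X β₀ ε βhat 0) ≤ zeroRiskConst σ c * (l0 β₀ / n) := by
  have hn' : (0 : ℝ) < n := by exact_mod_cast hn
  have hc₂' : 0 < c₂ := lt_of_lt_of_le (by positivity) hc₂
  obtain ⟨P, d, hP⟩ := exists_isEigendecomposition (gram_transpose X (supp β₀))
  have h := risk_zero_le (A := (√(n : ℝ))⁻¹ • X) (w := fun j => (n : ℝ)⁻¹ * d j)
    (v := 1) hσ hc hc₂ hb (by norm_num : (0 : ℝ) ≤ 36) hpen H hn hP
    (fun v hv => by rw [← predLoss_eq_quadLoss]; exact predLoss_eq_sum_rotated hP hv)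
    (by
      rw [← predLoss_eq_quadLoss]
      exact (H.ae_refitError_zero_le hpen hc hc₂' hb hn).mono fun ω h => h.1)
    (fun j => by
      have h1 : 0 < d j := lt_of_lt_of_le (by positivity)
        (H.eigenvalue_bounds hc hn (hP.hasEigenvalue j)).1
      rw [mul_div_cancel_right₀ _ h1.ne', one_div])
  rw [← predLoss_eq_quadLoss] at h
  refine h.trans ?_
  have hm := fourthMoment_nonneg σ
  rw [zeroRiskConst, mul_one]
  gcongr
  exact le_div_self (by positivity) (by positivity)
    (pow_le_one₀ hc.le (H.c_le_one hc hb hn))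

end Problem

/-- `quadratic_risk` for the squared loss, whose weights in the eigenbasis are all `1`. -/
theorem sqLoss_risk {σ c c₂ c₃ b K : ℝ} (hσ : 0 < σ) (hc : 0 < c) (hc₂ : √10 * σ ≤ c₂)
    (hc₃ : 0 < c₃) (hb : 0 < b) (hK : 0 < K) :
    ∃ C : ℝ, 0 < C ∧ ∃ η : ℝ, 0 < η ∧ ∀ {n p : ℕ} {Ω : Type u} [MeasurableSpace Ω]
      {pen : ℝ → ℝ → ℝ} {μ : Measure Ω} {X : Matrix (Fin n) (Fin p) ℝ} {β₀ : Fin p → ℝ}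
      {ε : Ω → Fin n → ℝ} {lam : ℝ} {βhat : Ω → Fin p → ℝ},
      (pen = hardPenalty ∨ pen = l0Penalty) →
      Conditions σ c c₂ c₃ b pen μ X β₀ ε lam βhat → 0 < n →
      (l0 β₀ : ℝ) ≤ η * n → (l0 β₀ : ℝ) ≤ n →
      (∃ l, IsOptimalRidge μ sqLoss (refitError X β₀ ε βhat) l) ∧
      ∀ l, IsOptimalRidge μ sqLoss (refitError X β₀ ε βhat) l →
        risk μ sqLoss (refitError X β₀ ε βhat l) ≤ zeroRiskConst σ c * (l0 β₀ / n) ∧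
        (ptilde n p ^ (1 / 2 - c₂ ^ 2 / (4 * σ ^ 2)) * l2 β₀ ^ 4
            ≤ K * ((l0 β₀ : ℝ) ^ 2 / (n : ℝ) ^ 2) →
          (∃ L, l0 β₀ * σ ^ 2 / l2 β₀ ^ 2
                * (minEig (gram X (supp β₀)) / maxEig (gram X (supp β₀))) ^ 2 ≤ L ∧
              L ≤ l0 β₀ * σ ^ 2 / l2 β₀ ^ 2
                * (maxEig (gram X (supp β₀)) / minEig (gram X (supp β₀))) ^ 2 ∧
              L ≤ C * (l0 β₀ / l2 β₀ ^ 2) ∧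
              |l - L| ≤ C * ((l0 β₀ : ℝ) ^ 2 / (n * l2 β₀ ^ 4))) ∧
          ∀ P d, IsEigendecomposition (gram X (supp β₀)) P d →
            ∑ j, (l ^ 2 * rotated β₀ P j ^ 2 + d j * σ ^ 2) / (d j + l) ^ 2
                ≤ C * (l0 β₀ / n) ∧
            |risk μ sqLoss (refitError X β₀ ε βhat l)
                - ∑ j, (l ^ 2 * rotated β₀ P j ^ 2 + d j * σ ^ 2) / (d j + l) ^ 2|
              ≤ C * ((l0 β₀ : ℝ) ^ 2 / ((n : ℝ) ^ 2 * l2 β₀ ^ 2))) := by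
  obtain ⟨C, hC, η, hη, h⟩ := quadratic_risk.{u} hσ hc hc₂ hc₃ hb hK one_pos one_pos one_pos
    (zeroRiskConst_pos (σ := σ) hc)
  refine ⟨C, hC, η, hη, ?_⟩
  intro n p Ω _ pen μ X β₀ ε lam βhat hpen H hn hs hs'
  have key := fun (P : Matrix (supp β₀) (supp β₀) ℝ) (d : supp β₀ → ℝ)
      (hP : IsEigendecomposition (gram X (supp β₀)) P d) =>
    h (A := (1 : Matrix (Fin p) (Fin p) ℝ)) (w := fun _ => 1) hpen H hn hP
      (fun u _ => by rw [one_mulVec, one_mul])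
      (fun v hv => by rw [← sqLoss_eq_quadLoss]; exact sqLoss_eq_sum_rotated hP hv)
      (fun _ => le_rfl) (fun _ => le_rfl)
      (by rw [← sqLoss_eq_quadLoss]; exact risk_sqLoss_zero_le hσ hc hc₂ hb hpen H hn) hs hs'
  rw [← sqLoss_eq_quadLoss] at key
  obtain ⟨P₀, d₀, hP₀⟩ := exists_isEigendecomposition (gram_transpose X (supp β₀))
  refine ⟨(key P₀ d₀ hP₀).1, fun l hl => ⟨((key P₀ d₀ hP₀).2 l hl).1, fun hlevel => ⟨?_, ?_⟩⟩⟩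
  · obtain ⟨h1, h2, -⟩ := ((key P₀ d₀ hP₀).2 l hl).2 hlevel
    have hd := H.eigenvalue_mem hc hn hP₀
    obtain ⟨j₀, hj₀⟩ := Finset.card_pos.1 (H.one_le_l0 hb)
    have hlm := (hd ⟨j₀, hj₀⟩).1
    have hlM := hlm.trans_le ((hd ⟨j₀, hj₀⟩).2.1.trans (hd ⟨j₀, hj₀⟩).2.2)
    have hm := leadOpt_mem (σ := σ) (w := fun _ => (1 : ℝ))
      (r₀ := 1 / maxEig (gram X (supp β₀)) ^ 2) (r₁ := 1 / minEig (gram X (supp β₀)) ^ 2)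
      (by positivity) (by positivity)
      (fun j => one_div_le_one_div_of_le (pow_pos (hlm.trans_le (hd j).2.1) 2)
        (pow_le_pow_left₀ (hlm.le.trans (hd j).2.1) (hd j).2.2 2))
      (fun j => one_div_le_one_div_of_le (by positivity)
        (pow_le_pow_left₀ hlm.le (hd j).2.1 2))
      (hb.trans_le H.norm_lower) (sum_rotated_sq hP₀)
    rw [Fintype.card_coe, ← l0, div_div_div_cancel_left' _ _ one_ne_zero,
      div_div_div_cancel_left' _ _ one_ne_zero, ← div_pow, ← div_pow] at hm
    exact ⟨_, hm.1, hm.2, h1, h2⟩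
  · intro P d hP
    obtain ⟨-, -, h3, h4⟩ := ((key P d hP).2 l hl).2 hlevel
    simp only [leadRisk, one_mul] at h3 h4
    exact ⟨h3, h4⟩

/-- `quadratic_risk` for the prediction loss, whose weights in the eigenbasis are `d j / n`. -/
theorem predLoss_risk {σ c c₂ c₃ b K : ℝ} (hσ : 0 < σ) (hc : 0 < c) (hc₂ : √10 * σ ≤ c₂)
    (hc₃ : 0 < c₃) (hb : 0 < b) (hK : 0 < K) :
    ∃ C : ℝ, 0 < C ∧ ∃ η : ℝ, 0 < η ∧ ∀ {n p : ℕ} {Ω : Type u} [MeasurableSpace Ω]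
      {pen : ℝ → ℝ → ℝ} {μ : Measure Ω} {X : Matrix (Fin n) (Fin p) ℝ} {β₀ : Fin p → ℝ}
      {ε : Ω → Fin n → ℝ} {lam : ℝ} {βhat : Ω → Fin p → ℝ},
      (pen = hardPenalty ∨ pen = l0Penalty) →
      Conditions σ c c₂ c₃ b pen μ X β₀ ε lam βhat → 0 < n →
      (l0 β₀ : ℝ) ≤ η * n → (l0 β₀ : ℝ) ≤ n →
      (∃ l, IsOptimalRidge μ (predLoss X) (refitError X β₀ ε βhat) l) ∧
      ∀ l, IsOptimalRidge μ (predLoss X) (refitError X β₀ ε βhat) l →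
        risk μ (predLoss X) (refitError X β₀ ε βhat l) ≤ zeroRiskConst σ c * (l0 β₀ / n) ∧
        (ptilde n p ^ (1 / 2 - c₂ ^ 2 / (4 * σ ^ 2)) * l2 β₀ ^ 4
            ≤ K * ((l0 β₀ : ℝ) ^ 2 / (n : ℝ) ^ 2) →
          (∃ L, l0 β₀ * σ ^ 2 / l2 β₀ ^ 2
                * (minEig (gram X (supp β₀)) / maxEig (gram X (supp β₀))) ≤ L ∧
              L ≤ l0 β₀ * σ ^ 2 / l2 β₀ ^ 2
                * (maxEig (gram X (supp β₀)) / minEig (gram X (supp β₀))) ∧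
              L ≤ C * (l0 β₀ / l2 β₀ ^ 2) ∧
              |l - L| ≤ C * ((l0 β₀ : ℝ) ^ 2 / (n * l2 β₀ ^ 4))) ∧
          ∀ P d, IsEigendecomposition (gram X (supp β₀)) P d →
            (n : ℝ)⁻¹ * ∑ j, (l ^ 2 * rotated β₀ P j ^ 2 * d j + d j ^ 2 * σ ^ 2)
                / (d j + l) ^ 2 ≤ C * (l0 β₀ / n) ∧
            |risk μ (predLoss X) (refitError X β₀ ε βhat l)
                - (n : ℝ)⁻¹ * ∑ j, (l ^ 2 * rotated β₀ P j ^ 2 * d j + d j ^ 2 * σ ^ 2)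
                  / (d j + l) ^ 2|
              ≤ C * ((l0 β₀ : ℝ) ^ 2 / ((n : ℝ) ^ 2 * l2 β₀ ^ 2))) := by
  obtain ⟨C, hC, η, hη, h⟩ := quadratic_risk.{u} hσ hc hc₂ hc₃ hb hK hc₃ (pow_pos hc 2)
    (pow_pos hc₃ 2) (zeroRiskConst_pos (σ := σ) hc)
  refine ⟨C, hC, η, hη, ?_⟩
  intro n p Ω _ pen μ X β₀ ε lam βhat hpen H hn hs hs'
  have hn' : (0 : ℝ) < n := by exact_mod_cast hn
  have key := fun (P : Matrix (supp β₀) (supp β₀) ℝ) (d : supp β₀ → ℝ)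
      (hP : IsEigendecomposition (gram X (supp β₀)) P d) =>
    h (A := (√(n : ℝ))⁻¹ • X) (w := fun j => (n : ℝ)⁻¹ * d j) hpen H hn hP
      (fun u hu => by
        rw [smul_mulVec, l2_smul, abs_of_nonneg (by positivity)]
        have h1 := sparse_upper_le hn H.sparse_upper hu
        rw [inv_mul_le_iff₀ (Real.sqrt_pos.2 hn')]
        linarith)
      (fun v hv => by rw [← predLoss_eq_quadLoss]; exact predLoss_eq_sum_rotated hP hv)
      (fun j => by
        have h1 := (H.eigenvalue_bounds hc hn (hP.hasEigenvalue j)).1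
        rw [le_inv_mul_iff₀ hn']
        linarith)
      (fun j => by
        have h1 := (H.eigenvalue_bounds hc hn (hP.hasEigenvalue j)).2
        rw [inv_mul_le_iff₀ hn']
        linarith)
      (by rw [← predLoss_eq_quadLoss]; exact risk_predLoss_zero_le hσ hc hc₂ hb hpen H hn) hs hs'
  rw [← predLoss_eq_quadLoss] at key
  obtain ⟨P₀, d₀, hP₀⟩ := exists_isEigendecomposition (gram_transpose X (supp β₀))
  refine ⟨(key P₀ d₀ hP₀).1, fun l hl => ⟨((key P₀ d₀ hP₀).2 l hl).1, fun hlevel => ⟨?_, ?_⟩⟩⟩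
  · obtain ⟨h1, h2, -⟩ := ((key P₀ d₀ hP₀).2 l hl).2 hlevel
    have hd := H.eigenvalue_mem hc hn hP₀
    obtain ⟨j₀, hj₀⟩ := Finset.card_pos.1 (H.one_le_l0 hb)
    have hlm := (hd ⟨j₀, hj₀⟩).1
    have hlM := hlm.trans_le ((hd ⟨j₀, hj₀⟩).2.1.trans (hd ⟨j₀, hj₀⟩).2.2)
    have e : ∀ j, (n : ℝ)⁻¹ * d₀ j / d₀ j ^ 2 = (n : ℝ)⁻¹ / d₀ j := fun j => by
      have := (hlm.trans_le (hd j).2.1).ne'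
      field_simp
    have hm := leadOpt_mem (σ := σ) (w := fun j => (n : ℝ)⁻¹ * d₀ j)
      (r₀ := (n : ℝ)⁻¹ / maxEig (gram X (supp β₀)))
      (r₁ := (n : ℝ)⁻¹ / minEig (gram X (supp β₀))) (by positivity) (by positivity)
      (fun j => by
        rw [e]
        exact div_le_div_of_nonneg_left (by positivity) (hlm.trans_le (hd j).2.1) (hd j).2.2)
      (fun j => by
        rw [e]
        exact div_le_div_of_nonneg_left (by positivity) hlm (hd j).2.1)
      (hb.trans_le H.norm_lower) (sum_rotated_sq hP₀)
    rw [Fintype.card_coe, ← l0, div_div_div_cancel_left' _ _ (inv_ne_zero hn'.ne'),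
      div_div_div_cancel_left' _ _ (inv_ne_zero hn'.ne')] at hm
    exact ⟨_, hm.1, hm.2, h1, h2⟩
  · intro P d hP
    obtain ⟨-, -, h3, h4⟩ := ((key P d hP).2 l hl).2 hlevel
    have e : (n : ℝ)⁻¹ * ∑ j, (l ^ 2 * rotated β₀ P j ^ 2 * d j + d j ^ 2 * σ ^ 2)
        / (d j + l) ^ 2 = leadRisk d (fun j => (n : ℝ)⁻¹ * d j) (rotated β₀ P) σ l := by
      rw [leadRisk, Finset.mul_sum]
      exact Finset.sum_congr rfl fun j _ => by ring
    rw [e]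
    exact ⟨h3, h4⟩

end Quadratic

/-- As `s ≥ 1`, the condition `s = o(n)` entails `n → ∞`. -/
lemma tendsto_atTop_of_isLittleO {s n : ℕ → ℕ} (hs : ∀ k, 1 ≤ s k)
    (h : (fun k => (s k : ℝ)) =o[atTop] fun k => (n k : ℝ)) :
    Tendsto (fun k => (n k : ℝ)) atTop atTop := by
  have h1 : (fun _ : ℕ => (1 : ℝ)) =O[atTop] fun k => (s k : ℝ) :=
    Asymptotics.IsBigO.of_bound 1 (Eventually.of_forall fun k => by
      have : (1 : ℝ) ≤ s k := by exact_mod_cast hs k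
      simpa using this)
  simpa using (Asymptotics.isLittleO_one_left_iff ℝ).1 (h1.trans_isLittleO h)

end ThresholdedRegression

end

open ThresholdedRegression in
theorem theorem2 (σ c c₂ c₃ b K : ℝ) (hσ : 0 < σ) (hc : 0 < c) (hc₂ : √10 * σ ≤ c₂)
    (hc₃ : 0 < c₃) (hb : 0 < b) (hK : 0 < K) :
    ∃ C : ℝ, 0 < C ∧
      ∀ (pen : ℝ → ℝ → ℝ), (pen = hardPenalty ∨ pen = l0Penalty) →
      ∀ (n p : ℕ → ℕ) (Ω : ℕ → Type*) [∀ k, MeasurableSpace (Ω k)]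
        (μ : ∀ k, Measure (Ω k)) (X : ∀ k, Matrix (Fin (n k)) (Fin (p k)) ℝ)
        (β₀ : ∀ k, Fin (p k) → ℝ) (ε : ∀ k, Ω k → Fin (n k) → ℝ) (lam : ℕ → ℝ)
        (βhat : ∀ k, Ω k → Fin (p k) → ℝ),
        (∀ k, Conditions σ c c₂ c₃ b pen (μ k) (X k) (β₀ k) (ε k) (lam k) (βhat k)) →
        ((fun k => (l0 (β₀ k) : ℝ)) =o[atTop] (fun k => (n k : ℝ))) →
        ∀ᶠ k in atTop,
          let N : ℝ := n k
          let s : ℝ := l0 (β₀ k)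
          let B : ℝ := l2 (β₀ k)
          let err := refitError (X k) (β₀ k) (ε k) (βhat k)
          let lmin := minEig (gram (X k) (supp (β₀ k)))
          let lmax := maxEig (gram (X k) (supp (β₀ k)))
          -- `c₂` is large enough for the given level of signal strength
          let level : Prop := ptilde (n k) (p k) ^ (1 / 2 - c₂ ^ 2 / (4 * σ ^ 2)) * B ^ 4
            ≤ K * (s ^ 2 / N ^ 2)
          -- (a) the squared L₂-risk
          ((∃ l, IsOptimalRidge (μ k) sqLoss err l) ∧
            ∀ l, IsOptimalRidge (μ k) sqLoss err l →
              risk (μ k) sqLoss (err l) ≤ C * (s / N) + C * (s ^ 2 / (N ^ 2 * B ^ 2)) ∧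
              (level →
                (∃ L, s * σ ^ 2 / B ^ 2 * (lmin / lmax) ^ 2 ≤ L ∧
                  L ≤ s * σ ^ 2 / B ^ 2 * (lmax / lmin) ^ 2 ∧
                  L ≤ C * (s / B ^ 2) ∧ |l - L| ≤ C * (s ^ 2 / (N * B ^ 4))) ∧
                (∀ P d, IsEigendecomposition (gram (X k) (supp (β₀ k))) P d →
                  let lead := ∑ j, (l ^ 2 * rotated (β₀ k) P j ^ 2 + d j * σ ^ 2) / (d j + l) ^ 2
                  lead ≤ C * (s / N) ∧
                  |risk (μ k) sqLoss (err l) - lead| ≤ C * (s ^ 2 / (N ^ 2 * B ^ 2))))) ∧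
          -- (b) the L_q-risks and the L_∞-risk
          (∀ q : ℝ, 1 ≤ q → q ≤ 2 →
            ∃ l, IsOptimalRidge (μ k) (lqLoss q) err l ∧
              risk (μ k) (lqLoss q) (err l)
                ≤ C * (s / N ^ (q / 2)) + C * (s ^ 2 / (B ^ 2 * N ^ (q / 2 + 1)))) ∧
          (∃ l, IsOptimalRidge (μ k) supLoss err l ∧
            risk (μ k) supLoss (err l)
              ≤ C * (s ^ (1 / 2 : ℝ) / N ^ (1 / 2 : ℝ))
                + C * (s ^ (3 / 2 : ℝ) / (B ^ 2 * N ^ (3 / 2 : ℝ)))) ∧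
          -- (c) the prediction risk
          ((∃ l, IsOptimalRidge (μ k) (predLoss (X k)) err l) ∧
            ∀ l, IsOptimalRidge (μ k) (predLoss (X k)) err l →
              risk (μ k) (predLoss (X k)) (err l)
                ≤ C * (s / N) + C * (s ^ 2 / (N ^ 2 * B ^ 2)) ∧
              (level →
                (∃ L, s * σ ^ 2 / B ^ 2 * (lmin / lmax) ≤ L ∧
                  L ≤ s * σ ^ 2 / B ^ 2 * (lmax / lmin) ∧
                  L ≤ C * (s / B ^ 2) ∧ |l - L| ≤ C * (s ^ 2 / (N * B ^ 4))) ∧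
                (∀ P d, IsEigendecomposition (gram (X k) (supp (β₀ k))) P d →
                  let lead := N⁻¹ *
                    ∑ j, (l ^ 2 * rotated (β₀ k) P j ^ 2 * d j + d j ^ 2 * σ ^ 2) / (d j + l) ^ 2
                  lead ≤ C * (s / N) ∧
                  |risk (μ k) (predLoss (X k)) (err l) - lead|
                    ≤ C * (s ^ 2 / (N ^ 2 * B ^ 2))))) := by
  obtain ⟨C₁, hC₁, η₁, hη₁, h₁⟩ := sqLoss_risk hσ hc hc₂ hc₃ hb hK
  obtain ⟨C₂, hC₂, η₂, hη₂, h₂⟩ := predLoss_risk hσ hc hc₂ hc₃ hb hK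
  have hZ := zeroRiskConst_pos (σ := σ) hc
  have hc₂' : 0 < c₂ := lt_of_lt_of_le (by positivity) hc₂
  refine ⟨C₁ + C₂ + (3 + zeroRiskConst σ c), by positivity, ?_⟩
  intro pen hpen n p Ω _ μ X β₀ ε lam βhat H ho
  have hnt := tendsto_atTop_of_isLittleO (fun k => (H k).one_le_l0 hb) ho
  have hlog : Tendsto (fun k => c₂ * √(Real.log (n k))) atTop atTop :=
    (Real.tendsto_sqrt_atTop.comp (Real.tendsto_log_atTop.comp hnt)).const_mul_atTop hc₂'
  filter_upwards [hnt.eventually_gt_atTop 0, hlog.eventually_gt_atTop (3 + zeroRiskConst σ c),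
    ho.bound hη₁, ho.bound hη₂, ho.bound one_pos] with k hn hlarge e₁ e₂ e₃
  simp only [Real.norm_natCast, one_mul] at e₁ e₂ e₃
  replace hn : 0 < n k := by exact_mod_cast hn
  have hn' : (0 : ℝ) < n k := by exact_mod_cast hn
  have hB : 0 < l2 (β₀ k) := hb.trans_le (H k).norm_lower
  have hs0 : (0 : ℝ) ≤ l0 (β₀ k) := Nat.cast_nonneg _
  have h0 := risk_sqLoss_zero_le hσ hc hc₂ hb hpen (H k) hn
  obtain ⟨a₁, a₂⟩ := h₁ hpen (H k) hn e₁ e₃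
  obtain ⟨p₁, p₂⟩ := h₂ hpen (H k) hn e₂ e₃
  have hle : ∀ {y t A : ℝ}, A ≤ C₁ + C₂ + (3 + zeroRiskConst σ c) → 0 ≤ y → t ≤ A * y →
      t ≤ (C₁ + C₂ + (3 + zeroRiskConst σ c)) * y := fun h hy ht =>
    ht.trans (mul_le_mul_of_nonneg_right h hy)
  have hle' : ∀ {y z t A : ℝ}, A ≤ C₁ + C₂ + (3 + zeroRiskConst σ c) → 0 ≤ y → 0 ≤ z →
      t ≤ A * y → t ≤ (C₁ + C₂ + (3 + zeroRiskConst σ c)) * y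
        + (C₁ + C₂ + (3 + zeroRiskConst σ c)) * z := fun h hy hz ht =>
    (hle h hy ht).trans (le_add_of_nonneg_right (mul_nonneg (by positivity) hz))
  have hA₁ : C₁ ≤ C₁ + C₂ + (3 + zeroRiskConst σ c) := by linarith
  have hA₂ : C₂ ≤ C₁ + C₂ + (3 + zeroRiskConst σ c) := by linarith
  have hA₃ : zeroRiskConst σ c ≤ C₁ + C₂ + (3 + zeroRiskConst σ c) := by linarith
  intro N s B err lmin lmax level
  refine ⟨⟨a₁, fun l hl => ?_⟩, fun q hq hq2 => ?_, ?_, ⟨p₁, fun l hl => ?_⟩⟩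
  · obtain ⟨r₁, r₂⟩ := a₂ l hl
    refine ⟨hle' hA₃ (by positivity) (by positivity) r₁, fun hlevel => ?_⟩
    obtain ⟨⟨L, b₁, b₂, b₃, b₄⟩, r₃⟩ := r₂ hlevel
    exact ⟨⟨L, b₁, b₂, hle hA₁ (by positivity) b₃, hle hA₁ (by positivity) b₄⟩,
      fun P d hP => ⟨hle hA₁ (by positivity) (r₃ P d hP).1, hle hA₁ (by positivity) (r₃ P d hP).2⟩⟩
  · obtain ⟨l, hl, r⟩ := exists_optimal_lqLoss (H k) hpen hσ hc hc₂ hb hn hq hq2 hZ.le h0 hlarge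
    exact ⟨l, hl, hle' (by linarith) (by positivity) (by positivity) r⟩
  · obtain ⟨l, hl, r⟩ := exists_optimal_supLoss (H k) hc hc₂' hb hn hZ.le h0 hlarge
    rw [Real.sqrt_eq_rpow, Real.div_rpow hs0 hn'.le] at r
    exact ⟨l, hl, hle' (by linarith) (by positivity) (by positivity) r⟩
  · obtain ⟨r₁, r₂⟩ := p₂ l hl
    refine ⟨hle' hA₃ (by positivity) (by positivity) r₁, fun hlevel => ?_⟩
    obtain ⟨⟨L, b₁, b₂, b₃, b₄⟩, r₃⟩ := r₂ hlevel
    exact ⟨⟨L, b₁, b₂, hle hA₂ (by positivity) b₃, hle hA₂ (by positivity) b₄⟩,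
      fun P d hP => ⟨hle hA₂ (by positivity) (r₃ P d hP).1, hle hA₂ (by positivity) (r₃ P d hP).2⟩⟩
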